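/- Let $X\subset\mathbb R$ be a compact nondegenerate interval with Lebesgue measure $m$, let $T:X\to X$, let $\mathcal P=\{P_i\}$ be an at most countable family of pairwise disjoint nondegenerate intervals $P_i\subseteq X$, and let $\mu$ be a $T$-invariant Borel probability measure on $X$ with $\mu(X\setminus\bigcup_iP_i)=0$. An $n$-cylinder is a nonempty set $\bigcap_{k=0}^{n-1}T^{-k}P_{w_k}$, $\mathcal P_n$ is the family of all $n$-cylinders ($n\ge1$), and the repeller is $\Lambda=\{x\in X: T^kx\in\bigcup_iP_i\ \text{for all }k\ge0\}$. Derivatives are taken within the respective interval (one-sided at its endpoints). Assume the following. (1) (Piecewise expanding.) $T$ is differentiable on each $P_i$, and there is $\gamma>0$ with $|DT|>\gamma$ on each $P_i$. There is $C_{bd}>0$ with $C_{bd}^{-1}\le DT^n(x)/DT^n(y)\le C_{bd}$ for all $n\ge1$, $I\in\mathcal P_n$, $x,y\in I$. (2) (Gibbs–Markov.) $T$ is injective on each $P_i$, and for all $i,j$ either $P_j\subseteq T(P_i)$ or $P_j\cap T(P_i)=\emptyset$. There is $\theta\in(0,1)$ such that for each $i$, $\log g|_{P_i}$, $g=1/|DT|$,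 is Lipschitz on $P_i\cap\Lambda$ for the symbolic metric: for some $L_i$, $|\log g(x)-\log g(y)|\le L_i\theta^n$ whenever $x,y\in P_i\cap\Lambda$ lie in the same $n$-cylinder, $n\ge1$. If $\mathcal P$ is infinite, there is $\delta_0>0$ with $m(T^n(I))\ge\delta_0$ for all $n\ge1$, $I\in\mathcal P_n$; if $\mathcal P$ is finite, there is $\delta_0>0$ with $m(P_i)\ge\delta_0$ for all $i$. (3) (Gibbs measure.) There are a potential $\varphi:\Lambda\to\mathbb R$ and constants $M>0$, $\zeta\in(0,1)$, $c>0$, $Q\in\mathbb R$ such that $|\varphi(x)-\varphi(y)|\le M\zeta^k$ whenever $x,y\in\Lambda$ lie in the same $k$-cylinder, $k\ge1$ (i.e. $\varphi$ is locally Hölder), and $$c^{-1}\le\frac{\mu(I)}{\exp\big(-nQ+\sum_{k=0}^{n-1}\varphi(T^kx)\big)}\le c\qquad\text{for all } n\ge1,\ I\in\mathcal P_n,\ x\in I\cap\Lambda.$$ (4) (Exponential decay of correlations for $\mathcal{BV}$ against $L^1$.) There are $C_1,c_1>0$ such that for all $f:X\to\mathbb R$ of bounded variation, all $g\in L^1(\mu)$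 and all $n\ge0$, $$\Big|\int f\cdot g\circ T^n\,d\mu-\int f\,d\mu\int g\,d\mu\Big|\le C_1e^{-c_1n}\,\|f\|_{\mathcal{BV}}\,\|g\|_{L^1(\mu)},\qquad \|f\|_{\mathcal{BV}}=\|f\|_{L^1(m)}+TV(f).$$ Let $\underline D_2(\mu)$ and $\overline D_2(\mu)$ be the $\liminf$ and the $\limsup$, as $r\to0^+$, of $\dfrac{\log\int\mu(B(x,r))\,d\mu(x)}{\log r}$, and let $m_n(x)=\min_{0\le i<j\le n-1}|T^ix-T^jx|$ (with $\log 0=-\infty$). (a) If $\overline D_2(\mu)>0$, then for $\mu$-a.e. $x\in\Lambda$, $$\liminf_{n\to\infty}\frac{\log m_n(x)}{-\log n}\ge\frac2{\overline D_2(\mu)}.$$ (b) If $\mu$ is absolutely continuous with respect to $m$, then $\underline D_2(\mu)=\overline D_2(\mu)=1$, and, with $D_2(\mu)$ denoting this common value, for $\mu$-a.e. $x$, $$\lim_{n\to\infty}\frac{\log m_n(x)}{-\log n}=\frac2{D_2(\mu)}=2.$$ -/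

import Mathlib

open Set Filter Topology MeasureTheory
open scoped ENNReal

namespace GibbsMarkov

noncomputable section

/-- The `n`-cylinder `[w 0, …, w (n-1)]` of the family `P`: the points `x` with
`T^i x ∈ P (w i)` for `0 ≤ i < n`. Only the first `n` letters of `w` matter. -/
def cylinder {ι : Type*} (T : ℝ → ℝ) (P : ι → Set ℝ) (w : ℕ → ι) (n : ℕ) : Set ℝ :=
  {x | ∀ i < n, T^[i] x ∈ P (w i)}

/-- The repeller: the points of `X` whose whole orbit stays in the union of the
partition elements. -/
def repeller {ι : Type*} (X : Set ℝ) (T : ℝ → ℝ) (P : ι → Set ℝ) : Set ℝ :=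
  {x | x ∈ X ∧ ∀ k : ℕ, T^[k] x ∈ ⋃ i, P i}

/-- `T : X → X` is a piecewise expanding interval map with branches on the pairwise disjoint
nondegenerate intervals `P i ⊆ X`. Derivatives are taken within the intervals, hence one-sided
at endpoints. -/
structure IsPiecewiseExpanding {ι : Type*} (X : Set ℝ) (T : ℝ → ℝ) (P : ι → Set ℝ) : Prop where
  mapsTo : MapsTo T X X
  subset : ∀ i, P i ⊆ X
  interval : ∀ i, (P i).OrdConnected
  nondegenerate : ∀ i, (P i).Nontrivial
  disjoint : Pairwise fun i j => Disjoint (P i) (P j)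
  differentiable : ∀ i, DifferentiableOn ℝ T (P i)
  expanding : ∃ γ : ℝ, 0 < γ ∧ ∀ i, ∀ x ∈ P i, γ < |derivWithin T (P i) x|

/-- Bounded distortion of all iterates on cylinders. -/
def HasBoundedDistortion {ι : Type*} (T : ℝ → ℝ) (P : ι → Set ℝ) : Prop :=
  ∃ C : ℝ, 0 < C ∧ ∀ (n : ℕ) (w : ℕ → ι), 1 ≤ n →
    ∀ x ∈ cylinder T P w n, ∀ y ∈ cylinder T P w n,
      C⁻¹ ≤ derivWithin T^[n] (cylinder T P w n) x / derivWithin T^[n] (cylinder T P w n) y ∧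
      derivWithin T^[n] (cylinder T P w n) x / derivWithin T^[n] (cylinder T P w n) y ≤ C

/-- The Gibbs-Markov structure. The function `g = dm / d(m ∘ T)` is `1 / |T'|` on each branch, and
two points of the repeller have symbolic distance at most `θ ^ n` exactly when they share an
`n`-cylinder. -/
structure IsGibbsMarkov {ι : Type*} (X : Set ℝ) (T : ℝ → ℝ) (P : ι → Set ℝ) : Prop where
  markov : ∀ i j, P j ⊆ T '' P i ∨ Disjoint (P j) (T '' P i)
  injOn : ∀ i, InjOn T (P i)
  logLipschitz : ∃ θ : ℝ, 0 < θ ∧ θ < 1 ∧ ∀ i, ∃ L : ℝ, ∀ (n : ℕ) (w : ℕ → ι), 1 ≤ n → w 0 = i →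
    ∀ x ∈ cylinder T P w n ∩ repeller X T P, ∀ y ∈ cylinder T P w n ∩ repeller X T P,
      |Real.log (|derivWithin T (P i) x|⁻¹) - Real.log (|derivWithin T (P i) y|⁻¹)| ≤ L * θ ^ n
  bigImage : Infinite ι → ∃ δ : ℝ, 0 < δ ∧ ∀ (n : ℕ) (w : ℕ → ι), 1 ≤ n →
    (cylinder T P w n).Nonempty → ENNReal.ofReal δ ≤ volume (T^[n] '' cylinder T P w n)
  bigElements : Finite ι → ∃ δ : ℝ, 0 < δ ∧ ∀ i, ENNReal.ofReal δ ≤ volume (P i)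

/-- A potential on the repeller is locally Hölder if its `k`-th variation, the largest oscillation
over the `k`-cylinders, decays exponentially in `k ≥ 1`. -/
def IsLocallyHolder {ι : Type*} (X : Set ℝ) (T : ℝ → ℝ) (P : ι → Set ℝ) (φ : ℝ → ℝ) : Prop :=
  ∃ M ζ : ℝ, 0 < M ∧ 0 < ζ ∧ ζ < 1 ∧ ∀ (k : ℕ) (w : ℕ → ι), 1 ≤ k →
    ∀ x ∈ cylinder T P w k ∩ repeller X T P, ∀ y ∈ cylinder T P w k ∩ repeller X T P,
      |φ x - φ y| ≤ M * ζ ^ k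

/-- `μ` is an invariant Gibbs probability measure on `X`, with respect to some locally Hölder
potential `φ`; the `P i` form a partition of `X` up to a `μ`-null set. -/
structure IsGibbsMeasure {ι : Type*} (X : Set ℝ) (T : ℝ → ℝ) (P : ι → Set ℝ)
    (μ : Measure ℝ) : Prop where
  prob : IsProbabilityMeasure μ
  support : μ Xᶜ = 0
  partition : μ (X \ ⋃ i, P i) = 0
  invariant : MeasurePreserving T μ μ
  gibbs : ∃ φ : ℝ → ℝ, IsLocallyHolder X T P φ ∧ ∃ c Q : ℝ, 0 < c ∧
    ∀ (n : ℕ) (w : ℕ → ι), 1 ≤ n → ∀ x ∈ cylinder T P w n ∩ repeller X T P,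
      c⁻¹ ≤ μ.real (cylinder T P w n) / Real.exp (-(n * Q) + birkhoffSum T φ n x) ∧
      μ.real (cylinder T P w n) / Real.exp (-(n * Q) + birkhoffSum T φ n x) ≤ c

/-- The norm `‖f‖_BV = ‖f‖_1 + TV(f)` on `X`, for `f` of bounded variation on `X`. -/
def bvNorm (X : Set ℝ) (f : ℝ → ℝ) : ℝ :=
  (∫ x in X, |f x|) + (eVariationOn f X).toReal

/-- Exponential decay of correlations for `BV` against `L^1(μ)` observables. -/
def HasExpDecay (X : Set ℝ) (T : ℝ → ℝ) (μ : Measure ℝ) : Prop :=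
  ∃ C c : ℝ, 0 < C ∧ 0 < c ∧ ∀ f g : ℝ → ℝ, BoundedVariationOn f X → Integrable g μ → ∀ n : ℕ,
    |(∫ x, f x * g (T^[n] x) ∂μ) - (∫ x, f x ∂μ) * ∫ x, g x ∂μ| ≤
      bvNorm X f * (∫ x, |g x| ∂μ) * (C * Real.exp (-(c * n)))

/-- The quotient `log ∫ μ(B(x,r)) dμ(x) / log r`, as an extended real. -/
def corrRatio (μ : Measure ℝ) (r : ℝ) : EReal :=
  ENNReal.log (∫⁻ x, μ (Metric.ball x r) ∂μ) / ((Real.log r : ℝ) : EReal)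

/-- The lower correlation dimension. -/
def lowerCorrDim (μ : Measure ℝ) : EReal := liminf (corrRatio μ) (𝓝[>] 0)

/-- The upper correlation dimension. -/
def upperCorrDim (μ : Measure ℝ) : EReal := limsup (corrRatio μ) (𝓝[>] 0)

/-- `m_n(x)`, the smallest distance between two of the first `n` iterates of `x`
(a minimum over finitely many pairs when `n ≥ 2`). -/
def closestDist (T : ℝ → ℝ) (n : ℕ) (x : ℝ) : ℝ≥0∞ :=
  ⨅ (i : ℕ) (j : ℕ) (_ : i < j ∧ j < n), edist (T^[i] x) (T^[j] x)

/-- The quotient `log m_n(x) / (-log n)`, as an extended real; it is `+∞` if `m_n(x) = 0` and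
`n ≥ 2`. -/
def closestRatio (T : ℝ → ℝ) (x : ℝ) (n : ℕ) : EReal :=
  ENNReal.log (closestDist T n x) / ((-Real.log n : ℝ) : EReal)

end

end GibbsMarkov

/-!
The orbit of a typical point is compared with an independent sample of the Gibbs measure `μ`: by the
birthday problem, `n` independent points are likely to contain two within distance `r` when
`n ^ 2` times the correlation integral at scale `r` is large, and unlikely to when it is small.

**Lower bound.** Only an inequality of mixing type is needed. The Gibbs property makes `μ`
quasi-Bernoulli (`exists_quasiBernoulli`): concatenating admissible cylinders multiplies measures up
to a constant. An image `T^N I` of an `N`-cylinder `I` is an interval, of measure bounded below, so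
decay of correlations for its indicator shows that it meets `T^{-g} K` in a fixed proportion of
`μ K`, for a gap `g` independent of everything. Thus, conditionally on the first `N` letters, the
law of the orbit after time `N + g` dominates `κ μ` (`exists_lower_mixing`). Such a domination
suffices for the birthday problem (`HasLowerMixing.measure_distinct_le`): conditionally on the first
half of the samples, each sample of the second half hits one of their cells with probability at
least `κ` times the total mass of these cells. The cells have to depend on few letters. This holds
because cylinders of positive measure shrink exponentially fast (`exists_diam_bound`), which follows
from uniform shrinking (`exists_forall_cylinder_volume_lt`) and distortion. If uniform shrinking
failed, then a compactness and pigeonhole argument would give a periodic word all of whose cylinders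
are long, and almost every point of one of them would follow that word forever, whereas the points
with a given itinerary form a null set by mixing (`measure_iInter_cylinder_eq_zero`). At scale
`r = n ^ (-s)` a sample consumes `O(log n)` letters, which leaves `n / log n` samples, enough if
`s < 2 / d` and the correlation integral is at least `r ^ d`. The probability of failure is summable
along `n = 2 ^ l`, and the Borel-Cantelli lemma applies (`ae_eventually_closestDist_le`).

**Absolutely continuous case.** Distortion and mixing bound the density of `μ`
(`exists_bounded_density`), so the correlation integral is at most of order `r`; it is at least of
order `r` by the Cauchy-Schwarz inequality, and the dimension is `1`. For the upper bound, it
suffices that `μ {x | |T^k x - x| < r} ≤ C r` uniformly in `k ≥ 1` (`exists_measure_return_le`),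
since then a union bound over fewer than `n ^ 2` pairs of times is summable along `n = 2 ^ l` for
`r = n ^ (-s)` with `s > 2`. If `k` is large, then all relevant cylinders are short, `T^k` expands
them strongly, and each contains returning points only in a proportion of order `r`. On a long
cylinder `T^k` might be close to the identity, but it is Lipschitz there, so that away from the
endpoints of the cylinder a return at time `k` entails one at time `2 k`, and `k` can be doubled
until it is large.
-/

namespace GibbsMarkov

/-! ### Cylinders as intervals and images of cylinders -/

section Cylinders

variable {ι : Type*} {X : Set ℝ} {T : ℝ → ℝ} {P : ι → Set ℝ}

lemma ordConnected_inter_preimage {s t : Set ℝ} {f : ℝ → ℝ} (hs : s.OrdConnected)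
    (hf : ContinuousOn f s) (hi : InjOn f s) (ht : t.OrdConnected) :
    (s ∩ f ⁻¹' t).OrdConnected := by
  refine ordConnected_of_Ioo ?_
  rintro x ⟨hxs, hxt⟩ y ⟨hys, hyt⟩ hxy z hz
  have hsub : Icc x y ⊆ s := hs.out hxs hys
  have hz' : z ∈ Icc x y := ⟨hz.1.le, hz.2.le⟩
  refine ⟨hsub hz', ht.uIcc_subset hxt hyt ?_⟩
  rcases (hf.mono hsub).strictMonoOn_of_injOn_Icc' hxy.le (hi.mono hsub) with h | h
  · exact mem_uIcc_of_le (h.monotoneOn (left_mem_Icc.2 hxy.le) hz' hz'.1)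
      (h.monotoneOn hz' (right_mem_Icc.2 hxy.le) hz'.2)
  · exact mem_uIcc_of_ge (h.antitoneOn hz' (right_mem_Icc.2 hxy.le) hz'.2)
      (h.antitoneOn (left_mem_Icc.2 hxy.le) hz' hz'.1)

lemma cylinder_zero (w : ℕ → ι) : cylinder T P w 0 = univ := by
  ext x; simp [cylinder]

lemma cylinder_one (w : ℕ → ι) : cylinder T P w 1 = P (w 0) := by
  ext x; simp [cylinder]

lemma cylinder_add (w : ℕ → ι) (m n : ℕ) : cylinder T P w (m + n) =
    cylinder T P w m ∩ T^[m] ⁻¹' cylinder T P (fun i => w (m + i)) n := by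
  ext x
  simp only [cylinder, mem_ofPred_eq, mem_inter_iff, mem_preimage, ← Function.iterate_add_apply]
  constructor
  · exact fun h => ⟨fun i hi => h i (by omega), fun i hi => by
      rw [Nat.add_comm i m]; exact h _ (by omega)⟩
  · rintro ⟨h1, h2⟩ i hi
    rcases lt_or_ge i m with h | h
    · exact h1 i h
    · obtain ⟨k, rfl⟩ := Nat.exists_eq_add_of_le h
      have := h2 k (by omega)
      rwa [Nat.add_comm k m] at this

lemma cylinder_succ (w : ℕ → ι) (n : ℕ) : cylinder T P w (n + 1) =
    P (w 0) ∩ T ⁻¹' cylinder T P (fun i => w (i + 1)) n := by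
  rw [Nat.add_comm n 1, cylinder_add, cylinder_one]
  simp only [Function.iterate_one, Nat.add_comm]

lemma cylinder_anti (w : ℕ → ι) {m n : ℕ} (h : m ≤ n) :
    cylinder T P w n ⊆ cylinder T P w m := fun _ hx i hi => hx i (hi.trans_le h)

lemma cylinder_congr {w w' : ℕ → ι} {n : ℕ} (h : ∀ i < n, w i = w' i) :
    cylinder T P w n = cylinder T P w' n := by
  ext x
  exact forall₂_congr fun i hi => by rw [h i hi]

lemma IsPiecewiseExpanding.eq_of_mem (hT : IsPiecewiseExpanding X T P) {i j : ι} {x : ℝ}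
    (hi : x ∈ P i) (hj : x ∈ P j) : i = j := by
  by_contra h
  exact disjoint_left.1 (hT.disjoint h) hi hj

lemma IsPiecewiseExpanding.cylinder_subset (hT : IsPiecewiseExpanding X T P) (w : ℕ → ι) {n : ℕ}
    (hn : 1 ≤ n) : cylinder T P w n ⊆ X := fun _ hx => hT.subset _ (hx 0 hn)

lemma IsPiecewiseExpanding.differentiableOn_iterate (hT : IsPiecewiseExpanding X T P) (n : ℕ) :
    ∀ w : ℕ → ι, DifferentiableOn ℝ T^[n] (cylinder T P w n) := by
  induction n with
  | zero => intro w; exact differentiableOn_id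
  | succ n ih =>
    intro w
    rw [cylinder_succ, Function.iterate_succ]
    exact (ih _).comp ((hT.differentiable _).mono inter_subset_left) fun x hx => hx.2

lemma IsGibbsMarkov.injOn_iterate (hG : IsGibbsMarkov X T P) (n : ℕ) :
    ∀ w : ℕ → ι, InjOn T^[n] (cylinder T P w n) := by
  induction n with
  | zero => intro w; exact Function.injective_id.injOn
  | succ n ih =>
    intro w
    rw [cylinder_succ, Function.iterate_succ]
    exact (ih _).comp ((hG.injOn _).mono inter_subset_left) fun x hx => hx.2

lemma ordConnected_cylinder (hT : IsPiecewiseExpanding X T P) (hG : IsGibbsMarkov X T P) (n : ℕ) :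
    ∀ w : ℕ → ι, (cylinder T P w n).OrdConnected := by
  induction n with
  | zero => intro w; rw [cylinder_zero]; exact ordConnected_univ
  | succ n ih =>
    intro w
    rw [cylinder_succ]
    exact ordConnected_inter_preimage (hT.interval _) (hT.differentiable _).continuousOn
      (hG.injOn _) (ih _)

lemma measurableSet_cylinder (hT : IsPiecewiseExpanding X T P) (hG : IsGibbsMarkov X T P) (n : ℕ)
    (w : ℕ → ι) : MeasurableSet (cylinder T P w n) :=
  (ordConnected_cylinder hT hG n w).measurableSet

/-- The Markov property for cylinders: an iterate maps a cylinder onto the whole cylinder of the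
remaining letters. -/
lemma image_cylinder_add (hG : IsGibbsMarkov X T P) {n : ℕ} (hn : 1 ≤ n) (k : ℕ) :
    ∀ w : ℕ → ι, (cylinder T P w (k + n)).Nonempty →
      T^[k] '' cylinder T P w (k + n) = cylinder T P (fun i => w (k + i)) n := by
  induction k with
  | zero => intro w _; simp
  | succ k ih =>
    intro w hne
    have hmark : P (w 1) ⊆ T '' P (w 0) := by
      refine (hG.markov (w 0) (w 1)).resolve_right fun hd => ?_
      obtain ⟨x, hx⟩ := hne
      exact disjoint_left.1 hd (hx 1 (by omega)) ⟨x, hx 0 (by omega), rfl⟩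
    have hstep : T '' cylinder T P w (k + 1 + n) = cylinder T P (fun i => w (i + 1)) (k + n) := by
      rw [Nat.add_right_comm, cylinder_succ, image_inter_preimage, inter_eq_right]
      exact fun x hx => hmark (hx 0 (by omega))
    rw [Function.iterate_succ, image_comp, hstep, ih _ (hstep ▸ hne.image T)]
    simp only [Nat.add_right_comm]

lemma image_iterate_cylinder (hG : IsGibbsMarkov X T P) {n : ℕ} (hn : 1 ≤ n) (w : ℕ → ι)
    (hne : (cylinder T P w n).Nonempty) :
    T^[n] '' cylinder T P w n = T '' P (w (n - 1)) := by
  obtain ⟨k, rfl⟩ := Nat.exists_eq_add_of_le' hn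
  rw [Function.iterate_succ', image_comp, image_cylinder_add hG le_rfl k w hne, cylinder_one]
  simp

lemma IsPiecewiseExpanding.ordConnected_image (hT : IsPiecewiseExpanding X T P) (i : ι) :
    (T '' P i).OrdConnected :=
  ((hT.interval i).isPreconnected.image _ (hT.differentiable i).continuousOn).ordConnected

lemma volume_image_eq_lintegral {I A : Set ℝ} {f : ℝ → ℝ} (hf : DifferentiableOn ℝ f I)
    (hi : InjOn f I) (hA : MeasurableSet A) (hAI : A ⊆ I) :
    volume (f '' A) = ∫⁻ x in A, ENNReal.ofReal |derivWithin f I x| := by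
  have := lintegral_image_eq_lintegral_abs_deriv_mul hA
    (fun x hx => ((hf x (hAI hx)).hasDerivWithinAt.mono hAI)) (hi.mono hAI) (fun _ => 1)
  simpa using this

/-- Iterates map cylinders onto intervals whose length is bounded below: for an infinite
partition this is assumed, for a finite one it follows from the Markov property. -/
lemma exists_le_volume_image (hT : IsPiecewiseExpanding X T P) (hG : IsGibbsMarkov X T P) :
    ∃ δ : ℝ, 0 < δ ∧ ∀ (n : ℕ) (w : ℕ → ι), 1 ≤ n → (cylinder T P w n).Nonempty →
      ENNReal.ofReal δ ≤ volume (T^[n] '' cylinder T P w n) := by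
  cases finite_or_infinite ι with
  | inr h => exact hG.bigImage h
  | inl h =>
    obtain ⟨δ, hδ, hP⟩ := hG.bigElements h
    obtain ⟨γ, hγ, hD⟩ := hT.expanding
    refine ⟨γ * δ, by positivity, fun n w hn hne => ?_⟩
    rw [image_iterate_cylinder hG hn w hne, volume_image_eq_lintegral (hT.differentiable _)
      (hG.injOn _) (hT.interval _).measurableSet subset_rfl, ENNReal.ofReal_mul hγ.le]
    calc ENNReal.ofReal γ * ENNReal.ofReal δ
        ≤ ENNReal.ofReal γ * volume (P (w (n - 1))) := by gcongr; exact hP _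
      _ = ∫⁻ x in P (w (n - 1)), ENNReal.ofReal γ := by rw [setLIntegral_const]
      _ ≤ _ := setLIntegral_mono' (hT.interval _).measurableSet fun x hx =>
          ENNReal.ofReal_le_ofReal (hD _ x hx).le

lemma exists_slope_eq {I : Set ℝ} (hI : I.OrdConnected) {f : ℝ → ℝ} (hf : DifferentiableOn ℝ f I)
    {x y : ℝ} (hx : x ∈ I) (hy : y ∈ I) :
    ∃ z ∈ I, |f x - f y| = |derivWithin f I z| * |x - y| := by
  wlog hxy : x < y generalizing x y
  · rcases eq_or_lt_of_le (not_lt.1 hxy) with rfl | h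
    · exact ⟨y, hx, by simp⟩
    · obtain ⟨z, hz, h⟩ := this hy hx h
      exact ⟨z, hz, by rw [abs_sub_comm (f x), abs_sub_comm x, h]⟩
  have hsub : Icc x y ⊆ I := hI.out hx hy
  obtain ⟨z, hz, h⟩ := exists_deriv_eq_slope f hxy (hf.continuousOn.mono hsub)
    (hf.mono (Ioo_subset_Icc_self.trans hsub))
  have hz' : I ∈ 𝓝 z := mem_of_superset (Icc_mem_nhds hz.1 hz.2) hsub
  refine ⟨z, mem_of_mem_nhds hz', ?_⟩
  rw [derivWithin_of_mem_nhds hz', h, abs_div, abs_sub_comm x, abs_sub_comm (f x),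
    div_mul_cancel₀ _ (by simpa [sub_eq_zero] using hxy.ne')]

/-- Bounded distortion together with large images: up to a uniform factor, `T^n` acts on an
`n`-cylinder `I` like the affine map of slope `1 / m(I)`, both on distances and on lengths. -/
lemma exists_distortion {a b : ℝ} (hT : IsPiecewiseExpanding (Icc a b) T P)
    (hD : HasBoundedDistortion T P) (hG : IsGibbsMarkov (Icc a b) T P) :
    ∃ K : ℝ, 0 < K ∧ ∀ (n : ℕ) (w : ℕ → ι), 1 ≤ n →
      (∀ x ∈ cylinder T P w n, ∀ y ∈ cylinder T P w n,
        |x - y| ≤ K * volume.real (cylinder T P w n) * |T^[n] x - T^[n] y| ∧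
        volume.real (cylinder T P w n) * |T^[n] x - T^[n] y| ≤ K * |x - y|) ∧
      (∀ A ⊆ cylinder T P w n, MeasurableSet A →
        volume.real A ≤ K * volume.real (cylinder T P w n) * volume.real (T^[n] '' A) ∧
        volume.real (cylinder T P w n) * volume.real (T^[n] '' A) ≤ K * volume.real A) := by
  obtain ⟨C, hC, hdist⟩ := hD
  obtain ⟨δ, hδ, hbig⟩ := exists_le_volume_image hT hG
  set K : ℝ := max (C / δ) (C * (b - a)) with hK
  have hK0 : 0 < K := lt_max_of_lt_left (by positivity)
  refine ⟨K * (1 + C), by positivity, fun n w hn => ?_⟩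
  set I := cylinder T P w n with hI
  set D : ℝ → ℝ := fun x => |derivWithin T^[n] I x| with hDdef
  have hIm : MeasurableSet I := measurableSet_cylinder hT hG n w
  have hIX : I ⊆ Icc a b := hT.cylinder_subset w hn
  have hfin : ∀ A ⊆ Icc a b, volume A ≠ ∞ := fun A hA =>
    ((measure_mono hA).trans_lt (by simp)).ne
  have hTX : ∀ A ⊆ I, T^[n] '' A ⊆ Icc a b := fun A hA =>
    image_subset_iff.2 fun x hx => hT.mapsTo.iterate n (hIX (hA hx))
  have hdif : DifferentiableOn ℝ T^[n] I := hT.differentiableOn_iterate n w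
  have hinj : InjOn T^[n] I := hG.injOn_iterate n w
  have hcomp : ∀ x ∈ I, ∀ y ∈ I, D x ≤ C * D y := fun x hx y hy => by
    have h := hdist n w hn x hx y hy
    have hpos : 0 < derivWithin T^[n] I x / derivWithin T^[n] I y :=
      (inv_pos.2 hC).trans_le h.1
    have hy0 : derivWithin T^[n] I y ≠ 0 := fun h0 => by simp [h0] at hpos
    have := h.2
    rw [← abs_of_pos hpos, abs_div, div_le_iff₀ (abs_pos.2 hy0)] at this
    exact this
  have hvol : ∀ A ⊆ I, MeasurableSet A → ∀ x ∈ I,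
      volume.real (T^[n] '' A) ≤ C * D x * volume.real A ∧
      D x * volume.real A ≤ C * volume.real (T^[n] '' A) := fun A hA hAm x hx => by
    have hAv := hfin A (hA.trans hIX)
    have hTv := hfin _ (hTX A hA)
    have heq := volume_image_eq_lintegral hdif hinj hAm hA
    have hDx : 0 ≤ D x := abs_nonneg _
    constructor
    · have h : volume (T^[n] '' A) ≤ ENNReal.ofReal (C * D x) * volume A := by
        rw [heq, ← setLIntegral_const]
        exact setLIntegral_mono' hAm fun y hy => ENNReal.ofReal_le_ofReal (hcomp y (hA hy) x hx)
      have := ENNReal.toReal_mono (ENNReal.mul_ne_top ENNReal.ofReal_ne_top hAv) h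
      rwa [ENNReal.toReal_mul, ENNReal.toReal_ofReal (by positivity)] at this
    · have h : ENNReal.ofReal (D x) * volume A ≤ ENNReal.ofReal C * volume (T^[n] '' A) := by
        rw [heq, ← setLIntegral_const, ← lintegral_const_mul' _ _ ENNReal.ofReal_ne_top]
        refine setLIntegral_mono' hAm fun y hy => ?_
        rw [← ENNReal.ofReal_mul hC.le]
        exact ENNReal.ofReal_le_ofReal (hcomp x hx y (hA hy))
      have := ENNReal.toReal_mono (ENNReal.mul_ne_top ENNReal.ofReal_ne_top hTv) h
      rwa [ENNReal.toReal_mul, ENNReal.toReal_mul, ENNReal.toReal_ofReal hDx,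
        ENNReal.toReal_ofReal hC.le] at this
  -- the slope is at least of order `1 / m(I)`, since the image is long, and at most of that order,
  -- since the image lies in `[a, b]`
  have hlow : ∀ x ∈ I, 1 ≤ K * volume.real I * D x := fun x hx => by
    have h1 := (hvol I subset_rfl hIm x hx).1
    have h2 : δ ≤ volume.real (T^[n] '' I) :=
      (ENNReal.ofReal_le_iff_le_toReal (hfin _ (hTX I subset_rfl))).1 (hbig n w hn ⟨x, hx⟩)
    have h3 : C / δ * (volume.real I * D x) ≤ K * (volume.real I * D x) :=
      mul_le_mul_of_nonneg_right (le_max_left _ _) (mul_nonneg measureReal_nonneg (abs_nonneg _))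
    have h4 : 1 ≤ C / δ * (volume.real I * D x) := by
      rw [div_mul_eq_mul_div, le_div_iff₀ hδ]
      linarith
    linarith
  have hup : ∀ x ∈ I, volume.real I * D x ≤ K := fun x hx => by
    have h1 := (hvol I subset_rfl hIm x hx).2
    have h2 : volume.real (T^[n] '' I) ≤ b - a := by
      have hab : a ≤ b := (hIX hx).1.trans (hIX hx).2
      have := measureReal_mono (hTX I subset_rfl) (μ := volume) (by simp)
      rwa [Real.volume_real_Icc_of_le hab] at this
    have h3 : C * (b - a) ≤ K := le_max_right _ _
    nlinarith
  refine ⟨fun x hx y hy => ?_, fun A hA hAm => ?_⟩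
  · obtain ⟨z, hz, h⟩ := exists_slope_eq (ordConnected_cylinder hT hG n w) hdif hx hy
    have h1 := hlow z hz
    have h2 := hup z hz
    have h3 := abs_nonneg (x - y)
    have h4 : 0 ≤ volume.real I * D z := mul_nonneg measureReal_nonneg (abs_nonneg _)
    rw [h]
    constructor
    · calc |x - y| ≤ (K * volume.real I * D z) * |x - y| := le_mul_of_one_le_left h3 h1
        _ ≤ (K * volume.real I * D z) * |x - y| * (1 + C) :=
          le_mul_of_one_le_right (by positivity) (by linarith)
        _ = _ := by ring
    · calc volume.real I * (D z * |x - y|) = (volume.real I * D z) * |x - y| := by ring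
        _ ≤ K * |x - y| := by gcongr
        _ ≤ K * |x - y| * (1 + C) := le_mul_of_one_le_right (by positivity) (by linarith)
        _ = _ := by ring
  · rcases A.eq_empty_or_nonempty with rfl | ⟨z, hz⟩
    · simp
    obtain ⟨h3, h4⟩ := hvol A hA hAm z (hA hz)
    have h1 := hlow z (hA hz)
    have h2 := hup z (hA hz)
    have hA0 : 0 ≤ volume.real A := measureReal_nonneg
    have hTA0 : 0 ≤ volume.real (T^[n] '' A) := measureReal_nonneg
    have hI0 : 0 ≤ volume.real I := measureReal_nonneg
    constructor
    · calc volume.real A ≤ (K * volume.real I * D z) * volume.real A :=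
            le_mul_of_one_le_left hA0 h1
        _ = K * volume.real I * (D z * volume.real A) := by ring
        _ ≤ K * volume.real I * ((1 + C) * volume.real (T^[n] '' A)) := by
          refine mul_le_mul_of_nonneg_left ?_ (by positivity)
          linarith
        _ = _ := by ring
    · calc volume.real I * volume.real (T^[n] '' A)
          ≤ volume.real I * ((1 + C) * D z * volume.real A) := by
            refine mul_le_mul_of_nonneg_left ?_ hI0
            have : 0 ≤ D z * volume.real A := mul_nonneg (abs_nonneg _) hA0
            linarith
        _ = (volume.real I * D z) * ((1 + C) * volume.real A) := by ring
        _ ≤ K * ((1 + C) * volume.real A) := by gcongr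
        _ = _ := by ring

end Cylinders

/-! ### Decay of correlations for intervals -/

section Decay

lemma eVariationOn_le_of_abs_sub_le {f g : ℝ → ℝ} {s : Set ℝ}
    (h : ∀ x ∈ s, ∀ y ∈ s, x ≤ y → |f y - f x| ≤ g y - g x) :
    eVariationOn f s ≤ eVariationOn g s := by
  refine iSup_le fun p => ?_
  refine (Finset.sum_le_sum fun i _ => ?_).trans (eVariationOn.sum_le p.2.2.1 p.2.2.2)
  rw [edist_dist, edist_dist, Real.dist_eq, Real.dist_eq]
  exact ENNReal.ofReal_le_ofReal
    ((h _ (p.2.2.2 i) _ (p.2.2.2 (i + 1)) (p.2.2.1 (Nat.le_succ i))).trans (le_abs_self _))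

open scoped Classical in
lemma eVariationOn_indicator_le {A : Set ℝ} (hA : A.OrdConnected) {a b : ℝ} (hab : a ≤ b) :
    eVariationOn (A.indicator fun _ => (1 : ℝ)) (Icc a b) ≤ ENNReal.ofReal 2 := by
  set g : ℝ → ℝ := fun x => if ∃ y ∈ A, y ≤ x then (if x ∈ A then 1 else 2) else 0 with hg
  have key : ∀ x y, x ≤ y →
      |A.indicator (fun _ => (1 : ℝ)) y - A.indicator (fun _ => (1 : ℝ)) x| ≤ g y - g x := by
    intro x y hxy
    by_cases hx : ∃ z ∈ A, z ≤ x
    · have hy : ∃ z ∈ A, z ≤ y := hx.imp fun z hz => ⟨hz.1, hz.2.trans hxy⟩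
      by_cases hxA : x ∈ A
      · by_cases hyA : y ∈ A <;> (simp [hg, hxA, hyA, hx, hy]; try norm_num)
      · have hyA : y ∉ A := fun hyA => by
          obtain ⟨z, hz, hzx⟩ := hx
          exact hxA (hA.out hz hyA ⟨hzx, hxy⟩)
        simp [hg, hxA, hyA, hx, hy]
    · have hxA : x ∉ A := fun h => hx ⟨x, h, le_rfl⟩
      by_cases hyA : y ∈ A
      · have hy : ∃ z ∈ A, z ≤ y := ⟨y, hyA, le_rfl⟩
        simp [hg, hxA, hyA, hx, hy]
      · simp only [indicator_of_notMem hxA, indicator_of_notMem hyA, hg, hx, if_false]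
        split_ifs <;> simp
  have hmono : MonotoneOn g (Icc a b) := fun x _ y _ hxy =>
    sub_nonneg.1 ((abs_nonneg _).trans (key x y hxy))
  refine (eVariationOn_le_of_abs_sub_le fun x _ y _ hxy => key x y hxy).trans
    (le_of_eq_of_le ?_ (ENNReal.ofReal_le_ofReal (p := g b - g a) ?_))
  · rw [← hmono.eVariationOn_eq (left_mem_Icc.2 hab) (right_mem_Icc.2 hab), inter_self]
  simp only [hg]
  split_ifs <;> norm_num

/-- Correlations of an interval with an arbitrary Borel set decay exponentially, with an error
proportional to the measure of the Borel set. -/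
lemma exists_decay_interval {a b : ℝ} (hab : a ≤ b) {T : ℝ → ℝ} (hTm : Measurable T)
    {μ : Measure ℝ} [IsProbabilityMeasure μ] (hdecay : HasExpDecay (Icc a b) T μ) :
    ∃ C c : ℝ, 0 < C ∧ 0 < c ∧ ∀ A B : Set ℝ, A.OrdConnected → MeasurableSet B → ∀ n : ℕ,
      |μ.real (A ∩ T^[n] ⁻¹' B) - μ.real A * μ.real B| ≤ C * Real.exp (-(c * n)) * μ.real B := by
  obtain ⟨C, c, hC, hc, h⟩ := hdecay
  refine ⟨(b - a + 2) * C, c, mul_pos (by linarith) hC, hc, fun A B hA hB n => ?_⟩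
  set f : ℝ → ℝ := A.indicator fun _ => (1 : ℝ)
  set g : ℝ → ℝ := B.indicator fun _ => (1 : ℝ)
  have hvar := eVariationOn_indicator_le hA hab
  have hbv : BoundedVariationOn f (Icc a b) := ne_top_of_le_ne_top ENNReal.ofReal_ne_top hvar
  have hg : Integrable g μ := (integrable_const (1 : ℝ)).indicator hB
  have hTB : MeasurableSet (T^[n] ⁻¹' B) := hTm.iterate n hB
  have h1 : ∫ x, f x * g (T^[n] x) ∂μ = μ.real (A ∩ T^[n] ⁻¹' B) := by
    rw [← integral_indicator_one (hA.measurableSet.inter hTB)]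
    congr 1 with x
    by_cases hx : x ∈ A <;> by_cases hy : T^[n] x ∈ B <;> simp [f, g, hx, hy]
  have h2 : ∫ x, f x ∂μ = μ.real A := integral_indicator_one hA.measurableSet
  have h3 : ∫ x, g x ∂μ = μ.real B := integral_indicator_one hB
  have h4 : ∫ x, |g x| ∂μ = μ.real B := by
    rw [← h3]
    congr 1 with x
    by_cases hy : x ∈ B <;> simp [g, hy]
  have h5 : bvNorm (Icc a b) f ≤ b - a + 2 := by
    refine add_le_add ?_ ?_
    · calc ∫ x in Icc a b, |f x| ≤ ∫ x in Icc a b, (1 : ℝ) := by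
            refine integral_mono_of_nonneg (.of_forall fun x => abs_nonneg _) (by simp)
              (.of_forall fun x => ?_)
            by_cases hx : x ∈ A <;> simp [f, hx]
        _ = b - a := by simp [hab]
    · exact ENNReal.toReal_le_of_le_ofReal (by norm_num) hvar
  have := h f g hbv hg n
  rw [h1, h2, h3, h4] at this
  refine this.trans ?_
  calc bvNorm (Icc a b) f * μ.real B * (C * Real.exp (-(c * n)))
      ≤ (b - a + 2) * μ.real B * (C * Real.exp (-(c * n))) := by
        gcongr
    _ = _ := by ring

end Decay

/-! ### Cylinders of positive measure shrink uniformly -/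

section Shrinking

variable {ι : Type*} {a b : ℝ} {T : ℝ → ℝ} {P : ι → Set ℝ} {μ : Measure ℝ}

/-- The support of a positive measure without atoms has two points, which a cut separates. -/
lemma exists_split_of_pos (hna : ∀ x, μ {x} = 0) {J : Set ℝ} (hJ : 0 < μ J) :
    ∃ t, 0 < μ (J ∩ Iio t) ∧ 0 < μ (J ∩ Ioi t) := by
  set ν := μ.restrict J with hνdef
  have hsub : ¬ ν.support.Subsingleton := fun hs => by
    have h1 : ν ν.support = 0 := by
      rcases hs.eq_empty_or_singleton with h | ⟨x, h⟩
      · rw [h, measure_empty]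
      · rw [h]
        exact le_antisymm ((Measure.restrict_apply_le _ _).trans (hna x).le) zero_le
    have h2 : ν univ = 0 := by
      rw [← union_compl_self ν.support]
      exact measure_union_null h1 Measure.measure_compl_support
    rw [Measure.restrict_apply_univ] at h2
    exact hJ.ne' h2
  rw [not_subsingleton_iff] at hsub
  obtain ⟨x, hx, y, hy, hxy⟩ := hsub.exists_lt
  have hx' := (Measure.mem_support_iff_forall _).1 hx (Iio ((x + y) / 2))
    (Iio_mem_nhds (by linarith))
  have hy' := (Measure.mem_support_iff_forall _).1 hy (Ioi ((x + y) / 2))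
    (Ioi_mem_nhds (by linarith))
  rw [Measure.restrict_apply measurableSet_Iio, inter_comm] at hx'
  rw [Measure.restrict_apply measurableSet_Ioi, inter_comm] at hy'
  exact ⟨_, hx', hy'⟩

/-- The points sharing an infinite itinerary form a null set: two separated parts of positive
measure of such a set would have disjoint images under all iterates, contradicting mixing. -/
lemma measure_iInter_cylinder_eq_zero (hab : a ≤ b) (hT : IsPiecewiseExpanding (Icc a b) T P)
    (hG : IsGibbsMarkov (Icc a b) T P) (hμ : IsGibbsMeasure (Icc a b) T P μ)
    (hdecay : HasExpDecay (Icc a b) T μ) (hna : ∀ x, μ {x} = 0) (w : ℕ → ι) :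
    μ (⋂ n, cylinder T P w n) = 0 := by
  have := hμ.prob
  obtain ⟨C, c, hC, hc, h⟩ := exists_decay_interval hab hμ.invariant.measurable hdecay
  set J := ⋂ n, cylinder T P w n
  have hJo : J.OrdConnected := ordConnected_iInter fun n => ordConnected_cylinder hT hG n w
  by_contra hJ
  obtain ⟨t, ht1, ht2⟩ := exists_split_of_pos hna (pos_iff_ne_zero.2 hJ)
  set A := J ∩ Iio t
  set A' := J ∩ Ioi t
  have hA : A.OrdConnected := hJo.inter ordConnected_Iio
  have hA' : A'.OrdConnected := hJo.inter ordConnected_Ioi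
  have hle : ∀ n : ℕ, μ.real A ≤ C * Real.exp (-(c * n)) := fun n => by
    have hsub : ∀ x ∈ J, x ∈ cylinder T P w n := fun x hx => mem_iInter.1 hx n
    have hB : (T^[n] '' A').OrdConnected :=
      (hA'.isPreconnected.image _ ((hT.differentiableOn_iterate n w).continuousOn.mono
        fun x hx => hsub x hx.1)).ordConnected
    have hemp : A ∩ T^[n] ⁻¹' (T^[n] '' A') = ∅ := by
      refine eq_empty_of_forall_notMem ?_
      rintro x ⟨hx, y, hy, hxy⟩
      have := hG.injOn_iterate n w (hsub y hy.1) (hsub x hx.1) hxy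
      exact lt_asymm (mem_Iio.1 hx.2) (mem_Ioi.1 (this ▸ hy.2))
    have hpos : 0 < μ.real (T^[n] '' A') := by
      refine ENNReal.toReal_pos (ne_of_gt (ht2.trans_le ?_)) (measure_ne_top _ _)
      rw [← (hμ.invariant.iterate n).measure_preimage hB.measurableSet.nullMeasurableSet]
      exact measure_mono (subset_preimage_image _ _)
    have := h A _ hA hB.measurableSet n
    rw [hemp, measureReal_empty, zero_sub, abs_neg, abs_of_nonneg (by positivity)] at this
    exact le_of_mul_le_mul_right this hpos
  have hlim : Tendsto (fun n : ℕ => C * Real.exp (-(c * n))) atTop (𝓝 0) := by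
    have : Tendsto (fun n : ℕ => c * (n : ℝ)) atTop atTop :=
      tendsto_natCast_atTop_atTop.const_mul_atTop hc
    simpa using (Real.tendsto_exp_neg_atTop_nhds_zero.comp this).const_mul C
  have h0 := ge_of_tendsto' hlim hle
  exact absurd (ENNReal.toReal_pos ht1.ne' (measure_ne_top _ _)) (not_lt.2 h0)

/-- A difference of two intervals consists of two intervals, which are at most single points if it
is Lebesgue null. -/
lemma measure_diff_eq_zero_of_volume (hna : ∀ x, μ {x} = 0) {U V : Set ℝ} (hU : U.OrdConnected)
    (hV : V.OrdConnected) (hne : V.Nonempty) (h : volume (U \ V) = 0) :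
    μ (U \ V) = 0 := by
  have hnull : ∀ L : Set ℝ, L.OrdConnected → L ⊆ U \ V → μ L = 0 := fun L hL hLs => by
    have hsub : L.Subsingleton := by
      by_contra hn
      obtain ⟨x, hx, y, hy, hxy⟩ := (not_subsingleton_iff.1 hn).exists_lt
      have := measure_mono_null ((hL.out hx hy).trans hLs) h
      rw [Real.volume_Icc, ENNReal.ofReal_eq_zero] at this
      linarith
    rcases hsub.eq_empty_or_singleton with h | ⟨x, h⟩
    · rw [h, measure_empty]
    · rw [h, hna]
  obtain ⟨y, hy⟩ := hne
  have hsplit : U \ V ⊆ ((U \ V) ∩ Iio y) ∪ ((U \ V) ∩ Ioi y) := fun x hx => by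
    rcases lt_trichotomy x y with h | h | h
    · exact Or.inl ⟨hx, h⟩
    · exact absurd (h ▸ hy) hx.2
    · exact Or.inr ⟨hx, h⟩
  refine measure_mono_null hsplit (measure_union_null (hnull _ ⟨?_⟩ inter_subset_left)
    (hnull _ ⟨?_⟩ inter_subset_left))
  · rintro x ⟨hx, -⟩ x' ⟨hx', hxy⟩ z hz
    exact ⟨⟨hU.out hx.1 hx'.1 hz, fun hzV => hx'.2 (hV.out hzV hy ⟨hz.2, (mem_Iio.1 hxy).le⟩)⟩,
      hz.2.trans_lt hxy⟩
  · rintro x ⟨hx, hxy⟩ x' ⟨hx', -⟩ z hz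
    exact ⟨⟨hU.out hx.1 hx'.1 hz, fun hzV => hx.2 (hV.out hy hzV ⟨(mem_Ioi.1 hxy).le, hz.1⟩)⟩,
      (mem_Ioi.1 hxy).trans_le hz.1⟩

/-- Compactness: if arbitrarily long cylinders of positive measure have length at least `η`, they
can be chosen as the prefixes of one infinite word. -/
lemma exists_word_of_long_cylinders (hT : IsPiecewiseExpanding (Icc a b) T P)
    (hG : IsGibbsMarkov (Icc a b) T P) {η : ℝ} (hη : 0 < η)
    (h : ∀ n₀ : ℕ, ∃ n ≥ n₀, ∃ w : ℕ → ι,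
      0 < μ (cylinder T P w n) ∧ η ≤ volume.real (cylinder T P w n)) :
    ∃ w : ℕ → ι, ∀ n, 1 ≤ n →
      0 < μ (cylinder T P w n) ∧ η ≤ volume.real (cylinder T P w n) := by
  choose N hN W hpos hlen using fun k : ℕ => h (k + 1)
  set I : ℕ → Set ℝ := fun k => cylinder T P (W k) (N k) with hI
  have hIX : ∀ k, I k ⊆ Icc a b := fun k => hT.cylinder_subset _ (le_trans (by omega) (hN k))
  have hne : ∀ k, (I k).Nonempty := fun k => nonempty_of_measure_ne_zero (hpos k).ne'
  have hbb : ∀ k, BddBelow (I k) := fun k => bddBelow_Icc.mono (hIX k)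
  have hba : ∀ k, BddAbove (I k) := fun k => bddAbove_Icc.mono (hIX k)
  have hwidth : ∀ k, η ≤ sSup (I k) - sInf (I k) := fun k => by
    have hle : sInf (I k) ≤ sSup (I k) :=
      (csInf_le (hbb k) (hne k).some_mem).trans (le_csSup (hba k) (hne k).some_mem)
    have := measureReal_mono (μ := volume) (subset_Icc_csInf_csSup (hbb k) (hba k)) (by simp)
    rw [Real.volume_real_Icc_of_le hle] at this
    exact (hlen k).trans this
  -- along a subsequence the left endpoints converge to some `s`, so that the intervals
  -- eventually contain `s + η / 2`; points in common force equal letters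
  obtain ⟨s, -, φ, hφ, hs⟩ := (isCompact_Icc (a := a) (b := b)).tendsto_subseq
    (x := fun k => sInf (I k)) fun k => by
      obtain ⟨x, hx⟩ := hne k
      exact ⟨le_csInf (hne k) fun y hy => (hIX k hy).1, (csInf_le (hbb k) hx).trans (hIX k hx).2⟩
  have hev : ∀ᶠ k in atTop, s + η / 2 ∈ I (φ k) := by
    have h1 := (tendsto_order.1 hs).1 (s - η / 2) (by linarith)
    have h2 := (tendsto_order.1 hs).2 (s + η / 2) (by linarith)
    filter_upwards [h1, h2] with k hk1 hk2
    simp only [Function.comp_apply] at hk1 hk2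
    obtain ⟨y, hy, hy'⟩ := exists_lt_of_csInf_lt (hne _) hk2
    obtain ⟨z, hz, hz'⟩ := exists_lt_of_lt_csSup (hne (φ k)) (b := s + η / 2)
      (by have := hwidth (φ k); linarith)
    exact (ordConnected_cylinder hT hG _ _).out hy hz ⟨hy'.le, hz'.le⟩
  obtain ⟨k₀, hk₀⟩ := eventually_atTop.1 hev
  set κ : ℕ → ℕ := fun n => φ (k₀ + n) with hκ
  have hκN : ∀ n, n + 1 ≤ N (κ n) := fun n =>
    le_trans (Nat.succ_le_succ ((Nat.le_add_left n k₀).trans (hφ.id_le (k₀ + n)))) (hN _)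
  refine ⟨fun i => W (κ i) i, fun n hn => ?_⟩
  have heq : cylinder T P (fun i => W (κ i) i) n = cylinder T P (W (κ n)) n :=
    cylinder_congr fun i hi => hT.eq_of_mem (hk₀ (k₀ + i) (by omega) i (hκN i))
      (hk₀ (k₀ + n) (by omega) i ((hi.trans (Nat.lt_succ_self n)).trans_le (hκN n)))
  have hsub : I (κ n) ⊆ cylinder T P (W (κ n)) n :=
    cylinder_anti _ (by have := hκN n; omega)
  rw [heq]
  exact ⟨(hpos _).trans_le (measure_mono hsub), (hlen _).trans
    (measureReal_mono hsub ((measure_mono (hT.cylinder_subset _ hn)).trans_lt (by simp)).ne)⟩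

/-- Pigeonhole principle: two shifts of an infinite word with long prefixes coincide, since the
images of its cylinders stay long. -/
lemma exists_periodic_word (hab : a < b) (hT : IsPiecewiseExpanding (Icc a b) T P)
    (hD : HasBoundedDistortion T P) (hG : IsGibbsMarkov (Icc a b) T P)
    (hinv : MeasurePreserving T μ μ) {η : ℝ} (hη : 0 < η) {w : ℕ → ι}
    (hw : ∀ n, 1 ≤ n → 0 < μ (cylinder T P w n) ∧ η ≤ volume.real (cylinder T P w n)) :
    ∃ (u : ℕ → ι) (p : ℕ) (η' : ℝ), 1 ≤ p ∧ 0 < η' ∧ (∀ k, u (p + k) = u k) ∧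
      ∀ n, 1 ≤ n → 0 < μ (cylinder T P u n) ∧ η' ≤ volume.real (cylinder T P u n) := by
  obtain ⟨K, hK, hdist⟩ := exists_distortion hT hD hG
  have hba : 0 < b - a := sub_pos.2 hab
  set η' := η / (K * (b - a)) with hη'
  have hη'0 : 0 < η' := by positivity
  have hfin : ∀ A ⊆ Icc a b, volume A ≠ ∞ := fun A hA =>
    ((measure_mono hA).trans_lt (by simp)).ne
  have hcyl : ∀ i n, 1 ≤ i → 1 ≤ n → 0 < μ (cylinder T P (fun k => w (i + k)) n) ∧
      η' ≤ volume.real (cylinder T P (fun k => w (i + k)) n) := fun i n hi hn => by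
    obtain ⟨h1, h2⟩ := hw (i + n) (by omega)
    have hne := nonempty_of_measure_ne_zero h1.ne'
    have himg := image_cylinder_add hG hn i w hne
    have hm := measurableSet_cylinder hT hG n fun k => w (i + k)
    refine ⟨?_, ?_⟩
    · rw [← (hinv.iterate i).measure_preimage hm.nullMeasurableSet, ← himg]
      exact h1.trans_le (measure_mono (subset_preimage_image _ _))
    · have h3 := ((hdist i w hi).2 _ (cylinder_anti w (Nat.le_add_right i n))
        (measurableSet_cylinder hT hG _ w)).1
      rw [himg] at h3
      have h4 : volume.real (cylinder T P w i) ≤ b - a := by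
        have := measureReal_mono (hT.cylinder_subset w hi) (μ := volume) (by simp)
        rwa [Real.volume_real_Icc_of_le hab.le] at this
      rw [hη', div_le_iff₀ (by positivity)]
      refine h2.trans (h3.trans ?_)
      rw [mul_comm (volume.real _) (K * _)]
      gcongr
  -- the points following a given shift of `w` form a set of length at least `η'`, and infinitely
  -- many such subsets of `[a, b]` cannot be pairwise disjoint
  set J : ℕ → Set ℝ := fun i => ⋂ n, cylinder T P (fun k => w (i + 1 + k)) (n + 1) with hJ
  have hJm : ∀ i, MeasurableSet (J i) := fun i =>
    MeasurableSet.iInter fun n => measurableSet_cylinder hT hG _ _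
  have hJvol : ∀ i, ENNReal.ofReal η' ≤ volume.restrict (Icc a b) (J i) := fun i => by
    have hsub : J i ⊆ Icc a b := (iInter_subset _ 0).trans (hT.cylinder_subset _ le_rfl)
    rw [Measure.restrict_apply (hJm i), inter_eq_left.2 hsub]
    refine ge_of_tendsto' (tendsto_measure_iInter_atTop
      (fun n => (measurableSet_cylinder hT hG _ _).nullMeasurableSet)
      (fun m n h => cylinder_anti _ (by omega)) ⟨0, hfin _ (hT.cylinder_subset _ le_rfl)⟩)
      fun n => ?_
    exact (ENNReal.ofReal_le_iff_le_toReal (hfin _ (hT.cylinder_subset _ (by omega)))).2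
      (hcyl (i + 1) (n + 1) (by omega) (by omega)).2
  have htop : (volume.restrict (Icc a b)) univ < ∑' i, volume.restrict (Icc a b) (J i) := by
    refine lt_of_lt_of_le (b := ∞) (by simp) ?_
    rw [← ENNReal.tsum_const_eq_top_of_ne_zero (α := ℕ) (c := ENNReal.ofReal η')
      (by simpa using hη'0)]
    exact ENNReal.tsum_le_tsum hJvol
  obtain ⟨i, j, hij, x, hxi, hxj⟩ :=
    exists_nonempty_inter_of_measure_univ_lt_tsum_measure _
      (fun i => (hJm i).nullMeasurableSet) htop
  wlog hlt : i < j generalizing i j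
  · exact this j i hij.symm hxj hxi (by omega)
  refine ⟨fun k => w (i + 1 + k), j - i, η', by omega, hη'0, fun k => ?_,
    fun n hn => hcyl (i + 1) n (by omega) hn⟩
  have h1 := mem_iInter.1 hxi (k) k (by omega)
  have h2 := mem_iInter.1 hxj (k) k (by omega)
  have h3 : i + 1 + (j - i + k) = j + 1 + k := by omega
  simp only [h3]
  exact hT.eq_of_mem h2 h1

/-- Cylinders of positive measure become short, uniformly in the number of letters. -/
lemma exists_forall_cylinder_volume_lt (hab : a < b) (hT : IsPiecewiseExpanding (Icc a b) T P)
    (hD : HasBoundedDistortion T P) (hG : IsGibbsMarkov (Icc a b) T P)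
    (hμ : IsGibbsMeasure (Icc a b) T P μ) (hdecay : HasExpDecay (Icc a b) T μ)
    (hna : ∀ x, μ {x} = 0) {η : ℝ} (hη : 0 < η) :
    ∃ n₀, ∀ n ≥ n₀, ∀ w : ℕ → ι, 0 < μ (cylinder T P w n) →
      volume.real (cylinder T P w n) < η := by
  by_contra! hcon
  obtain ⟨w, hw⟩ := exists_word_of_long_cylinders hT hG hη hcon
  obtain ⟨u, p, η', hp, hη', hper, hu⟩ := exists_periodic_word hab hT hD hG hμ.invariant hη hw
  obtain ⟨K, hK, hdist⟩ := exists_distortion hT hD hG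
  have hperl : ∀ l k, u (l * p + k) = u k := fun l => by
    induction l with
    | zero => simp
    | succ l ih => intro k; rw [add_mul, one_mul, add_assoc, ih, hper]
  -- `V l` consists of the points that follow the periodic word for `l` periods
  set V : ℕ → Set ℝ := fun l => cylinder T P u (l * p) with hV
  have hVm : ∀ l, MeasurableSet (V l) := fun l => measurableSet_cylinder hT hG _ _
  have hVanti : ∀ l, V (l + 1) ⊆ V l := fun l =>
    cylinder_anti u (Nat.mul_le_mul_right p (Nat.le_succ l))
  have hpos : ∀ l, 1 ≤ (l + 1) * p := fun l => Nat.mul_pos l.succ_pos hp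
  have hVX : ∀ l, V (l + 1) ⊆ Icc a b := fun l => hT.cylinder_subset u (hpos l)
  have hVfin : ∀ l, volume (V (l + 1)) ≠ ∞ := fun l =>
    ((measure_mono (hVX l)).trans_lt (by simp)).ne
  have hVsplit : ∀ l q, V (l + q) = V l ∩ T^[l * p] ⁻¹' V q := fun l q => by
    simp only [hV, add_mul, cylinder_add, hperl]
  -- `T^((l + 1) p)` maps `V (l + 2) \ V (l + 3)` onto `V 1 \ V 2` with slope bounded above, as
  -- `V (l + 1)` is long, while the lengths of these differences tend to `0`
  have hvol0 : volume.real (V 1 \ V 2) = 0 := by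
    have hle : ∀ l, η' * volume.real (V 1 \ V 2) ≤
        K * (volume.real (V (l + 2)) - volume.real (V (l + 3))) := fun l => by
      have hsub : V 1 \ V 2 ⊆ T^[(l + 1) * p] '' (V (l + 2) \ V (l + 3)) := by
        rintro y ⟨hy1, hy2⟩
        have himg := image_cylinder_add hG hp ((l + 1) * p) u
          (nonempty_of_measure_ne_zero (hu _ (by omega)).1.ne')
        simp only [hperl] at himg
        have hy1' : y ∈ cylinder T P u p := by simpa [hV] using hy1
        rw [← himg] at hy1'
        obtain ⟨x, hx, rfl⟩ := hy1'
        refine ⟨x, ⟨?_, fun h3 => hy2 ?_⟩, rfl⟩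
        · have : (l + 1) * p + p = (l + 2) * p := by ring
          simpa only [hV, this] using hx
        · exact ((hVsplit (l + 1) 2).subset h3).2
      have hA : V (l + 2) \ V (l + 3) ⊆ V (l + 1) := sdiff_subset.trans (hVanti _)
      have h1 := ((hdist _ u (hpos l)).2 _ hA ((hVm _).diff (hVm _))).2
      have hTfin : volume (T^[(l + 1) * p] '' (V (l + 2) \ V (l + 3))) ≠ ∞ := by
        refine ((measure_mono (t := Icc a b) ?_).trans_lt (by simp)).ne
        exact image_subset_iff.2 fun x hx => hT.mapsTo.iterate _ (hVX l (hA hx))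
      rw [measureReal_sdiff (hVanti (l + 2)) (hVm _) (h₁ := hVfin (l + 1))] at h1
      refine le_trans ?_ h1
      gcongr
      · exact (hu _ (hpos l)).2
    have hlim : Tendsto (fun l => K * (volume.real (V (l + 2)) - volume.real (V (l + 3)))) atTop
        (𝓝 (K * 0)) := by
      have hanti : Antitone fun l => volume.real (V (l + 2)) :=
        antitone_nat_of_succ_le fun l => measureReal_mono (hVanti _) (hVfin (l + 1))
      have h1 := tendsto_atTop_ciInf hanti ⟨0, by rintro _ ⟨l, rfl⟩; exact measureReal_nonneg⟩
      have h2 := h1.sub (h1.comp (tendsto_add_atTop_nat 1))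
      rw [sub_self] at h2
      exact h2.const_mul K
    rw [mul_zero] at hlim
    have h0 := ge_of_tendsto' hlim hle
    have h1 : 0 ≤ volume.real (V 1 \ V 2) := measureReal_nonneg
    nlinarith
  have hμ0 : μ (V 1 \ V 2) = 0 := by
    refine measure_diff_eq_zero_of_volume hna (ordConnected_cylinder hT hG _ _)
      (ordConnected_cylinder hT hG _ _)
      (nonempty_of_measure_ne_zero (hu _ (hpos 1)).1.ne') ?_
    exact (measureReal_eq_zero_iff
      ((measure_mono (sdiff_subset.trans (hVX 0))).trans_lt (by simp)).ne).1 hvol0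
  have hμl : ∀ l, μ (V (l + 1) \ V (l + 2)) = 0 := fun l => by
    refine measure_mono_null (t := T^[l * p] ⁻¹' (V 1 \ V 2)) ?_ ?_
    · rw [hVsplit l 1, hVsplit l 2]
      exact fun x hx => ⟨hx.1.2, fun h => hx.2 ⟨hx.1.1, h⟩⟩
    · rw [(hμ.invariant.iterate _).measure_preimage ((hVm 1).diff (hVm 2)).nullMeasurableSet, hμ0]
  -- hence almost every point of `V 1` follows the periodic word forever
  have hcover : V 1 ⊆ (⋂ n, cylinder T P u n) ∪ ⋃ l, (V (l + 1) \ V (l + 2)) := fun x hx => by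
    by_contra hx'
    rw [mem_union, not_or, mem_iUnion, not_exists] at hx'
    have hall : ∀ l, x ∈ V (l + 1) := fun l => by
      induction l with
      | zero => exact hx
      | succ l ih => exact not_not.1 fun h => hx'.2 l ⟨ih, h⟩
    exact hx'.1 (mem_iInter.2 fun n => cylinder_anti u (by nlinarith) (hall n))
  have := measure_mono_null hcover (measure_union_null
    (measure_iInter_cylinder_eq_zero hab.le hT hG hμ hdecay hna u) (measure_iUnion_null hμl))
  exact (hu _ (hpos 0)).1.ne' this

end Shrinking

/-! ### Itineraries -/

section Codes

variable {ι : Type*} {X : Set ℝ} {T : ℝ → ℝ} {P : ι → Set ℝ} {μ : Measure ℝ}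

open scoped Classical in
/-- The index of the partition element containing `x`, and an arbitrary index if there is none. -/
noncomputable def letter [Nonempty ι] (P : ι → Set ℝ) (x : ℝ) : ι :=
  if h : ∃ i, x ∈ P i then h.choose else Classical.arbitrary ι

/-- The first `n` letters of the itinerary of `x`. -/
noncomputable def code [Nonempty ι] (T : ℝ → ℝ) (P : ι → Set ℝ) (n : ℕ) (x : ℝ) : Fin n → ι :=
  fun i => letter P (T^[i] x)

open scoped Classical in
/-- An infinite word with prefix `v`. -/
noncomputable def extendWord [Nonempty ι] {n : ℕ} (v : Fin n → ι) : ℕ → ι :=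
  fun i => if h : i < n then v ⟨i, h⟩ else Classical.arbitrary ι

lemma ae_mem_repeller (hμ : IsGibbsMeasure X T P μ) : ∀ᵐ x ∂μ, x ∈ repeller X T P := by
  have h1 : ∀ᵐ x ∂μ, x ∈ X := hμ.support
  have h2 : ∀ᵐ x ∂μ, x ∈ ⋃ i, P i := by
    have h3 : ∀ᵐ x ∂μ, x ∉ X \ ⋃ i, P i := measure_eq_zero_iff_ae_notMem.1 hμ.partition
    filter_upwards [h1, h3] with x hx hx'
    exact not_not.1 fun h => hx' ⟨hx, h⟩
  have h3 : ∀ k : ℕ, ∀ᵐ x ∂μ, T^[k] x ∈ ⋃ i, P i := fun k =>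
    (hμ.invariant.iterate k).quasiMeasurePreserving.ae h2
  filter_upwards [h1, ae_all_iff.2 h3] with x hx hx'
  exact ⟨hx, hx'⟩

variable [Nonempty ι]

lemma extendWord_apply {n : ℕ} (v : Fin n → ι) (i : Fin n) : extendWord v i = v i := by
  simp [extendWord]

lemma letter_eq (hT : IsPiecewiseExpanding X T P) {x : ℝ} {i : ι} (h : x ∈ P i) :
    letter P x = i := by
  have h' : ∃ j, x ∈ P j := ⟨i, h⟩
  rw [letter, dif_pos h']
  exact hT.eq_of_mem h'.choose_spec h

lemma mem_letter {x : ℝ} (h : x ∈ ⋃ i, P i) : x ∈ P (letter P x) := by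
  have h' : ∃ j, x ∈ P j := mem_iUnion.1 h
  rw [letter, dif_pos h']
  exact h'.choose_spec

lemma code_eq_iff {m : ℕ} {x y : ℝ} : code T P m x = code T P m y ↔
    ∀ i < m, letter P (T^[i] x) = letter P (T^[i] y) := by
  rw [funext_iff, Fin.forall_iff]
  rfl

lemma code_eq_of_le {m n : ℕ} (h : m ≤ n) {x y : ℝ} (hxy : code T P n x = code T P n y) :
    code T P m x = code T P m y :=
  code_eq_iff.2 fun i hi => code_eq_iff.1 hxy i (hi.trans_le h)

lemma code_iterate_eq {m k : ℕ} {x y : ℝ} (hxy : code T P (k + m) x = code T P (k + m) y) :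
    code T P m (T^[k] x) = code T P m (T^[k] y) :=
  code_eq_iff.2 fun i hi => by
    rw [← Function.iterate_add_apply, ← Function.iterate_add_apply]
    exact code_eq_iff.1 hxy _ (by omega)

lemma mem_cylinder_iff_code (hT : IsPiecewiseExpanding X T P) {n : ℕ} {v : Fin n → ι} {x : ℝ}
    (hx : x ∈ repeller X T P) : x ∈ cylinder T P (extendWord v) n ↔ code T P n x = v := by
  constructor
  · intro h
    funext i
    rw [code, letter_eq hT (h i i.2), extendWord_apply]
  · rintro rfl i hi
    have := mem_letter (hx.2 i)
    rwa [show letter P (T^[i] x) = extendWord (code T P n x) i by simp [extendWord, hi, code]]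
      at this

variable [Countable ι]

lemma measurableSet_letter (hT : IsPiecewiseExpanding X T P) (W : Set ι) :
    MeasurableSet (letter P ⁻¹' W) := by
  have hP : ∀ i, MeasurableSet (P i) := fun i => (hT.interval i).measurableSet
  have h : letter P ⁻¹' W = (⋃ i ∈ W, P i) ∪
      {x | x ∉ (⋃ i, P i) ∧ Classical.arbitrary ι ∈ W} := by
    ext x
    by_cases hx : ∃ i, x ∈ P i
    · obtain ⟨i, hi⟩ := hx
      have h1 : ∀ j ∈ W, x ∈ P j → i ∈ W := fun j hj hxj => by rwa [hT.eq_of_mem hi hxj]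
      simp only [mem_preimage, letter_eq hT hi, mem_union, mem_iUnion, mem_ofPred_eq]
      constructor
      · exact fun h => Or.inl ⟨i, h, hi⟩
      · rintro (⟨j, hj, hxj⟩ | ⟨h, -⟩)
        · exact h1 j hj hxj
        · exact absurd ⟨i, hi⟩ h
    · have h1 : ∀ j, x ∉ P j := not_exists.1 hx
      simp [letter, h1]
  rw [h]
  refine (MeasurableSet.biUnion (to_countable W) fun i _ => hP i).union ?_
  by_cases hW : Classical.arbitrary ι ∈ W
  · convert (MeasurableSet.iUnion hP).compl using 1
    ext x
    simp [hW]
  · simp [hW]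

lemma measurableSet_code (hT : IsPiecewiseExpanding X T P) (hTm : Measurable T) {n : ℕ}
    (W : Set (Fin n → ι)) : MeasurableSet (code T P n ⁻¹' W) := by
  have h1 : ∀ v : Fin n → ι, MeasurableSet (code T P n ⁻¹' {v}) := fun v => by
    have : code T P n ⁻¹' {v} = ⋂ i : Fin n, T^[i] ⁻¹' (letter P ⁻¹' {v i}) := by
      ext x
      simp only [mem_preimage, mem_singleton_iff, mem_iInter, funext_iff]
      rfl
    rw [this]
    exact MeasurableSet.iInter fun i => hTm.iterate _ (measurableSet_letter hT _)
  rw [← biUnion_preimage_singleton]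
  exact MeasurableSet.biUnion (to_countable W) fun v _ => h1 v

lemma measurable_comp_code (hT : IsPiecewiseExpanding X T P) (hTm : Measurable T) {n : ℕ}
    {β : Type*} [MeasurableSpace β] (F : (Fin n → ι) → β) :
    Measurable fun x => F (code T P n x) :=
  fun s _ => measurableSet_code hT hTm (F ⁻¹' s)

lemma lintegral_eq_tsum_code (hT : IsPiecewiseExpanding X T P) (hTm : Measurable T) {ν : Measure ℝ}
    {n : ℕ} (g : ℝ → ℝ≥0∞) :
    ∫⁻ x, g x ∂ν = ∑' v : Fin n → ι, ∫⁻ x in code T P n ⁻¹' {v}, g x ∂ν := by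
  rw [← lintegral_iUnion (fun v => measurableSet_code hT hTm {v})
    (fun v v' h => Disjoint.preimage _ (disjoint_singleton.2 h)), ← preimage_iUnion,
    iUnion_of_singleton, preimage_univ, setLIntegral_univ]

lemma lintegral_code_mul (hT : IsPiecewiseExpanding X T P) (hTm : Measurable T) {ν : Measure ℝ}
    {n : ℕ} (F : (Fin n → ι) → ℝ≥0∞) {g : ℝ → ℝ≥0∞} (hg : Measurable g) :
    ∫⁻ x, F (code T P n x) * g x ∂ν =
      ∑' v : Fin n → ι, F v * ∫⁻ x in code T P n ⁻¹' {v}, g x ∂ν := by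
  rw [lintegral_eq_tsum_code hT hTm (n := n)]
  congr 1 with v
  rw [← lintegral_const_mul _ hg]
  exact setLIntegral_congr_fun (measurableSet_code hT hTm _) fun x hx => by
    rw [mem_singleton_iff.1 hx]

lemma measure_eq_tsum_code (hT : IsPiecewiseExpanding X T P) (hTm : Measurable T) {ν : Measure ℝ}
    (n : ℕ) (S : Set ℝ) :
    ν S = ∑' v : Fin n → ι, ν (S ∩ code T P n ⁻¹' {v}) := by
  have := lintegral_eq_tsum_code hT hTm (ν := ν.restrict S) (n := n) (fun _ => 1)
  simp only [lintegral_const, one_mul, Measure.restrict_apply_univ] at this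
  rw [this]
  congr 1 with v
  rw [Measure.restrict_apply (measurableSet_code hT hTm _), inter_comm]

lemma measure_eq_tsum_cylinder (hT : IsPiecewiseExpanding X T P) (hμ : IsGibbsMeasure X T P μ)
    {ν : Measure ℝ} (hν : ν ≪ μ) (n : ℕ) (S : Set ℝ) :
    ν S = ∑' v : Fin n → ι, ν (S ∩ cylinder T P (extendWord v) n) := by
  rw [measure_eq_tsum_code hT hμ.invariant.measurable n S]
  congr 1 with v
  refine measure_congr ?_
  filter_upwards [hν.ae_le (ae_mem_repeller hμ)] with x hx
  exact propext (and_congr_right fun _ => (mem_cylinder_iff_code hT hx).symm)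

end Codes

/-! ### The Gibbs property and a lower mixing bound -/

section Mixing

variable {ι : Type*} {X : Set ℝ} {T : ℝ → ℝ} {P : ι → Set ℝ} {μ : Measure ℝ}

lemma mem_repeller_of_iterate (hT : IsPiecewiseExpanding X T P) {n : ℕ} (hn : 1 ≤ n) {w : ℕ → ι}
    {x : ℝ} (hx : x ∈ cylinder T P w n) (h : T^[n] x ∈ repeller X T P) : x ∈ repeller X T P := by
  refine ⟨hT.cylinder_subset w hn hx, fun k => ?_⟩
  rcases lt_or_ge k n with hk | hk
  · exact mem_iUnion.2 ⟨_, hx k hk⟩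
  · obtain ⟨j, rfl⟩ := Nat.exists_eq_add_of_le hk
    rw [Nat.add_comm, Function.iterate_add_apply]
    exact h.2 j

lemma exists_cylinder_inter (w w' : ℕ → ι) (t k : ℕ) : ∃ w'' : ℕ → ι,
    cylinder T P w t ∩ T^[t] ⁻¹' cylinder T P w' k = cylinder T P w'' (t + k) := by
  refine ⟨fun i => if i < t then w i else w' (i - t), ?_⟩
  rw [cylinder_add]
  congr 1
  · exact cylinder_congr fun i hi => by simp [hi]
  · simp

/-- A Gibbs measure is quasi-Bernoulli: an admissible concatenation of two cylinders has, up to a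
uniform factor, the product of their measures. -/
lemma exists_quasiBernoulli (hT : IsPiecewiseExpanding X T P) (hμ : IsGibbsMeasure X T P μ) :
    ∃ C : ℝ, 0 < C ∧ ∀ (t k : ℕ) (w w' : ℕ → ι), 1 ≤ t → 1 ≤ k →
      (cylinder T P w t ∩ T^[t] ⁻¹' cylinder T P w' k ∩ repeller X T P).Nonempty →
      μ (cylinder T P w t ∩ T^[t] ⁻¹' cylinder T P w' k) ≤
        ENNReal.ofReal C * (μ (cylinder T P w t) * μ (cylinder T P w' k)) ∧
      μ (cylinder T P w t) * μ (cylinder T P w' k) ≤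
        ENNReal.ofReal C * μ (cylinder T P w t ∩ T^[t] ⁻¹' cylinder T P w' k) := by
  have := hμ.prob
  obtain ⟨φ, -, c, Q, hc, h⟩ := hμ.gibbs
  set G : ℕ → ℝ → ℝ := fun n x => Real.exp (-(n * Q) + birkhoffSum T φ n x) with hG
  have hG0 : ∀ n x, 0 < G n x := fun n x => Real.exp_pos _
  have hle : ∀ (n : ℕ) (w : ℕ → ι), 1 ≤ n → ∀ x ∈ cylinder T P w n ∩ repeller X T P,
      G n x ≤ c * μ.real (cylinder T P w n) ∧ μ.real (cylinder T P w n) ≤ c * G n x := by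
    intro n w hn x hx
    obtain ⟨h1, h2⟩ := h n w hn x hx
    rw [le_div_iff₀ (hG0 n x), inv_mul_le_iff₀ hc] at h1
    rw [div_le_iff₀ (hG0 n x)] at h2
    exact ⟨h1, h2⟩
  refine ⟨c ^ 3, by positivity, ?_⟩
  rintro t k w w' ht hk ⟨x, ⟨hxt, hxk⟩, hxΛ⟩
  have hyΛ : T^[t] x ∈ repeller X T P := by
    refine ⟨hT.mapsTo.iterate t hxΛ.1, fun j => ?_⟩
    rw [← Function.iterate_add_apply]
    exact hxΛ.2 _
  obtain ⟨w'', hw''⟩ := exists_cylinder_inter (T := T) (P := P) w w' t k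
  have hx'' : x ∈ cylinder T P w'' (t + k) := hw'' ▸ ⟨hxt, hxk⟩
  obtain ⟨a1, a2⟩ := hle t w ht x ⟨hxt, hxΛ⟩
  obtain ⟨b1, b2⟩ := hle k w' hk _ ⟨hxk, hyΛ⟩
  obtain ⟨d1, d2⟩ := hle (t + k) w'' (by omega) x ⟨hx'', hxΛ⟩
  have hmul : G (t + k) x = G t x * G k (T^[t] x) := by
    simp only [hG, ← Real.exp_add, birkhoffSum_add]
    congr 1
    push_cast
    ring
  rw [hmul] at d1 d2
  rw [hw'', ← ENNReal.ofReal_toReal (measure_ne_top μ (cylinder T P w'' (t + k))),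
    ← ENNReal.ofReal_toReal (measure_ne_top μ (cylinder T P w t)),
    ← ENNReal.ofReal_toReal (measure_ne_top μ (cylinder T P w' k)),
    ← ENNReal.ofReal_mul ENNReal.toReal_nonneg, ← ENNReal.ofReal_mul (by positivity),
    ← ENNReal.ofReal_mul (by positivity)]
  have e1 := (hG0 t x).le
  have e2 := (hG0 k (T^[t] x)).le
  have e3 : 0 ≤ μ.real (cylinder T P w t) := measureReal_nonneg
  have e4 : 0 ≤ μ.real (cylinder T P w' k) := measureReal_nonneg
  constructor <;> refine ENNReal.ofReal_le_ofReal ?_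
  · calc μ.real (cylinder T P w'' (t + k)) ≤ c * (G t x * G k (T^[t] x)) := d2
      _ ≤ c * ((c * μ.real (cylinder T P w t)) * (c * μ.real (cylinder T P w' k))) := by gcongr
      _ = _ := by simp only [measureReal_def]; ring
  · calc μ.real (cylinder T P w t) * μ.real (cylinder T P w' k)
        ≤ (c * G t x) * (c * G k (T^[t] x)) := by gcongr
      _ = c ^ 2 * (G t x * G k (T^[t] x)) := by ring
      _ ≤ c ^ 2 * (c * μ.real (cylinder T P w'' (t + k))) := by gcongr
      _ = _ := by simp only [measureReal_def]; ring

variable {a b : ℝ} [Countable ι] [Nonempty ι]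

/-- Conditionally on any cylinder of `N` letters, after a fixed time gap every cylinder
is visited with at least a fixed proportion of its measure. -/
lemma exists_lower_mixing (hab : a ≤ b) (hT : IsPiecewiseExpanding (Icc a b) T P)
    (hG : IsGibbsMarkov (Icc a b) T P) (hμ : IsGibbsMeasure (Icc a b) T P μ)
    (hdecay : HasExpDecay (Icc a b) T μ) :
    ∃ (κ : ℝ) (g : ℕ), 0 < κ ∧ ∀ (N h : ℕ) (w w' : ℕ → ι), 1 ≤ N → 1 ≤ h →
      ENNReal.ofReal κ * (μ (cylinder T P w N) * μ (cylinder T P w' h)) ≤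
        μ (cylinder T P w N ∩ T^[N + g] ⁻¹' cylinder T P w' h) := by
  have := hμ.prob
  have hTm := hμ.invariant.measurable
  obtain ⟨C, hC, hqb⟩ := exists_quasiBernoulli hT hμ
  obtain ⟨D, c, hD, hc, hdec⟩ := exists_decay_interval hab hTm hdecay
  have hΛ := ae_mem_repeller hμ
  have hex : ∀ S : Set ℝ, μ S ≠ 0 → ∃ x ∈ S, x ∈ repeller (Icc a b) T P := fun S hS =>
    not_not.1 fun hcon => hS (measure_mono_null (fun x hx hx' => hcon ⟨x, hx, hx'⟩) hΛ)
  -- a point of the repeller in `T^N I ∩ K` comes from a point of the repeller in `I`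
  have hlift : ∀ (N : ℕ) (w : ℕ → ι) (S : Set ℝ), 1 ≤ N → ∀ y ∈ T^[N] '' cylinder T P w N ∩ S,
      y ∈ repeller (Icc a b) T P →
      (cylinder T P w N ∩ T^[N] ⁻¹' S ∩ repeller (Icc a b) T P).Nonempty := by
    rintro N w S hN y ⟨⟨x, hx, rfl⟩, hy⟩ hyΛ
    exact ⟨x, ⟨hx, hy⟩, mem_repeller_of_iterate hT hN hx hyΛ⟩
  have hJ : ∀ (N : ℕ) (w : ℕ → ι), 1 ≤ N → μ (cylinder T P w N) ≠ 0 →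
      (T^[N] '' cylinder T P w N).OrdConnected := fun N w hN h0 => by
    rw [image_iterate_cylinder hG hN w (nonempty_of_measure_ne_zero h0)]
    exact hT.ordConnected_image _
  have hsum : ∀ (N n : ℕ) (I S : Set ℝ), MeasurableSet S → μ (I ∩ T^[N] ⁻¹' S) =
      ∑' v : Fin n → ι, μ (I ∩ T^[N] ⁻¹' (S ∩ cylinder T P (extendWord v) n)) := by
    intro N n I S hS
    have hmap : ∀ A, MeasurableSet A → (μ.restrict I).map T^[N] A = μ (I ∩ T^[N] ⁻¹' A) :=
      fun A hA => by
        rw [Measure.map_apply (hTm.iterate N) hA, Measure.restrict_apply (hTm.iterate N hA),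
          inter_comm]
    have hac : (μ.restrict I).map T^[N] ≪ μ := by
      have := (Measure.restrict_le_self (μ := μ) (s := I)).absolutelyContinuous.map
        (hTm.iterate N)
      rwa [(hμ.invariant.iterate N).map_eq] at this
    rw [← hmap S hS, measure_eq_tsum_cylinder hT hμ hac n S]
    congr 1 with v
    exact hmap _ (hS.inter (measurableSet_cylinder hT hG _ _))
  -- the image of a cylinder of positive measure has measure at least `1 / C`
  have himg : ∀ (N : ℕ) (w : ℕ → ι), 1 ≤ N → μ (cylinder T P w N) ≠ 0 →
      1 ≤ ENNReal.ofReal C * μ (T^[N] '' cylinder T P w N) := fun N w hN h0 => by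
    set I := cylinder T P w N
    have key : μ I ≤ μ I * (ENNReal.ofReal C * μ (T^[N] '' I)) := by
      have h1 := hsum N 1 I univ MeasurableSet.univ
      rw [preimage_univ, inter_univ] at h1
      rw [measure_eq_tsum_cylinder hT hμ Measure.AbsolutelyContinuous.rfl 1 (T^[N] '' I),
        ← ENNReal.tsum_mul_left, ← ENNReal.tsum_mul_left]
      refine h1.le.trans (ENNReal.tsum_le_tsum fun v => ?_)
      rw [univ_inter]
      by_cases hz : μ (I ∩ T^[N] ⁻¹' cylinder T P (extendWord v) 1) = 0
      · rw [hz]; exact zero_le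
      obtain ⟨x, hx, hxΛ⟩ := hex _ hz
      have h2 := (hqb N 1 w (extendWord v) hN le_rfl ⟨x, hx, hxΛ⟩).1
      have h3 : cylinder T P (extendWord v) 1 ⊆ T^[N] '' I := by
        rw [cylinder_one, image_iterate_cylinder hG hN w ⟨x, hx.1⟩]
        have h4 : T^[N] x ∈ T '' P (w (N - 1)) := by
          rw [← image_iterate_cylinder hG hN w ⟨x, hx.1⟩]
          exact mem_image_of_mem _ hx.1
        have h5 : T^[N] x ∈ P (extendWord v 0) := by
          have h6 := hx.2
          rwa [mem_preimage, cylinder_one] at h6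
        exact (hG.markov _ _).resolve_right fun hd => disjoint_left.1 hd h5 h4
      rw [inter_eq_right.2 h3]
      refine h2.trans (le_of_eq ?_)
      ring
    have h2 : μ I * 1 ≤ μ I * (ENNReal.ofReal C * μ (T^[N] '' I)) := by rwa [mul_one]
    exact (ENNReal.mul_le_mul_iff_right h0 (measure_ne_top _ _)).1 h2
  obtain ⟨g, hg⟩ : ∃ g : ℕ, D * Real.exp (-(c * g)) ≤ 1 / (2 * C) := by
    have h1 : Tendsto (fun n : ℕ => c * (n : ℝ)) atTop atTop :=
      tendsto_natCast_atTop_atTop.const_mul_atTop hc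
    have h2 : Tendsto (fun n : ℕ => D * Real.exp (-(c * n))) atTop (𝓝 0) := by
      simpa using (Real.tendsto_exp_neg_atTop_nhds_zero.comp h1).const_mul D
    exact (h2.eventually_le_const (by positivity)).exists
  refine ⟨1 / (2 * C ^ 2), g, by positivity, fun N h w w' hN hh => ?_⟩
  set I := cylinder T P w N
  set K := cylinder T P w' h
  have hKm : MeasurableSet K := measurableSet_cylinder hT hG _ _
  set S := T^[g] ⁻¹' K with hS
  have hSm : MeasurableSet S := hTm.iterate g hKm
  have hNS : T^[N + g] ⁻¹' K = T^[N] ⁻¹' S := by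
    rw [hS, ← preimage_comp, ← Function.iterate_add, Nat.add_comm]
  rw [hNS]
  by_cases h0 : μ I = 0
  · rw [h0]; simp
  -- the quasi-Bernoulli property, summed over the cylinders that make up `T^{-g} K`
  have hlow : μ I * μ (T^[N] '' I ∩ S) ≤ ENNReal.ofReal C * μ (I ∩ T^[N] ⁻¹' S) := by
    rw [hsum N (g + h) I S hSm, measure_eq_tsum_cylinder hT hμ Measure.AbsolutelyContinuous.rfl
      (g + h) (T^[N] '' I ∩ S), ← ENNReal.tsum_mul_left, ← ENNReal.tsum_mul_left]
    refine ENNReal.tsum_le_tsum fun v => ?_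
    by_cases hz : μ (T^[N] '' I ∩ S ∩ cylinder T P (extendWord v) (g + h)) = 0
    · rw [hz]; simp
    obtain ⟨y, hy, hyΛ⟩ := hex _ hz
    have hsub : cylinder T P (extendWord v) (g + h) ⊆ S := fun z hz => by
      have hyv := hy.2
      rw [cylinder_add] at hz hyv
      intro i hi
      have h1 := hz.2 i hi
      rwa [hT.eq_of_mem (hyv.2 i hi) (hy.1.2 i hi)] at h1
    rw [inter_eq_right.2 hsub]
    exact le_trans (by gcongr; exact inter_subset_right)
      (hqb N (g + h) w _ hN (by omega) (hlift N w _ hN y ⟨hy.1.1, hy.2⟩ hyΛ)).2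
  have hJr : 1 / C ≤ μ.real (T^[N] '' I) := by
    have := ENNReal.toReal_mono (by finiteness) (himg N w hN h0)
    rw [ENNReal.toReal_mul, ENNReal.toReal_ofReal hC.le, ENNReal.toReal_one] at this
    rw [div_le_iff₀ hC, mul_comm]
    exact this
  -- `T^N I` is an interval of measure at least `1 / C`, and `g` is chosen so that the error in the
  -- decay of correlations is at most half of the main term
  have hmix : 1 / (2 * C) * μ.real K ≤ μ.real (T^[N] '' I ∩ S) := by
    have h1 := (abs_le.1 (hdec _ K (hJ N w hN h0) hKm g)).1
    have hK0 : 0 ≤ μ.real K := measureReal_nonneg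
    have h2 : D * Real.exp (-(c * g)) * μ.real K ≤ 1 / (2 * C) * μ.real K := by gcongr
    have h3 : 1 / C * μ.real K ≤ μ.real (T^[N] '' I) * μ.real K := by gcongr
    have h4 : 1 / C * μ.real K = 1 / (2 * C) * μ.real K + 1 / (2 * C) * μ.real K := by
      field_simp; norm_num
    linarith
  have hreal := ENNReal.toReal_mono (by finiteness) hlow
  simp only [ENNReal.toReal_mul, ENNReal.toReal_ofReal hC.le, ← measureReal_def] at hreal
  rw [← ENNReal.ofReal_toReal (measure_ne_top μ I), ← ENNReal.ofReal_toReal (measure_ne_top μ K),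
    ← ENNReal.ofReal_mul ENNReal.toReal_nonneg, ← ENNReal.ofReal_mul (by positivity)]
  refine ENNReal.ofReal_le_of_le_toReal ?_
  have h5 : μ.real I * (1 / (2 * C) * μ.real K) ≤ C * μ.real (I ∩ T^[N] ⁻¹' S) :=
    le_trans (by gcongr) hreal
  have h6 : 1 / (2 * C ^ 2) * (μ.real I * μ.real K) =
      (μ.real I * (1 / (2 * C) * μ.real K)) / C := by field_simp
  rw [← measureReal_def, ← measureReal_def, ← measureReal_def, h6, div_le_iff₀ hC]
  linarith

end Mixing

/-! ### A birthday problem for lower mixing processes -/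

section Birthday

variable {ι : Type*} {X : Set ℝ} {T : ℝ → ℝ} {P : ι → Set ℝ} {μ : Measure ℝ} [Nonempty ι]

/-- Lower mixing with gap `g`: conditionally on the first `N` letters, the law of the orbit
after time `N + g` dominates `κ` times the invariant law, on cylinders. -/
def HasLowerMixing (T : ℝ → ℝ) (P : ι → Set ℝ) (μ : Measure ℝ) (κ : ℝ) (g : ℕ) : Prop :=
  ∀ (N h : ℕ) (u : Fin N → ι) (v : Fin h → ι), 1 ≤ N → 1 ≤ h →
    ENNReal.ofReal κ * (μ (code T P N ⁻¹' {u}) * μ (code T P h ⁻¹' {v})) ≤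
      μ (code T P N ⁻¹' {u} ∩ T^[N + g] ⁻¹' (code T P h ⁻¹' {v}))

lemma exists_hasLowerMixing [Countable ι] {a b : ℝ} (hab : a ≤ b)
    (hT : IsPiecewiseExpanding (Icc a b) T P) (hG : IsGibbsMarkov (Icc a b) T P)
    (hμ : IsGibbsMeasure (Icc a b) T P μ) (hdecay : HasExpDecay (Icc a b) T μ) :
    ∃ (κ : ℝ) (g : ℕ), 0 < κ ∧ HasLowerMixing T P μ κ g := by
  obtain ⟨κ, g, hκ, h⟩ := exists_lower_mixing hab hT hG hμ hdecay
  have hΛ := ae_mem_repeller hμ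
  have hcode : ∀ (n : ℕ) (v : Fin n → ι),
      (code T P n ⁻¹' {v} : Set ℝ) =ᵐ[μ] cylinder T P (extendWord v) n := fun n v => by
    filter_upwards [hΛ] with x hx
    exact propext (mem_cylinder_iff_code hT hx).symm
  refine ⟨κ, g, hκ, fun N k u v hN hk => ?_⟩
  rw [measure_congr (hcode N u), measure_congr (hcode k v), measure_congr ((hcode N u).inter
    ((hμ.invariant.iterate (N + g)).quasiMeasurePreserving.preimage_ae_eq (hcode k v)))]
  exact h N k _ _ hN hk

variable [Countable ι] [IsProbabilityMeasure μ] {κ : ℝ} {g h : ℕ}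

/-- One sample of the orbit: `ψ` is the probability of surviving the sample and `φ` that of being
killed by it. If `φ` has mean at least `q`, then lower mixing reduces the survivors by a factor
`1 - κ q ≤ exp (-κ q)`, conditionally on the first `N` letters. -/
lemma HasLowerMixing.setLIntegral_le (hmix : HasLowerMixing T P μ κ g)
    (hT : IsPiecewiseExpanding X T P) (hTm : Measurable T) (hκ : 0 ≤ κ) (hh : 1 ≤ h) {N : ℕ}
    (hN : 1 ≤ N) (u : Fin N → ι) {φ ψ : (Fin h → ι) → ℝ≥0∞} (hsum : ∀ v, ψ v + φ v = 1)
    {q : ℝ} (hq0 : 0 ≤ q) (hq : ENNReal.ofReal q ≤ ∫⁻ x, φ (code T P h x) ∂μ) :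
    ∫⁻ x in code T P N ⁻¹' {u}, ψ (code T P h (T^[N + g] x)) ∂μ ≤
      ENNReal.ofReal (Real.exp (-(κ * q))) * μ (code T P N ⁻¹' {u}) := by
  set U := code T P N ⁻¹' {u}
  have hTN := hTm.iterate (N + g)
  have hmφ : Measurable fun x => φ (code T P h x) := measurable_comp_code hT hTm φ
  have hmψ : Measurable fun x => ψ (code T P h x) := measurable_comp_code hT hTm ψ
  have hexp : ∀ ν : Measure ℝ, ∫⁻ x, φ (code T P h x) ∂ν =
      ∑' v : Fin h → ι, φ v * ν (code T P h ⁻¹' {v}) := fun ν => by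
    have := lintegral_code_mul hT hTm (ν := ν) φ (measurable_const (a := (1 : ℝ≥0∞)))
    simpa using this
  have hlow : ENNReal.ofReal κ * μ U * ENNReal.ofReal q ≤
      ∫⁻ x in U, φ (code T P h (T^[N + g] x)) ∂μ := by
    calc ENNReal.ofReal κ * μ U * ENNReal.ofReal q
        ≤ ENNReal.ofReal κ * μ U * ∑' v : Fin h → ι, φ v * μ (code T P h ⁻¹' {v}) := by
          rw [← hexp]; gcongr
      _ = ∑' v : Fin h → ι, φ v * (ENNReal.ofReal κ * (μ U * μ (code T P h ⁻¹' {v}))) := by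
          rw [← ENNReal.tsum_mul_left]
          congr 1 with v
          ring
      _ ≤ ∑' v : Fin h → ι, φ v * ((μ.restrict U).map T^[N + g]) (code T P h ⁻¹' {v}) := by
          refine ENNReal.tsum_le_tsum fun v => ?_
          rw [Measure.map_apply hTN (measurableSet_code hT hTm _),
            Measure.restrict_apply (hTN (measurableSet_code hT hTm _)), inter_comm]
          gcongr
          exact hmix N h u v hN hh
      _ = _ := by rw [← hexp, lintegral_map hmφ hTN]
  have htot : ∫⁻ x in U, ψ (code T P h (T^[N + g] x)) ∂μ +
      ∫⁻ x in U, φ (code T P h (T^[N + g] x)) ∂μ = μ U := by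
    rw [← lintegral_add_left (show Measurable fun x => ψ (code T P h (T^[N + g] x)) from
      hmψ.comp hTN)]
    simp [hsum]
  set I := ∫⁻ x in U, ψ (code T P h (T^[N + g] x)) ∂μ
  have hle : I + ENNReal.ofReal κ * μ U * ENNReal.ofReal q ≤ μ U := by
    exact (add_le_add_right hlow I).trans htot.le
  have hIfin : I ≠ ∞ := ne_top_of_le_ne_top (measure_ne_top μ U) (le_self_add.trans htot.le)
  have hreal := ENNReal.toReal_mono (measure_ne_top μ U) hle
  rw [ENNReal.toReal_add hIfin (by finiteness)] at hreal
  simp only [ENNReal.toReal_mul, ENNReal.toReal_ofReal hκ, ENNReal.toReal_ofReal hq0] at hreal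
  rw [← ENNReal.ofReal_toReal hIfin, ← ENNReal.ofReal_toReal (measure_ne_top μ U),
    ← ENNReal.ofReal_mul (Real.exp_pos _).le]
  refine ENNReal.ofReal_le_ofReal ?_
  have h1 := Real.add_one_le_exp (-(κ * q))
  have h2 : 0 ≤ (μ U).toReal := ENNReal.toReal_nonneg
  nlinarith

lemma HasLowerMixing.lintegral_mul_le (hmix : HasLowerMixing T P μ κ g)
    (hT : IsPiecewiseExpanding X T P) (hTm : Measurable T) (hκ : 0 ≤ κ) (hh : 1 ≤ h) {N : ℕ}
    (hN : 1 ≤ N) {Φ : ℝ → ℝ≥0∞} (hΦ : Function.FactorsThrough Φ (code T P N))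
    {φ ψ : (Fin h → ι) → ℝ≥0∞} (hsum : ∀ v, ψ v + φ v = 1)
    {q : ℝ} (hq0 : 0 ≤ q) (hq : ENNReal.ofReal q ≤ ∫⁻ x, φ (code T P h x) ∂μ) :
    ∫⁻ x, Φ x * ψ (code T P h (T^[N + g] x)) ∂μ ≤
      ENNReal.ofReal (Real.exp (-(κ * q))) * ∫⁻ x, Φ x ∂μ := by
  obtain ⟨F, rfl⟩ := (Function.factorsThrough_iff Φ).1 hΦ
  have h1 := lintegral_code_mul hT hTm (ν := μ) F
    ((measurable_comp_code hT hTm ψ).comp (hTm.iterate (N + g)))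
  have h2 := lintegral_code_mul hT hTm (ν := μ) F (measurable_const (a := (1 : ℝ≥0∞)))
  simp only [mul_one, lintegral_const, Measure.restrict_apply_univ, one_mul] at h2
  simp only [Function.comp_apply] at h1 ⊢
  rw [h1, h2, ← ENNReal.tsum_mul_left]
  refine ENNReal.tsum_le_tsum fun u => ?_
  rw [mul_left_comm]
  gcongr
  exact hmix.setLIntegral_le hT hTm hκ hh hN u hsum hq0 hq

/-- Sampling the orbit `m` times, with gaps that let the mixing act, after the first `N` letters. -/
lemma HasLowerMixing.lintegral_prod_le (hmix : HasLowerMixing T P μ κ g)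
    (hT : IsPiecewiseExpanding X T P) (hTm : Measurable T) (hκ : 0 ≤ κ) (hh : 1 ≤ h) {N : ℕ}
    (hN : 1 ≤ N) {Φ : ℝ → ℝ≥0∞} (hΦ : Function.FactorsThrough Φ (code T P N))
    {φ ψ : (Fin h → ι) → ℝ≥0∞} (hsum : ∀ v, ψ v + φ v = 1)
    {q : ℝ} (hq0 : 0 ≤ q) (hq : ENNReal.ofReal q ≤ ∫⁻ x, φ (code T P h x) ∂μ) (m : ℕ) :
    ∫⁻ x, Φ x * ∏ j ∈ Finset.range m, ψ (code T P h (T^[N + g + j * (h + g)] x)) ∂μ ≤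
      ENNReal.ofReal (Real.exp (-(κ * q * m))) * ∫⁻ x, Φ x ∂μ := by
  induction m with
  | zero => simp
  | succ m ih =>
    have hfac : Function.FactorsThrough
        (fun x => Φ x * ∏ j ∈ Finset.range m, ψ (code T P h (T^[N + g + j * (h + g)] x)))
        (code T P (N + m * (h + g))) := fun x y hxy => by
      have h1 : Φ x = Φ y := hΦ (code_eq_of_le (Nat.le_add_right _ _) hxy)
      have h2 : ∀ j ∈ Finset.range m, ψ (code T P h (T^[N + g + j * (h + g)] x)) =
          ψ (code T P h (T^[N + g + j * (h + g)] y)) := fun j hj => by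
        rw [code_iterate_eq (code_eq_of_le ?_ hxy)]
        have : (j + 1) * (h + g) ≤ m * (h + g) :=
          Nat.mul_le_mul_right _ (Finset.mem_range.1 hj)
        rw [add_mul] at this
        omega
      simp only [h1, Finset.prod_congr rfl h2]
    have hstep := hmix.lintegral_mul_le hT hTm hκ hh (le_trans hN (Nat.le_add_right _ _)) hfac
      hsum hq0 hq
    simp only [Finset.prod_range_succ, ← mul_assoc]
    simp only [Nat.add_right_comm N (m * (h + g)) g] at hstep
    refine hstep.trans ((mul_le_mul_right ih _).trans (le_of_eq ?_))
    rw [← mul_assoc, ← ENNReal.ofReal_mul (Real.exp_pos _).le, ← Real.exp_add]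
    congr 3
    push_cast
    ring

/-- The mass of the cell `k` of a labelling `A` of the points. -/
noncomputable def cellMass (μ : Measure ℝ) (A : ℝ → ℤ) (k : ℤ) : ℝ := μ.real (A ⁻¹' {k})

/-- The probability that two independent points lie in the same cell. -/
noncomputable def collisionProb (μ : Measure ℝ) (A : ℝ → ℤ) : ℝ≥0∞ :=
  ∫⁻ x, ENNReal.ofReal (cellMass μ A (A x)) ∂μ

lemma cellMass_le_sqrt {A : ℝ → ℤ} (hA : Measurable A) (k : ℤ) :
    cellMass μ A k ≤ √(collisionProb μ A).toReal := by
  have h0 : 0 ≤ cellMass μ A k := measureReal_nonneg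
  have hfin : collisionProb μ A ≠ ∞ := by
    refine ne_top_of_le_ne_top ENNReal.one_ne_top ?_
    refine (lintegral_mono (g := fun _ => 1) fun x => ?_).trans (by simp)
    exact ENNReal.ofReal_le_one.2 measureReal_le_one
  refine Real.le_sqrt_of_sq_le ?_
  rw [← ENNReal.ofReal_le_iff_le_toReal hfin, pow_two, ENNReal.ofReal_mul h0]
  calc ENNReal.ofReal (cellMass μ A k) * ENNReal.ofReal (cellMass μ A k)
      = ENNReal.ofReal (cellMass μ A k) * μ (A ⁻¹' {k}) := by
        congr 1
        exact ENNReal.ofReal_toReal (measure_ne_top _ _)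
    _ = ∫⁻ x in A ⁻¹' {k}, ENNReal.ofReal (cellMass μ A k) ∂μ := by rw [setLIntegral_const]
    _ = ∫⁻ x in A ⁻¹' {k}, ENNReal.ofReal (cellMass μ A (A x)) ∂μ :=
        setLIntegral_congr_fun (hA (measurableSet_singleton k)) fun x hx => by
          rw [mem_singleton_iff.1 hx]
    _ ≤ _ := setLIntegral_le_lintegral _ _

lemma half_le_one_sub_exp_neg {u : ℝ} (h0 : 0 ≤ u) (h1 : u ≤ 1) :
    u / 2 ≤ 1 - Real.exp (-u) := by
  have h2 := Real.add_one_le_exp u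
  have h3 : Real.exp (-u) ≤ 1 / (1 + u) := by
    rw [Real.exp_neg, ← one_div]
    exact one_div_le_one_div_of_le (by linarith) (by linarith)
  have h4 : 1 / (1 + u) ≤ 1 - u / 2 := by
    rw [div_le_iff₀ (by linarith)]
    nlinarith
  linarith

/-- The birthday problem: `2 m` samples of the orbit, labelled by cells, are pairwise distinct with
probability at most `exp (-y / 2)` as soon as `m` exceeds `1 / √s` by a factor `y / κ`, where `s`
is the collision probability of two independent points. -/
lemma HasLowerMixing.measure_distinct_le (hmix : HasLowerMixing T P μ κ g)
    (hT : IsPiecewiseExpanding X T P) (hTm : Measurable T) (hκ : 0 < κ) (hh : 1 ≤ h)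
    (α : (Fin h → ι) → ℤ) {m : ℕ} {y : ℝ} (hy : 1 ≤ y)
    (hym : y ≤ κ * m * √(collisionProb μ fun x => α (code T P h x)).toReal) :
    μ {x | ∀ i j, i < j → j < 2 * m → α (code T P h (T^[1 + g + i * (h + g)] x)) ≠
      α (code T P h (T^[1 + g + j * (h + g)] x))} ≤ ENNReal.ofReal (Real.exp (-(y / 2))) := by
  set A : ℝ → ℤ := fun x => α (code T P h x) with hA
  have hAm : Measurable A := measurable_comp_code hT hTm α
  set p := cellMass μ A with hp
  have hp0 : ∀ k, 0 ≤ p k := fun k => measureReal_nonneg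
  set t : ℕ → ℕ := fun j => 1 + g + j * (h + g) with ht
  set s := √(collisionProb μ A).toReal with hs
  have hm0 : (0 : ℝ) ≤ m := m.cast_nonneg
  have hs0 : 0 < s := (Real.sqrt_nonneg _).lt_of_ne fun h0 => by
    rw [← hs] at h0
    rw [← h0] at hym
    linarith
  set D := {x | ∀ i j, i < j → j < 2 * m → A (T^[t i] x) ≠ A (T^[t j] x)} with hD
  set H : ℝ → ℝ≥0∞ := fun x =>
    ∏ j ∈ Finset.range m, ENNReal.ofReal (Real.exp (-(κ * m * p (A (T^[t j] x))))) with hH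
  -- given the first half of the samples, the second half avoids their cells
  have hhalf : μ D ≤ ∫⁻ x, H x ∂μ := by
    rw [measure_eq_tsum_code hT hTm (1 + m * (h + g)) D,
      lintegral_eq_tsum_code hT hTm (n := 1 + m * (h + g)) H]
    refine ENNReal.tsum_le_tsum fun u => ?_
    set U := code T P (1 + m * (h + g)) ⁻¹' {u} with hU
    have hUm : MeasurableSet U := measurableSet_code hT hTm _
    rcases (D ∩ U).eq_empty_or_nonempty with he | ⟨x₀, hx₀D, hx₀U⟩
    · rw [he]; simp
    have hconst : ∀ x ∈ U, ∀ j < m, A (T^[t j] x) = A (T^[t j] x₀) := fun x hx j hj => by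
      simp only [hA]
      rw [code_iterate_eq (code_eq_of_le (n := 1 + m * (h + g)) ?_
        ((mem_singleton_iff.1 hx).trans (mem_singleton_iff.1 hx₀U).symm))]
      have : (j + 1) * (h + g) ≤ m * (h + g) := Nat.mul_le_mul_right _ hj
      rw [add_mul] at this
      simp only [ht]
      omega
    -- the cells met by the first half have total mass `q`, as they are distinct
    set V : Finset ℤ := (Finset.range m).image fun j => A (T^[t j] x₀) with hV
    have hinj : Set.InjOn (fun j => A (T^[t j] x₀)) (Finset.range m : Set ℕ) := by
      intro i hi j hj hij
      simp only [Finset.coe_range, mem_Iio] at hi hj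
      by_contra hne
      rcases lt_or_gt_of_ne hne with hlt | hlt
      · exact hx₀D i j hlt (by omega) hij
      · exact hx₀D j i hlt (by omega) hij.symm
    set q : ℝ := ∑ j ∈ Finset.range m, p (A (T^[t j] x₀)) with hq
    have hqV : q = ∑ k ∈ V, p k := by rw [hV, Finset.sum_image hinj]
    have hq0 : 0 ≤ q := Finset.sum_nonneg fun j _ => hp0 _
    classical
    set φ : (Fin h → ι) → ℝ≥0∞ := fun v => if α v ∈ V then 1 else 0 with hφ
    set ψ : (Fin h → ι) → ℝ≥0∞ := fun v => if α v ∈ V then 0 else 1 with hψ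
    have hφψ : ∀ v, ψ v + φ v = 1 := fun v => by
      by_cases hv : α v ∈ V <;> simp [hφ, hψ, hv]
    have hint : ENNReal.ofReal q ≤ ∫⁻ x, φ (code T P h x) ∂μ := by
      have h1 : ∫⁻ x, φ (code T P h x) ∂μ = μ (A ⁻¹' (V : Set ℤ)) := by
        rw [← lintegral_indicator_one (hAm V.measurableSet)]
        congr 1 with x
        simp [hφ, hA, indicator]
      rw [h1, hqV, ENNReal.ofReal_sum_of_nonneg fun k _ => hp0 k,
        ← sum_measure_preimage_singleton _ fun k _ => hAm (measurableSet_singleton k)]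
      exact Finset.sum_le_sum fun k _ => (ENNReal.ofReal_toReal (measure_ne_top _ _)).le
    have hfac : Function.FactorsThrough (U.indicator (1 : ℝ → ℝ≥0∞))
        (code T P (1 + m * (h + g))) := fun x y hxy => by
      have : x ∈ U ↔ y ∈ U := by rw [hU, mem_preimage, mem_preimage, hxy]
      by_cases hx : x ∈ U
      · simp [hx, this.1 hx]
      · have hy : y ∉ U := fun hy => hx (this.2 hy)
        simp [hx, hy]
    have hbound := hmix.lintegral_prod_le hT hTm hκ.le hh (by omega) hfac hφψ hq0 hint m
    rw [lintegral_indicator_one hUm] at hbound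
    have hHU : ∫⁻ x in U, H x ∂μ = ENNReal.ofReal (Real.exp (-(κ * q * m))) * μ U := by
      rw [← setLIntegral_const]
      refine setLIntegral_congr_fun hUm fun x hx => ?_
      simp only [hH]
      rw [Finset.prod_congr rfl fun j hj => by rw [hconst x hx j (Finset.mem_range.1 hj)],
        ← ENNReal.ofReal_prod_of_nonneg fun j _ => (Real.exp_pos _).le, ← Real.exp_sum]
      congr 2
      rw [Finset.sum_neg_distrib, ← Finset.mul_sum]
      ring
    rw [hHU]
    refine le_trans ?_ hbound
    refine meas_le_lintegral₀ (Measurable.aemeasurable ?_) fun x hx => ?_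
    · refine (measurable_one.indicator hUm).mul (Finset.measurable_fun_prod _ fun j _ => ?_)
      exact (measurable_comp_code hT hTm ψ).comp (hTm.iterate _)
    · rw [indicator_of_mem hx.2, Pi.one_apply, one_mul, Finset.prod_eq_one]
      intro j hj
      have hj' := Finset.mem_range.1 hj
      have htime : 1 + m * (h + g) + g + j * (h + g) = t (m + j) := by simp only [ht]; ring
      rw [htime]
      refine if_neg fun hmem => ?_
      obtain ⟨i, hi, hij⟩ := Finset.mem_image.1 hmem
      have hi' := Finset.mem_range.1 hi
      rw [← hconst x hx.2 i hi'] at hij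
      exact hx.1 i (m + j) (by omega) (by omega) hij
  -- integrating over the first half
  set ψ : (Fin h → ι) → ℝ≥0∞ := fun v => ENNReal.ofReal (Real.exp (-(κ * m * p (α v)))) with hψ
  set φ : (Fin h → ι) → ℝ≥0∞ := fun v => ENNReal.ofReal (1 - Real.exp (-(κ * m * p (α v)))) with hφ
  have hle1 : ∀ v, Real.exp (-(κ * m * p (α v))) ≤ 1 := fun v => by
    rw [Real.exp_le_one_iff]
    have := hp0 (α v)
    have : 0 ≤ κ * m * p (α v) := by positivity
    linarith
  have hφψ : ∀ v, ψ v + φ v = 1 := fun v => by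
    rw [hψ, hφ, ← ENNReal.ofReal_add (Real.exp_pos _).le (sub_nonneg.2 (hle1 v))]
    simp
  have hq : ENNReal.ofReal (s / 2) ≤ ∫⁻ x, φ (code T P h x) ∂μ := by
    have h1 : ∀ x, ENNReal.ofReal (1 / (2 * s)) * ENNReal.ofReal (p (A x)) ≤ φ (code T P h x) :=
      fun x => by
        rw [← ENNReal.ofReal_mul (by positivity)]
        refine ENNReal.ofReal_le_ofReal ?_
        have h2 : p (A x) / s ≤ 1 := (div_le_one hs0).2 (cellMass_le_sqrt hAm _)
        have h3 := half_le_one_sub_exp_neg (div_nonneg (hp0 (A x)) hs0.le) h2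
        -- `κ m ≥ 1 / s`, and `p ≤ s` keeps the exponent in the range where `1 - exp (-u) ≥ u / 2`
        have h4 : p (A x) / s ≤ κ * m * p (A x) := by
          rw [div_le_iff₀ hs0]
          have := mul_le_mul_of_nonneg_right (hy.trans hym) (hp0 (A x))
          linarith
        have h5 : Real.exp (-(κ * m * p (A x))) ≤ Real.exp (-(p (A x) / s)) :=
          Real.exp_le_exp.2 (by linarith)
        calc 1 / (2 * s) * p (A x) = p (A x) / s / 2 := by field_simp
          _ ≤ 1 - Real.exp (-(κ * m * p (A x))) := by linarith
    have hmeas : Measurable fun x => ENNReal.ofReal (p (A x)) :=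
      (measurable_of_countable fun k => ENNReal.ofReal (p k)).comp hAm
    refine le_trans ?_ (lintegral_mono h1)
    rw [lintegral_const_mul _ hmeas]
    have hfin : collisionProb μ A ≠ ∞ := fun htop => by simp [hs, htop] at hs0
    have h6 : ∫⁻ x, ENNReal.ofReal (p (A x)) ∂μ = ENNReal.ofReal (s ^ 2) := by
      rw [hs, Real.sq_sqrt ENNReal.toReal_nonneg, ENNReal.ofReal_toReal hfin]
      rfl
    rw [h6, ← ENNReal.ofReal_mul (by positivity)]
    refine ENNReal.ofReal_le_ofReal (le_of_eq ?_)
    field_simp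
  have hfac : Function.FactorsThrough (fun _ : ℝ => (1 : ℝ≥0∞)) (code T P 1) := fun _ _ _ => rfl
  have hfin := hmix.lintegral_prod_le hT hTm hκ.le hh le_rfl hfac hφψ (by positivity) hq m
  simp only [one_mul, lintegral_one, measure_univ, mul_one] at hfin
  refine hhalf.trans (hfin.trans (ENNReal.ofReal_le_ofReal (Real.exp_le_exp.2 ?_)))
  have : κ * (s / 2) * m = κ * m * s / 2 := by ring
  rw [this]
  linarith

end Birthday

/-! ### Cells determined by finitely many letters -/

section Cells

variable {ι : Type*} {a b : ℝ} {T : ℝ → ℝ} {P : ι → Set ℝ} {μ : Measure ℝ}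

/-- Cylinders of positive measure shrink exponentially fast. -/
lemma exists_diam_bound (hab : a < b) (hT : IsPiecewiseExpanding (Icc a b) T P)
    (hD : HasBoundedDistortion T P) (hG : IsGibbsMarkov (Icc a b) T P)
    (hμ : IsGibbsMeasure (Icc a b) T P μ) (hdecay : HasExpDecay (Icc a b) T μ)
    (hna : ∀ x, μ {x} = 0) :
    ∃ n₀, 1 ≤ n₀ ∧ ∀ (q : ℕ) (w : ℕ → ι), 0 < μ (cylinder T P w (q * n₀)) →
      ∀ x ∈ cylinder T P w (q * n₀), ∀ y ∈ cylinder T P w (q * n₀), x ∈ Icc a b → y ∈ Icc a b →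
        2 ^ q * |x - y| ≤ b - a := by
  obtain ⟨K, hK, hdist⟩ := exists_distortion hT hD hG
  obtain ⟨n, hn⟩ := exists_forall_cylinder_volume_lt hab hT hD hG hμ hdecay hna
    (η := 1 / (2 * K)) (by positivity)
  set n₀ := max n 1
  have hn₀ : 1 ≤ n₀ := le_max_right _ _
  refine ⟨n₀, hn₀, fun q => ?_⟩
  induction q with
  | zero =>
    intro w _ x _ y _ hx hy
    rw [pow_zero, one_mul, abs_le]
    exact ⟨by linarith [hx.1, hy.2], by linarith [hx.2, hy.1]⟩
  | succ q ih =>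
    intro w hpos x hx y hy hxX hyX
    rw [add_mul, one_mul, Nat.add_comm, cylinder_add] at hpos hx hy
    have hpos1 : 0 < μ (cylinder T P w n₀) := hpos.trans_le (measure_mono inter_subset_left)
    have hpos2 : 0 < μ (cylinder T P (fun i => w (n₀ + i)) (q * n₀)) := by
      rw [← (hμ.invariant.iterate n₀).measure_preimage
        (measurableSet_cylinder hT hG _ _).nullMeasurableSet]
      exact hpos.trans_le (measure_mono inter_subset_right)
    have h1 := ih _ hpos2 _ hx.2 _ hy.2 (hT.mapsTo.iterate n₀ hxX) (hT.mapsTo.iterate n₀ hyX)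
    have h2 := ((hdist n₀ w hn₀).1 x hx.1 y hy.1).1
    have h3 : K * volume.real (cylinder T P w n₀) ≤ 1 / 2 := by
      have h4 := (hn n₀ (le_max_left _ _) w hpos1).le
      calc K * volume.real (cylinder T P w n₀) ≤ K * (1 / (2 * K)) := by gcongr
        _ = 1 / 2 := by field_simp
    have h5 : |x - y| ≤ 1 / 2 * |T^[n₀] x - T^[n₀] y| :=
      h2.trans (mul_le_mul_of_nonneg_right h3 (abs_nonneg _))
    calc (2 : ℝ) ^ (q + 1) * |x - y| ≤ 2 ^ (q + 1) * (1 / 2 * |T^[n₀] x - T^[n₀] y|) := by gcongr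
      _ = 2 ^ q * |T^[n₀] x - T^[n₀] y| := by ring
      _ ≤ b - a := h1

variable [Nonempty ι] [Countable ι]

lemma ae_measure_code_pos (n : ℕ) : ∀ᵐ x ∂μ, 0 < μ (code T P n ⁻¹' {code T P n x}) := by
  have h : μ (⋃ v ∈ {v : Fin n → ι | μ (code T P n ⁻¹' {v}) = 0}, code T P n ⁻¹' {v}) = 0 :=
    (measure_biUnion_null_iff (to_countable _)).2 fun v hv => hv
  filter_upwards [measure_eq_zero_iff_ae_notMem.1 h] with x hx
  refine pos_iff_ne_zero.2 fun h0 => hx ?_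
  exact mem_biUnion (x := code T P n x) h0 rfl

/-- A labelling of the points by cells of diameter at most `3 r`, which depends only on finitely
many letters, and such that points at distance less than `r` have labels differing by at
most `3`: the integer part of `y / r`, where `y` is a chosen point of the cylinder. -/
lemma exists_cells (hT : IsPiecewiseExpanding (Icc a b) T P)
    (hμ : IsGibbsMeasure (Icc a b) T P μ) {n₀ q : ℕ}
    (hdiam : ∀ w : ℕ → ι, 0 < μ (cylinder T P w (q * n₀)) →
      ∀ x ∈ cylinder T P w (q * n₀), ∀ y ∈ cylinder T P w (q * n₀), x ∈ Icc a b → y ∈ Icc a b →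
        2 ^ q * |x - y| ≤ b - a) {r : ℝ} (hr : 0 < r) (hqr : b - a ≤ 2 ^ q * r) :
    ∃ (α : (Fin (q * n₀) → ι) → ℤ) (E : Set ℝ), (∀ᵐ x ∂μ, x ∈ E) ∧
      ∀ x ∈ E, ∀ y ∈ E,
        (α (code T P (q * n₀) x) = α (code T P (q * n₀) y) → |x - y| ≤ 3 * r) ∧
        (|x - y| < r → |α (code T P (q * n₀) x) - α (code T P (q * n₀) y)| ≤ 3) := by
  classical
  set h := q * n₀
  set Λ := repeller (Icc a b) T P
  set rep : (Fin h → ι) → ℝ := fun v =>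
    if hv : ∃ x, x ∈ Λ ∧ code T P h x = v then hv.choose else 0 with hrep
  have hrep' : ∀ x ∈ Λ, rep (code T P h x) ∈ Λ ∧ code T P h (rep (code T P h x)) = code T P h x :=
    fun x hx => by
      have hv : ∃ y, y ∈ Λ ∧ code T P h y = code T P h x := ⟨x, hx, rfl⟩
      simp only [hrep, dif_pos hv]
      exact hv.choose_spec
  set E := {x | x ∈ Λ ∧ 0 < μ (code T P h ⁻¹' {code T P h x})} with hE
  have hclose : ∀ x ∈ E, |rep (code T P h x) - x| ≤ r := fun x hx => by
    obtain ⟨h1, h2⟩ := hrep' x hx.1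
    have hpos : 0 < μ (cylinder T P (extendWord (code T P h x)) h) := by
      refine hx.2.trans_le (le_of_eq (measure_congr ?_))
      filter_upwards [ae_mem_repeller hμ] with y hy
      exact propext (mem_cylinder_iff_code hT hy).symm
    have h3 := hdiam _ hpos _ ((mem_cylinder_iff_code hT h1).2 h2) x
      ((mem_cylinder_iff_code hT hx.1).2 rfl) h1.1 hx.1.1
    exact le_of_mul_le_mul_left (h3.trans hqr) (by positivity)
  refine ⟨fun v => ⌊rep v / r⌋, E, ?_, fun x hx y hy => ⟨fun hxy => ?_, fun hxy => ?_⟩⟩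
  · filter_upwards [ae_mem_repeller hμ, ae_measure_code_pos (ι := ι) h] with x h1 h2 using ⟨h1, h2⟩
  · have h1 := Int.abs_sub_lt_one_of_floor_eq_floor hxy
    rw [← sub_div, abs_div, abs_of_pos hr, div_lt_one hr] at h1
    have h2 := abs_le.1 (hclose x hx)
    have h3 := abs_le.1 (hclose y hy)
    have h4 := abs_lt.1 h1
    rw [abs_le]
    constructor <;> linarith
  · have h2 := abs_le.1 (hclose x hx)
    have h3 := abs_le.1 (hclose y hy)
    have h4 := abs_lt.1 hxy
    have h5 : |rep (code T P h x) / r - rep (code T P h y) / r| < 3 := by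
      rw [← sub_div, abs_div, abs_of_pos hr, div_lt_iff₀ hr, abs_lt]
      constructor <;> linarith
    have h6 := abs_lt.1 h5
    have a1 := Int.floor_le (rep (code T P h x) / r)
    have a2 := Int.lt_floor_add_one (rep (code T P h x) / r)
    have a3 := Int.floor_le (rep (code T P h y) / r)
    have a4 := Int.lt_floor_add_one (rep (code T P h y) / r)
    rw [abs_le]
    constructor
    · have : ((-4 : ℤ) : ℝ) < ((⌊rep (code T P h x) / r⌋ - ⌊rep (code T P h y) / r⌋ : ℤ) : ℝ) := by
        push_cast; linarith
      have := Int.cast_lt.1 this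
      simp only
      omega
    · have : ((⌊rep (code T P h x) / r⌋ - ⌊rep (code T P h y) / r⌋ : ℤ) : ℝ) < ((4 : ℤ) : ℝ) := by
        push_cast; linarith
      have := Int.cast_lt.1 this
      simp only
      omega

end Cells

/-! ### The correlation integral and the collision probability -/

section Collision

variable {μ : Measure ℝ} [IsProbabilityMeasure μ]

lemma lintegral_cellMass_add_le {A : ℝ → ℤ} (hA : Measurable A) (e : ℤ) :
    ∫⁻ x, ENNReal.ofReal (cellMass μ A (A x + e)) ∂μ ≤ collisionProb μ A := by
  set p := cellMass μ A
  have hp0 : ∀ k, 0 ≤ p k := fun k => measureReal_nonneg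
  have hexp : ∀ F : ℤ → ℝ≥0∞, ∫⁻ x, F (A x) ∂μ = ∑' k, F k * ENNReal.ofReal (p k) := fun F => by
    rw [← lintegral_map (measurable_of_countable F) hA, lintegral_countable']
    congr 1 with k
    rw [Measure.map_apply hA (measurableSet_singleton k)]
    congr 1
    exact (ENNReal.ofReal_toReal (measure_ne_top _ _)).symm
  have h1 : ∫⁻ x, ENNReal.ofReal (p (A x + e)) ∂μ =
      ∑' k, ENNReal.ofReal (p (k + e)) * ENNReal.ofReal (p k) :=
    hexp fun k => ENNReal.ofReal (p (k + e))
  have h2 : collisionProb μ A = ∑' k, ENNReal.ofReal (p k) * ENNReal.ofReal (p k) :=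
    hexp fun k => ENNReal.ofReal (p k)
  have h3 : collisionProb μ A =
      ∑' k, ENNReal.ofReal (p (k + e)) * ENNReal.ofReal (p (k + e)) := by
    rw [h2]
    exact ((Equiv.addRight e).tsum_eq fun k => ENNReal.ofReal (p k) * ENNReal.ofReal (p k)).symm
  have h4 : 2 * ∫⁻ x, ENNReal.ofReal (p (A x + e)) ∂μ ≤ 2 * collisionProb μ A := by
    calc 2 * ∫⁻ x, ENNReal.ofReal (p (A x + e)) ∂μ
        ≤ ∑' k, (ENNReal.ofReal (p (k + e)) * ENNReal.ofReal (p (k + e)) +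
            ENNReal.ofReal (p k) * ENNReal.ofReal (p k)) := by
          rw [h1, ← ENNReal.tsum_mul_left]
          refine ENNReal.tsum_le_tsum fun k => ?_
          rw [← ENNReal.ofReal_mul (hp0 _), ← ENNReal.ofReal_mul (hp0 _),
            ← ENNReal.ofReal_mul (hp0 _), ← ENNReal.ofReal_add (mul_nonneg (hp0 _) (hp0 _))
              (mul_nonneg (hp0 _) (hp0 _)),
            show (2 : ℝ≥0∞) = ENNReal.ofReal 2 by simp, ← ENNReal.ofReal_mul (by norm_num)]
          refine ENNReal.ofReal_le_ofReal ?_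
          nlinarith [sq_nonneg (p (k + e) - p k)]
      _ = 2 * collisionProb μ A := by rw [ENNReal.tsum_add, ← h3, ← h2, two_mul]
  exact (ENNReal.mul_le_mul_iff_right (by norm_num) (by norm_num)).1 h4

/-- The correlation integral is comparable to the collision probability of the cells. -/
lemma lintegral_ball_le_collisionProb {A : ℝ → ℤ} (hA : Measurable A) {E : Set ℝ} {r : ℝ}
    (hE : ∀ᵐ x ∂μ, x ∈ E) (h : ∀ x ∈ E, ∀ y ∈ E, |x - y| < r → |A x - A y| ≤ 3) :
    ∫⁻ x, μ (Metric.ball x r) ∂μ ≤ 7 * collisionProb μ A := by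
  have hball : ∀ᵐ x ∂μ, μ (Metric.ball x r) ≤
      ∑ e ∈ Finset.Icc (-3 : ℤ) 3, ENNReal.ofReal (cellMass μ A (A x + e)) := by
    filter_upwards [hE] with x hx
    calc μ (Metric.ball x r) ≤ μ (⋃ e ∈ Finset.Icc (-3 : ℤ) 3, A ⁻¹' {A x + e}) := by
          refine measure_mono_ae ?_
          filter_upwards [hE] with y hy hyx
          have h1 := abs_le.1 (h y hy x hx (Metric.mem_ball.1 hyx))
          refine mem_biUnion (x := A y - A x) (Finset.mem_Icc.2 h1) ?_
          simp
      _ ≤ ∑ e ∈ Finset.Icc (-3 : ℤ) 3, μ (A ⁻¹' {A x + e}) := measure_biUnion_finset_le _ _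
      _ = _ := Finset.sum_congr rfl fun e _ => (ENNReal.ofReal_toReal (measure_ne_top _ _)).symm
  calc ∫⁻ x, μ (Metric.ball x r) ∂μ
      ≤ ∫⁻ x, ∑ e ∈ Finset.Icc (-3 : ℤ) 3, ENNReal.ofReal (cellMass μ A (A x + e)) ∂μ :=
        lintegral_mono_ae hball
    _ = ∑ e ∈ Finset.Icc (-3 : ℤ) 3, ∫⁻ x, ENNReal.ofReal (cellMass μ A (A x + e)) ∂μ :=
        lintegral_finsetSum _ fun e _ =>
          (measurable_of_countable fun k => ENNReal.ofReal (cellMass μ A (k + e))).comp hA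
    _ ≤ ∑ e ∈ Finset.Icc (-3 : ℤ) 3, collisionProb μ A :=
        Finset.sum_le_sum fun e _ => lintegral_cellMass_add_le hA e
    _ = 7 * collisionProb μ A := by simp

end Collision

/-! ### Dimension and closest-distance quotients -/

section Quotients

lemma le_log_div_iff {L s : ℝ} (hL : L < 0) {Z : ℝ≥0∞} :
    (s : EReal) ≤ ENNReal.log Z / (L : EReal) ↔ Z ≤ ENNReal.ofReal (Real.exp (s * L)) := by
  have h1 : (s : EReal) = ENNReal.log (ENNReal.ofReal (Real.exp (s * L))) / (L : EReal) := by
    rw [ENNReal.log_ofReal_of_pos (Real.exp_pos _), Real.log_exp, ← EReal.coe_div,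
      mul_div_cancel_right₀ _ hL.ne]
  rw [h1, (EReal.strictAnti_div_right_of_neg (EReal.coe_neg'.2 hL) (EReal.coe_ne_bot L)).le_iff_ge,
    ENNReal.log_le_log_iff]

lemma log_div_le_iff {L s : ℝ} (hL : L < 0) {Z : ℝ≥0∞} :
    ENNReal.log Z / (L : EReal) ≤ (s : EReal) ↔ ENNReal.ofReal (Real.exp (s * L)) ≤ Z := by
  have h1 : (s : EReal) = ENNReal.log (ENNReal.ofReal (Real.exp (s * L))) / (L : EReal) := by
    rw [ENNReal.log_ofReal_of_pos (Real.exp_pos _), Real.log_exp, ← EReal.coe_div,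
      mul_div_cancel_right₀ _ hL.ne]
  rw [h1, (EReal.strictAnti_div_right_of_neg (EReal.coe_neg'.2 hL) (EReal.coe_ne_bot L)).le_iff_ge,
    ENNReal.log_le_log_iff]

variable {μ : Measure ℝ} {r s : ℝ}

lemma le_corrRatio_iff (h0 : 0 < r) (h1 : r < 1) :
    (s : EReal) ≤ corrRatio μ r ↔ ∫⁻ x, μ (Metric.ball x r) ∂μ ≤ ENNReal.ofReal (r ^ s) := by
  rw [corrRatio, le_log_div_iff (Real.log_neg h0 h1), Real.rpow_def_of_pos h0, mul_comm]

lemma corrRatio_le_iff (h0 : 0 < r) (h1 : r < 1) :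
    corrRatio μ r ≤ (s : EReal) ↔ ENNReal.ofReal (r ^ s) ≤ ∫⁻ x, μ (Metric.ball x r) ∂μ := by
  rw [corrRatio, log_div_le_iff (Real.log_neg h0 h1), Real.rpow_def_of_pos h0, mul_comm]

variable {T : ℝ → ℝ} {x : ℝ} {n : ℕ}

lemma le_closestRatio_iff (hn : 2 ≤ n) :
    (s : EReal) ≤ closestRatio T x n ↔ closestDist T n x ≤ ENNReal.ofReal ((n : ℝ) ^ (-s)) := by
  have h1 : (1 : ℝ) < n := by exact_mod_cast hn
  rw [closestRatio, le_log_div_iff (neg_neg_of_pos (Real.log_pos h1)),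
    Real.rpow_def_of_pos (by linarith)]
  ring_nf

lemma closestRatio_le_iff (hn : 2 ≤ n) :
    closestRatio T x n ≤ (s : EReal) ↔ ENNReal.ofReal ((n : ℝ) ^ (-s)) ≤ closestDist T n x := by
  have h1 : (1 : ℝ) < n := by exact_mod_cast hn
  rw [closestRatio, log_div_le_iff (neg_neg_of_pos (Real.log_pos h1)),
    Real.rpow_def_of_pos (by linarith)]
  ring_nf

lemma closestDist_anti {m n : ℕ} (h : m ≤ n) : closestDist T n x ≤ closestDist T m x :=
  le_iInf fun i => le_iInf fun j => le_iInf fun hij =>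
    iInf_le_of_le i (iInf_le_of_le j (iInf_le_of_le ⟨hij.1, hij.2.trans_le h⟩ le_rfl))

lemma closestDist_le {i j : ℕ} (hij : i < j) (hj : j < n) :
    closestDist T n x ≤ edist (T^[i] x) (T^[j] x) :=
  iInf_le_of_le i (iInf_le_of_le j (iInf_le_of_le ⟨hij, hj⟩ le_rfl))

lemma exists_dyadic {n : ℕ} (hn : n ≠ 0) : 2 ^ Nat.log 2 n ≤ n ∧ n < 2 * 2 ^ Nat.log 2 n :=
  ⟨Nat.pow_log_le_self 2 hn, by
    have := Nat.lt_pow_succ_log_self (b := 2) one_lt_two n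
    rwa [pow_succ, mul_comm] at this⟩

lemma tendsto_log_two : Tendsto (Nat.log 2) atTop atTop :=
  tendsto_atTop_atTop.2 fun k => ⟨2 ^ k, fun _ hn =>
    Nat.le_log_of_pow_le one_lt_two hn⟩

/-- An upper bound on `m_n` along the powers of two gives a lower bound for the liminf. -/
lemma le_liminf_closestRatio {C : ℝ} (hC : 0 < C) (hs : 0 < s)
    (h : ∀ᶠ l : ℕ in atTop, closestDist T (2 ^ l) x ≤ ENNReal.ofReal (C * ((2 : ℝ) ^ l) ^ (-s))) :
    (s : EReal) ≤ liminf (closestRatio T x) atTop := by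
  refine EReal.ge_of_forall_gt_iff_ge.1 fun z hz => ?_
  have hz' : 0 < s - z := sub_pos.2 (EReal.coe_lt_coe_iff.1 hz)
  have hsmall : Tendsto (fun n : ℕ => C * 2 ^ s * (n : ℝ) ^ (-(s - z))) atTop (𝓝 0) := by
    simpa using ((tendsto_rpow_neg_atTop hz').comp tendsto_natCast_atTop_atTop).const_mul
      (C * 2 ^ s)
  refine le_liminf_of_le (by isBoundedDefault) ?_
  filter_upwards [tendsto_log_two.eventually h, eventually_ge_atTop 2,
    hsmall.eventually_le_const zero_lt_one] with n hn hn2 hn1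
  obtain ⟨h1, h2⟩ := exists_dyadic (n := n) (by omega)
  have hn0 : (0 : ℝ) < n := by exact_mod_cast (by omega : 0 < n)
  rw [le_closestRatio_iff hn2]
  refine (closestDist_anti h1).trans (hn.trans (ENNReal.ofReal_le_ofReal ?_))
  have h3 : (n : ℝ) / 2 ≤ 2 ^ Nat.log 2 n := by
    rw [div_le_iff₀ two_pos, mul_comm]
    exact_mod_cast h2.le
  calc C * ((2 : ℝ) ^ Nat.log 2 n) ^ (-s) ≤ C * ((n : ℝ) / 2) ^ (-s) := by
        gcongr ?_ * ?_
        exact Real.rpow_le_rpow_of_nonpos (by positivity) h3 (by linarith)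
    _ = C * 2 ^ s * (n : ℝ) ^ (-(s - z)) * (n : ℝ) ^ (-z) := by
        rw [mul_assoc _ ((n : ℝ) ^ _), ← Real.rpow_add hn0, Real.div_rpow hn0.le two_pos.le,
          Real.rpow_neg two_pos.le, div_inv_eq_mul]
        ring_nf
    _ ≤ 1 * (n : ℝ) ^ (-z) := by gcongr
    _ = _ := one_mul _

/-- A lower bound on `m_n` along the powers of two gives an upper bound for all `n`. -/
lemma eventually_closestRatio_le (hs : 0 < s)
    (h : ∀ᶠ l : ℕ in atTop, ENNReal.ofReal (((2 : ℝ) ^ l) ^ (-s)) ≤ closestDist T (2 * 2 ^ l) x) :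
    ∀ᶠ n in atTop, closestRatio T x n ≤ (s : EReal) := by
  filter_upwards [tendsto_log_two.eventually h, eventually_ge_atTop 2] with n hn hn2
  obtain ⟨h1, h2⟩ := exists_dyadic (n := n) (by omega)
  rw [closestRatio_le_iff hn2]
  refine le_trans ?_ (hn.trans (closestDist_anti h2.le))
  refine ENNReal.ofReal_le_ofReal ?_
  exact Real.rpow_le_rpow_of_nonpos (by positivity) (by exact_mod_cast h1) (by linarith)

end Quotients

/-! ### The lower bound for the closest distance quotient -/

section ClosestLower

lemma ae_eventually_notMem_of_geometric {μ : Measure ℝ} {D : ℕ → Set ℝ} {C ρ : ℝ} (hC : 0 ≤ C)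
    (hρ0 : 0 ≤ ρ) (hρ : ρ < 1) (h : ∀ᶠ l in atTop, μ (D l) ≤ ENNReal.ofReal (C * ρ ^ l)) :
    ∀ᵐ x ∂μ, ∀ᶠ l in atTop, x ∉ D l := by
  obtain ⟨l₀, hl₀⟩ := eventually_atTop.1 h
  have hsum : Summable fun l : ℕ => C * ρ ^ (l + l₀) :=
    ((summable_nat_add_iff l₀).2 (summable_geometric_of_lt_one hρ0 hρ)).mul_left C
  have hfin : ∑' l, μ (D (l + l₀)) ≠ ∞ := by
    refine ne_top_of_le_ne_top ?_ (ENNReal.tsum_le_tsum fun l => hl₀ (l + l₀) (by omega))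
    rw [← ENNReal.ofReal_tsum_of_nonneg (fun l => by positivity) hsum]
    exact ENNReal.ofReal_ne_top
  filter_upwards [ae_eventually_notMem hfin] with x hx
  filter_upwards [(tendsto_sub_atTop_nat l₀).eventually hx, eventually_ge_atTop l₀] with l hl hl'
  rwa [Nat.sub_add_cancel hl'] at hl

variable {ι : Type*} {a b : ℝ} {T : ℝ → ℝ} {P : ι → Set ℝ} {μ : Measure ℝ}

/-- If the correlation integral at scale `r` is at least `r ^ d`, then the orbit of almost every
point up to time `n` comes back within `3 n ^ (-s)` of itself for every `s < 2 / d`: the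
birthday problem for the `≈ n / log n` samples of the orbit labelled by cells of size `n ^ (-s)`. -/
lemma ae_eventually_closestDist_le [Countable ι] [Nonempty ι] (hab : a < b)
    (hT : IsPiecewiseExpanding (Icc a b) T P) (hD : HasBoundedDistortion T P)
    (hG : IsGibbsMarkov (Icc a b) T P) (hμ : IsGibbsMeasure (Icc a b) T P μ)
    (hdecay : HasExpDecay (Icc a b) T μ) (hna : ∀ x, μ {x} = 0) {s d : ℝ} (hs : 0 < s)
    (hsd : s * d < 2)
    (hZ : ∀ᶠ r in 𝓝[>] (0 : ℝ), ENNReal.ofReal (r ^ d) ≤ ∫⁻ x, μ (Metric.ball x r) ∂μ) :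
    ∀ᵐ x ∂μ, ∀ᶠ l : ℕ in atTop,
      closestDist T (2 ^ l) x ≤ ENNReal.ofReal (3 * ((2 : ℝ) ^ l) ^ (-s)) := by
  have := hμ.prob
  have hTm := hμ.invariant.measurable
  obtain ⟨n₀, hn₀, hdiam⟩ := exists_diam_bound hab hT hD hG hμ hdecay hna
  obtain ⟨κ, g, hκ, hmix⟩ := exists_hasLowerMixing hab.le hT hG hμ hdecay
  obtain ⟨c₀, hc₀⟩ := pow_unbounded_of_one_lt (b - a) (one_lt_two (α := ℝ))
  -- the scale, the number of letters that resolve it, and the number of samples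
  set r : ℕ → ℝ := fun l => ((2 : ℝ) ^ l) ^ (-s) with hr
  set q : ℕ → ℕ := fun l => ⌈l * s⌉₊ + c₀ + 1 with hq
  set W : ℕ → ℕ := fun l => 1 + g + (q l * n₀ + g) with hW
  set m : ℕ → ℕ := fun l => 2 ^ l / (3 * W l) with hm
  have hr0 : ∀ l, 0 < r l := fun l => by positivity
  have hrl : ∀ l : ℕ, r l = (2 : ℝ) ^ (-(l * s)) := fun l => by
    simp only [hr]
    rw [← Real.rpow_natCast, ← Real.rpow_mul two_pos.le]
    ring_nf
  have hqr : ∀ l, b - a ≤ 2 ^ q l * r l := fun l => by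
    have h2 : (c₀ : ℝ) ≤ (q l : ℝ) + -(l * s) := by
      have := Nat.le_ceil (l * s)
      simp only [hq]
      push_cast
      linarith
    rw [hrl, ← Real.rpow_natCast, ← Real.rpow_add two_pos]
    refine hc₀.le.trans ?_
    rw [← Real.rpow_natCast]
    exact Real.rpow_le_rpow_of_exponent_le one_le_two h2
  choose α E hE hcell using fun l => exists_cells hT hμ (hdiam (q l)) (hr0 l) (hqr l)
  set A : ℕ → ℝ → ℤ := fun l x => α l (code T P (q l * n₀) x) with hA
  have hAm : ∀ l, Measurable (A l) := fun l => measurable_comp_code hT hTm (α l)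
  have hqn : ∀ l, 1 ≤ q l * n₀ := fun l => Nat.mul_pos (by simp [hq]) hn₀
  -- there are many more than `1 / √s` samples
  have hcount : ∀ᶠ l : ℕ in atTop, 1 ≤ m l ∧
      (l : ℝ) ≤ κ * m l * √(collisionProb μ (A l)).toReal := by
    set ρ : ℝ := 2 ^ (1 - s * d / 2) with hρ
    have hρ1 : 1 < ρ := Real.one_lt_rpow one_lt_two (by linarith)
    set B : ℝ := 1 + 2 * g + n₀ * (s + 2 + c₀) with hB
    have hB0 : 0 < B := by positivity
    have hWB : ∀ l, 1 ≤ l → (W l : ℝ) ≤ 2 * B * l := fun l hl => by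
      have h1 : (⌈l * s⌉₊ : ℝ) ≤ l * s + 1 := (Nat.ceil_lt_add_one (by positivity)).le
      have hl' : (1 : ℝ) ≤ l := by exact_mod_cast hl
      have hg : (0 : ℝ) ≤ g := g.cast_nonneg
      have hc : (0 : ℝ) ≤ c₀ := c₀.cast_nonneg
      have h2 : (q l : ℝ) ≤ l * (s + 2 + c₀) := by
        simp only [hq]
        push_cast
        nlinarith
      have h3 : (q l : ℝ) * n₀ ≤ l * (s + 2 + c₀) * n₀ := by gcongr
      have h4 : (0 : ℝ) ≤ n₀ * (s + 2 + c₀) := by positivity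
      simp only [hW, hB]
      push_cast
      nlinarith
    have hlim : Tendsto (fun l => (r l : ℝ)) atTop (𝓝[>] 0) := by
      refine tendsto_nhdsWithin_iff.2 ⟨?_, Eventually.of_forall hr0⟩
      exact (tendsto_rpow_neg_atTop hs).comp (tendsto_pow_atTop_atTop_of_one_lt one_lt_two)
    have e1 : ∀ᶠ l : ℕ in atTop, 6 * B * ((l : ℝ) ^ 1 / 2 ^ l) ≤ 1 := by
      have := (tendsto_pow_const_div_const_pow_of_one_lt 1 (one_lt_two (α := ℝ))).const_mul (6 * B)
      rw [mul_zero] at this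
      exact this.eventually_le_const zero_lt_one
    have e2 : ∀ᶠ l : ℕ in atTop, 36 * B / κ * ((l : ℝ) ^ 2 / ρ ^ l) ≤ 1 := by
      have := (tendsto_pow_const_div_const_pow_of_one_lt 2 hρ1).const_mul (36 * B / κ)
      rw [mul_zero] at this
      exact this.eventually_le_const zero_lt_one
    filter_upwards [hlim.eventually hZ, e1, e2, eventually_ge_atTop 1] with l hl h1 h2 hl1
    have hW0 : 0 < W l := by simp only [hW]; omega
    have hW0' : (0 : ℝ) < W l := by exact_mod_cast hW0
    have hl0 : (0 : ℝ) < l := by exact_mod_cast hl1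
    have hm1 : 1 ≤ m l := by
      rw [hm, Nat.one_le_div_iff (by omega)]
      rw [pow_one, ← mul_div_assoc, div_le_one (by positivity)] at h1
      have := hWB l hl1
      have h3 : ((3 * W l : ℕ) : ℝ) ≤ ((2 ^ l : ℕ) : ℝ) := by push_cast; linarith
      exact_mod_cast h3
    refine ⟨hm1, ?_⟩
    have hmlow : (2 : ℝ) ^ l ≤ 6 * W l * m l := by
      have h3 : 2 ^ l < 3 * W l * (2 ^ l / (3 * W l) + 1) := Nat.lt_mul_div_succ _ (by omega)
      have h4 : 3 * W l * (m l + 1) ≤ 3 * W l * (m l + m l) := by gcongr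
      have h5 : 2 ^ l ≤ 6 * W l * m l := by
        refine (h3.le.trans h4).trans (le_of_eq ?_)
        ring
      exact_mod_cast h5
    have hcoll : r l ^ (d / 2) / 3 ≤ √(collisionProb μ (A l)).toReal := by
      refine Real.le_sqrt_of_sq_le ?_
      have hfin : collisionProb μ (A l) ≠ ∞ := by
        refine ne_top_of_le_ne_top ENNReal.one_ne_top ?_
        refine (lintegral_mono (g := fun _ => 1) fun x => ?_).trans (by simp)
        exact ENNReal.ofReal_le_one.2 measureReal_le_one
      have h3 := hl.trans (lintegral_ball_le_collisionProb (hAm l) (hE l)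
        fun x hx y hy => (hcell l x hx y hy).2)
      have h4 := ENNReal.toReal_mono (by finiteness) h3
      rw [ENNReal.toReal_ofReal (by positivity), ENNReal.toReal_mul] at h4
      have h5 : (r l ^ (d / 2)) ^ 2 = r l ^ d := by
        rw [← Real.rpow_natCast, ← Real.rpow_mul (hr0 l).le]
        congr 1
        push_cast
        ring
      have h6 : 0 ≤ r l ^ d := by positivity
      rw [div_pow, h5]
      norm_num at h4 ⊢
      linarith
    have hρl : ρ ^ l = 2 ^ l * r l ^ (d / 2) := by
      rw [hρ, hrl, ← Real.rpow_natCast, ← Real.rpow_natCast, ← Real.rpow_mul two_pos.le,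
        ← Real.rpow_mul two_pos.le, ← Real.rpow_add two_pos]
      congr 1
      ring
    have hlB : (l : ℝ) * (36 * B * l) ≤ κ * ρ ^ l := by
      have h3 : 36 * B / κ * ((l : ℝ) ^ 2 / ρ ^ l) = (l * (36 * B * l)) / (κ * ρ ^ l) := by
        field_simp
      rw [h3, div_le_one (by positivity)] at h2
      exact h2
    have h7 : (l : ℝ) * (18 * W l) ≤ κ * m l * √(collisionProb μ (A l)).toReal * (18 * W l) := by
      calc (l : ℝ) * (18 * W l) ≤ l * (18 * (2 * B * l)) := by gcongr; exact hWB l hl1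
        _ = l * (36 * B * l) := by ring
        _ ≤ κ * ρ ^ l := hlB
        _ = κ * 2 ^ l * r l ^ (d / 2) := by rw [hρl]; ring
        _ ≤ κ * (6 * W l * m l) * r l ^ (d / 2) := by gcongr
        _ = κ * m l * (r l ^ (d / 2) / 3) * (18 * W l) := by ring
        _ ≤ _ := by gcongr
    exact le_of_mul_le_mul_right h7 (by positivity)
  have hbad : ∀ᶠ l : ℕ in atTop, μ {x | ∀ i j, i < j → j < 2 * m l →
      A l (T^[1 + g + i * (q l * n₀ + g)] x) ≠ A l (T^[1 + g + j * (q l * n₀ + g)] x)} ≤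
      ENNReal.ofReal (1 * Real.exp (-(1 / 2)) ^ l) := by
    filter_upwards [hcount, eventually_ge_atTop 1] with l hl hl1
    refine (hmix.measure_distinct_le hT hTm hκ (hqn l) (α l) (by exact_mod_cast hl1)
      hl.2).trans (le_of_eq ?_)
    rw [one_mul, ← Real.exp_nat_mul]
    congr 2
    ring
  -- almost every orbit avoids the null set outside which the cells are under control
  have hgood : ∀ᵐ x ∂μ, ∀ l k, T^[k] x ∈ E l := ae_all_iff.2 fun l => ae_all_iff.2 fun k =>
    (hμ.invariant.iterate k).quasiMeasurePreserving.ae (hE l)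
  filter_upwards [ae_eventually_notMem_of_geometric zero_le_one (Real.exp_pos _).le
    (Real.exp_lt_one_iff.2 (by norm_num)) hbad, hgood] with x hx hxE
  filter_upwards [hx, hcount] with l hl hml
  simp only [not_forall, not_not] at hl
  obtain ⟨i, j, hij, hj, heq⟩ := hl
  have hW1 : q l * n₀ + g < W l := by simp only [hW]; omega
  have hlt : 1 + g + j * (q l * n₀ + g) < 2 ^ l := by
    have h1 : 3 * W l * m l ≤ 2 ^ l := Nat.mul_div_le _ _
    have h2 : (j + 1) * W l ≤ 2 * m l * W l := Nat.mul_le_mul_right _ hj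
    have h3 : j * (q l * n₀ + g) ≤ j * W l := Nat.mul_le_mul_left _ hW1.le
    have h4 : 1 + g ≤ W l := by simp only [hW]; omega
    have h5 : 0 < m l * W l := Nat.mul_pos hml.1 (by omega)
    nlinarith
  have hlt' : 1 + g + i * (q l * n₀ + g) < 1 + g + j * (q l * n₀ + g) := by
    have := hqn l
    have : i * (q l * n₀ + g) < j * (q l * n₀ + g) := Nat.mul_lt_mul_of_pos_right hij (by omega)
    omega
  refine (closestDist_le hlt' hlt).trans ?_
  rw [edist_dist, Real.dist_eq]
  exact ENNReal.ofReal_le_ofReal ((hcell l _ (hxE l _) _ (hxE l _)).1 heq)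

/-- An atom keeps the correlation integral away from `0`, which forces dimension `0`. -/
lemma measure_singleton_eq_zero_of_upperCorrDim_pos [IsProbabilityMeasure μ]
    (h : 0 < upperCorrDim μ) (x : ℝ) : μ {x} = 0 := by
  by_contra hx
  set p := μ.real {x} with hp
  have hp0 : 0 < p := ENNReal.toReal_pos hx (measure_ne_top _ _)
  have hZ : ∀ r : ℝ, 0 < r → ENNReal.ofReal (p ^ 2) ≤ ∫⁻ y, μ (Metric.ball y r) ∂μ := fun r hr => by
    calc ENNReal.ofReal (p ^ 2) = μ {x} * μ {x} := by
          rw [pow_two, ENNReal.ofReal_mul hp0.le, hp, measureReal_def,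
            ENNReal.ofReal_toReal (measure_ne_top _ _)]
      _ = ∫⁻ y in {x}, μ {x} ∂μ := by rw [setLIntegral_const]
      _ ≤ ∫⁻ y in {x}, μ (Metric.ball y r) ∂μ := by
          refine setLIntegral_mono' (measurableSet_singleton x) fun y hy => measure_mono ?_
          rw [mem_singleton_iff.1 hy, singleton_subset_iff]
          exact Metric.mem_ball_self hr
      _ ≤ _ := setLIntegral_le_lintegral _ _
  refine h.not_ge ?_
  refine EReal.le_of_forall_lt_iff_le.1 fun z hz => ?_
  have hz' : 0 < z := EReal.coe_pos.1 hz
  refine limsup_le_of_le (by isBoundedDefault) ?_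
  have hlim : Tendsto (fun r : ℝ => r ^ z) (𝓝[>] 0) (𝓝 0) := by
    have := (Real.continuousAt_rpow_const 0 z (Or.inr hz'.le)).tendsto
    rw [Real.zero_rpow hz'.ne'] at this
    exact this.mono_left nhdsWithin_le_nhds
  filter_upwards [hlim.eventually_le_const (show 0 < p ^ 2 by positivity),
    Ioo_mem_nhdsGT (zero_lt_one (α := ℝ))] with r hr hr1
  rw [corrRatio_le_iff hr1.1 hr1.2]
  exact (ENNReal.ofReal_le_ofReal hr).trans (hZ r hr1.1)

/-- The correlation integral of a probability measure on an interval of length `L` is at least of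
order `r / L`, by the Cauchy-Schwarz inequality for a partition into intervals of length `r`. -/
lemma ofReal_le_lintegral_ball [IsProbabilityMeasure μ] (hab : a < b) (hsupp : μ (Icc a b)ᶜ = 0)
    {r : ℝ} (hr : 0 < r) (hr1 : r < 1) :
    ENNReal.ofReal (r / (b - a + 1)) ≤ ∫⁻ x, μ (Metric.ball x r) ∂μ := by
  have hba : 0 < b - a := sub_pos.2 hab
  set N : ℕ := ⌊(b - a) / r⌋₊ + 1 with hN
  set J : ℕ → Set ℝ := fun k => Ico (a + k * r) (a + (k + 1) * r) with hJ
  have hJm : ∀ k, MeasurableSet (J k) := fun k => measurableSet_Ico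
  have hdisj : Pairwise (Function.onFun Disjoint J) := by
    have h : Monotone fun k : ℕ => a + k * r := fun i j hij => by
      have : (i : ℝ) ≤ j := by exact_mod_cast hij
      simp only
      gcongr
    have := h.pairwise_disjoint_on_Ico_succ
    simpa [hJ, Function.onFun] using this
  have hcover : Icc a b ⊆ ⋃ k ∈ Finset.range N, J k := fun x hx => by
    have h0 : 0 ≤ (x - a) / r := div_nonneg (by linarith [hx.1]) hr.le
    have h1 := Nat.floor_le h0
    have h2 := Nat.lt_floor_add_one ((x - a) / r)
    rw [le_div_iff₀ hr] at h1
    rw [div_lt_iff₀ hr] at h2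
    refine mem_biUnion (x := ⌊(x - a) / r⌋₊) ?_ ⟨by linarith, by linarith⟩
    have : ⌊(x - a) / r⌋₊ ≤ ⌊(b - a) / r⌋₊ := Nat.floor_le_floor (by gcongr; exact hx.2)
    exact Finset.mem_coe.2 (Finset.mem_range.2 (by omega))
  have hone : 1 ≤ ∑ k ∈ Finset.range N, μ.real (J k) := by
    have h1 : μ (Icc a b) = 1 := (prob_compl_eq_zero_iff measurableSet_Icc).1 hsupp
    have h2 : μ (⋃ k ∈ Finset.range N, J k) = 1 :=
      le_antisymm prob_le_one (h1.symm.le.trans (measure_mono hcover))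
    have h3 : μ.real (⋃ k ∈ Finset.range N, J k) = 1 := by rw [measureReal_def, h2]; simp
    rw [← h3]
    exact measureReal_biUnion_finset_le _ _
  have hsq : 1 / (N : ℝ) ≤ ∑ k ∈ Finset.range N, μ.real (J k) ^ 2 := by
    have h1 := sq_sum_le_card_mul_sum_sq (s := Finset.range N) (f := fun k => μ.real (J k))
    rw [Finset.card_range] at h1
    rw [div_le_iff₀' (by positivity)]
    nlinarith
  have hNr : r / (b - a + 1) ≤ 1 / N := by
    rw [div_le_div_iff₀ (by linarith) (by positivity)]
    have h1 := Nat.floor_le (div_nonneg hba.le hr.le)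
    rw [le_div_iff₀ hr] at h1
    simp only [hN]
    push_cast
    nlinarith
  calc ENNReal.ofReal (r / (b - a + 1))
      ≤ ENNReal.ofReal (∑ k ∈ Finset.range N, μ.real (J k) ^ 2) :=
        ENNReal.ofReal_le_ofReal (hNr.trans hsq)
    _ = ∑ k ∈ Finset.range N, μ (J k) * μ (J k) := by
        rw [ENNReal.ofReal_sum_of_nonneg fun k _ => by positivity]
        refine Finset.sum_congr rfl fun k _ => ?_
        rw [pow_two, ENNReal.ofReal_mul measureReal_nonneg, measureReal_def,
          ENNReal.ofReal_toReal (measure_ne_top _ _)]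
    _ ≤ ∑ k ∈ Finset.range N, ∫⁻ x in J k, μ (Metric.ball x r) ∂μ := by
        refine Finset.sum_le_sum fun k _ => ?_
        rw [← setLIntegral_const]
        refine setLIntegral_mono' (hJm k) fun x hx => measure_mono fun y hy => ?_
        rw [Metric.mem_ball, Real.dist_eq, abs_lt]
        have h1 := hx.1
        have h2 := hx.2
        have h3 := hy.1
        have h4 := hy.2
        constructor <;> linarith
    _ = ∫⁻ x in ⋃ k ∈ Finset.range N, J k, μ (Metric.ball x r) ∂μ := by
        rw [lintegral_biUnion_finset (fun i _ j _ hij => hdisj hij) fun k _ => hJm k]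
    _ ≤ _ := setLIntegral_le_lintegral _ _

lemma upperCorrDim_le_one [IsProbabilityMeasure μ] (hab : a < b) (hsupp : μ (Icc a b)ᶜ = 0) :
    upperCorrDim μ ≤ 1 := by
  refine EReal.le_of_forall_lt_iff_le.1 fun z hz => ?_
  have hz' : 0 < z - 1 := sub_pos.2 (by exact_mod_cast hz)
  refine limsup_le_of_le (by isBoundedDefault) ?_
  have hlim : Tendsto (fun r : ℝ => r ^ (z - 1)) (𝓝[>] 0) (𝓝 0) := by
    have := (Real.continuousAt_rpow_const 0 (z - 1) (Or.inr hz'.le)).tendsto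
    rw [Real.zero_rpow hz'.ne'] at this
    exact this.mono_left nhdsWithin_le_nhds
  filter_upwards [hlim.eventually_le_const (show 0 < 1 / (b - a + 1) by
    have := sub_pos.2 hab; positivity), Ioo_mem_nhdsGT (zero_lt_one (α := ℝ))] with r hr hr1
  rw [corrRatio_le_iff hr1.1 hr1.2]
  refine le_trans (ENNReal.ofReal_le_ofReal ?_) (ofReal_le_lintegral_ball hab hsupp hr1.1 hr1.2)
  have h1 : r ^ z = r * r ^ (z - 1) := by
    rw [Real.rpow_sub_one hr1.1.ne']
    field_simp [hr1.1.ne']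
  rw [h1, div_eq_mul_one_div]
  exact mul_le_mul_of_nonneg_left hr hr1.1.le

/-- The lower bound on the closest distance quotient in terms of the upper correlation dimension. -/
lemma ae_le_liminf_closestRatio [Countable ι] [Nonempty ι] (hab : a < b)
    (hT : IsPiecewiseExpanding (Icc a b) T P) (hD : HasBoundedDistortion T P)
    (hG : IsGibbsMarkov (Icc a b) T P) (hμ : IsGibbsMeasure (Icc a b) T P μ)
    (hdecay : HasExpDecay (Icc a b) T μ) (hdim : 0 < upperCorrDim μ) :
    ∀ᵐ x ∂μ, 2 / upperCorrDim μ ≤ liminf (closestRatio T x) atTop := by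
  have := hμ.prob
  have hna := measure_singleton_eq_zero_of_upperCorrDim_pos hdim
  have hle := upperCorrDim_le_one hab hμ.support
  obtain ⟨D, hDeq⟩ : ∃ D : ℝ, upperCorrDim μ = D := by
    refine ⟨(upperCorrDim μ).toReal, (EReal.coe_toReal ?_ ?_).symm⟩
    · exact (hle.trans_lt (EReal.coe_lt_top 1)).ne
    · exact (EReal.bot_lt_zero.trans hdim).ne'
  rw [hDeq] at hdim ⊢
  have hD0 : 0 < D := EReal.coe_pos.1 hdim
  have hquot : (2 : EReal) / (D : EReal) = ((2 / D : ℝ) : EReal) := by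
    rw [EReal.coe_div]; rfl
  rw [hquot]
  have key : ∀ s : ℚ, 0 < (s : ℝ) → (s : ℝ) < 2 / D →
      ∀ᵐ x ∂μ, ((s : ℝ) : EReal) ≤ liminf (closestRatio T x) atTop := fun s hs0 hs => by
    obtain ⟨d, hd1, hd2⟩ := exists_between ((lt_div_iff₀' hs0).2 ((lt_div_iff₀ hD0).1 hs))
    have hZ : ∀ᶠ r in 𝓝[>] (0 : ℝ), ENNReal.ofReal (r ^ d) ≤ ∫⁻ x, μ (Metric.ball x r) ∂μ := by
      have h1 : limsup (corrRatio μ) (𝓝[>] 0) < (d : EReal) := by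
        change upperCorrDim μ < _
        rw [hDeq]
        exact EReal.coe_lt_coe_iff.2 hd1
      filter_upwards [eventually_lt_of_limsup_lt h1, Ioo_mem_nhdsGT (zero_lt_one (α := ℝ))]
        with r hr hr1
      exact (corrRatio_le_iff hr1.1 hr1.2).1 hr.le
    filter_upwards [ae_eventually_closestDist_le hab hT hD hG hμ hdecay hna hs0
      ((lt_div_iff₀' hs0).1 hd2) hZ] with x hx
    exact le_liminf_closestRatio three_pos hs0 hx
  have key' : ∀ᵐ x ∂μ, ∀ s : ℚ, 0 < (s : ℝ) → (s : ℝ) < 2 / D →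
      ((s : ℝ) : EReal) ≤ liminf (closestRatio T x) atTop :=
    ae_all_iff.2 fun s => by
      by_cases h : 0 < (s : ℝ) ∧ (s : ℝ) < 2 / D
      · filter_upwards [key s h.1 h.2] with x hx _ _ using hx
      · exact Eventually.of_forall fun x h1 h2 => absurd ⟨h1, h2⟩ h
  filter_upwards [key'] with x hx
  refine EReal.ge_of_forall_gt_iff_ge.1 fun z hz => ?_
  have hz' : max z 0 < 2 / D := max_lt (EReal.coe_lt_coe_iff.1 hz) (by positivity)
  obtain ⟨s, hs1, hs2⟩ := exists_rat_btwn hz'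
  exact le_trans (EReal.coe_le_coe_iff.2 ((le_max_left _ _).trans hs1.le))
    (hx s ((le_max_right _ _).trans_lt hs1) hs2)

end ClosestLower

/-! ### Absolutely continuous Gibbs measures have bounded density -/

section Density

variable {ι : Type*} {a b : ℝ} {T : ℝ → ℝ} {P : ι → Set ℝ} {μ : Measure ℝ}

/-- Mixing for arbitrary Borel sets, in the form of an inequality; it follows from the decay of
correlations for functions of bounded variation by approximation in `L¹(μ)`. -/
lemma measure_mul_le_of_forall (hab : a ≤ b) (hTm : Measurable T) [IsProbabilityMeasure μ]
    (hdecay : HasExpDecay (Icc a b) T μ) {E B : Set ℝ} (hE : MeasurableSet E)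
    (hB : MeasurableSet B) {M : ℝ} (h : ∀ n, 1 ≤ n → μ.real (E ∩ T^[n] ⁻¹' B) ≤ M) :
    μ.real E * μ.real B ≤ M := by
  obtain ⟨C, c, hC, hc, hdec⟩ := hdecay
  refine le_of_forall_pos_le_add fun ε hε => ?_
  set f : ℝ → ℝ := E.indicator fun _ => (1 : ℝ) with hf
  have hfint : Integrable f μ := (integrable_const (1 : ℝ)).indicator hE
  -- a smooth approximation of the indicator is Lipschitz, hence of bounded variation
  obtain ⟨u, hu1, hu2, hu3⟩ := (memLp_one_iff_integrable.2 hfint).exist_eLpNorm_sub_le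
    ENNReal.one_ne_top le_rfl (show 0 < ε / 3 by positivity)
  have huint : Integrable u μ := hu2.continuous.integrable_of_hasCompactSupport hu1
  have hdiff : ∫ x, |f x - u x| ∂μ ≤ ε / 3 := by
    have h1 := (hfint.sub huint)
    have h2 : ENNReal.ofReal (∫ x, |f x - u x| ∂μ) ≤ ENNReal.ofReal (ε / 3) := by
      refine le_trans (le_of_eq ?_) hu3
      rw [eLpNorm_one_eq_lintegral_enorm, ← ofReal_integral_norm_eq_lintegral_enorm h1]
      rfl
    exact (ENNReal.ofReal_le_ofReal_iff (by positivity)).1 h2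
  have hbv : BoundedVariationOn u (Icc a b) := by
    obtain ⟨K, hK⟩ := hu2.lipschitzWith_of_hasCompactSupport hu1 (by simp)
    have := hK.locallyBoundedVariationOn (Icc a b) a b (left_mem_Icc.2 hab) (right_mem_Icc.2 hab)
    rwa [inter_self] at this
  set g : ℝ → ℝ := B.indicator fun _ => (1 : ℝ) with hg
  have hgint : Integrable g μ := (integrable_const (1 : ℝ)).indicator hB
  have hg0 : ∀ x, 0 ≤ g x ∧ g x ≤ 1 := fun x => by
    by_cases hx : x ∈ B <;> simp [hg, hx]
  have hgm : Measurable g := measurable_const.indicator hB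
  have hgB : ∫ x, g x ∂μ = μ.real B := integral_indicator_one hB
  have hfE : ∫ x, f x ∂μ = μ.real E := integral_indicator_one hE
  have hB1 : μ.real B ≤ 1 := measureReal_le_one
  have hB0 : 0 ≤ μ.real B := measureReal_nonneg
  have hlim : Tendsto (fun n : ℕ => bvNorm (Icc a b) u * (∫ x, |g x| ∂μ) *
      (C * Real.exp (-(c * n)))) atTop (𝓝 0) := by
    have h1 : Tendsto (fun n : ℕ => c * (n : ℝ)) atTop atTop :=
      tendsto_natCast_atTop_atTop.const_mul_atTop hc
    simpa using ((Real.tendsto_exp_neg_atTop_nhds_zero.comp h1).const_mul C).const_mul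
      (bvNorm (Icc a b) u * (∫ x, |g x| ∂μ))
  obtain ⟨n, hn, hn1⟩ := ((hlim.eventually_le_const (show 0 < ε / 3 by positivity)).and
    (eventually_ge_atTop 1)).exists
  have h1 := (abs_le.1 ((hdec u g hbv hgint n).trans hn)).1
  rw [hgB] at h1
  have hmul : ∀ v : ℝ → ℝ, Integrable v μ → Integrable (fun x => v x * g (T^[n] x)) μ :=
    fun v hv => hv.mul_bdd (c := 1) (hgm.comp (hTm.iterate n)).aestronglyMeasurable
      (.of_forall fun x => by
        rw [Real.norm_eq_abs, abs_of_nonneg (hg0 _).1]; exact (hg0 _).2)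
  have h2 : ∫ x, f x * g (T^[n] x) ∂μ = μ.real (E ∩ T^[n] ⁻¹' B) := by
    rw [← integral_indicator_one (hE.inter (hTm.iterate n hB))]
    congr 1 with x
    by_cases hx : x ∈ E <;> by_cases hy : T^[n] x ∈ B <;> simp [f, g, hx, hy]
  have h3 : ∫ x, u x * g (T^[n] x) ∂μ - ∫ x, f x * g (T^[n] x) ∂μ ≤ ε / 3 := by
    rw [← integral_sub (hmul u huint) (hmul f hfint)]
    refine le_trans (integral_mono ((hmul u huint).sub (hmul f hfint))
      (hfint.sub huint).abs fun x => ?_) hdiff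
    have h4 := neg_abs_le (f x - u x)
    have h5 := abs_nonneg (f x - u x)
    have h6 := hg0 (T^[n] x)
    simp only [Pi.sub_apply]
    nlinarith
  have h4 : ∫ x, f x ∂μ - ∫ x, u x ∂μ ≤ ε / 3 := by
    rw [← integral_sub hfint huint]
    exact le_trans (integral_mono (hfint.sub huint) (hfint.sub huint).abs
      fun x => le_abs_self _) hdiff
  have h5 := h n hn1
  rw [hfE] at h4
  rw [h2] at h3
  nlinarith

variable [Countable ι] [Nonempty ι]

lemma tsum_volume_cylinder_le (hT : IsPiecewiseExpanding (Icc a b) T P)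
    (hG : IsGibbsMarkov (Icc a b) T P) {n : ℕ} (hn : 1 ≤ n) :
    ∑' v : Fin n → ι, volume (cylinder T P (extendWord v) n) ≤ ENNReal.ofReal (b - a) := by
  rw [← measure_iUnion _ fun v => measurableSet_cylinder hT hG n _, ← Real.volume_Icc]
  · exact measure_mono (iUnion_subset fun v => hT.cylinder_subset _ hn)
  · intro v v' hne
    refine disjoint_left.2 fun x hx hx' => hne (funext fun i => ?_)
    rw [← extendWord_apply v, ← extendWord_apply v']
    exact hT.eq_of_mem (hx i i.2) (hx' i i.2)

/-- A density bound that holds on each cylinder sums up to a bound by the length of `X`. -/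
lemma measure_le_of_cylinder (hT : IsPiecewiseExpanding (Icc a b) T P)
    (hG : IsGibbsMarkov (Icc a b) T P) (hμ : IsGibbsMeasure (Icc a b) T P μ) {n : ℕ} (hn : 1 ≤ n)
    {S : Set ℝ} {c : ℝ≥0∞} (h : ∀ w : ℕ → ι,
      μ (S ∩ cylinder T P w n) ≤ c * volume (cylinder T P w n)) :
    μ S ≤ c * ENNReal.ofReal (b - a) := by
  rw [measure_eq_tsum_cylinder hT hμ Measure.AbsolutelyContinuous.rfl n S]
  refine (ENNReal.tsum_le_tsum fun v => h (extendWord v)).trans ?_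
  rw [ENNReal.tsum_mul_left]
  gcongr
  exact tsum_volume_cylinder_le hT hG hn

/-- An absolutely continuous Gibbs measure has bounded density: the push-forwards under iterates of
its part of density at most `k` have uniformly bounded density by distortion, and they converge to
a multiple of the whole measure by mixing. -/
lemma exists_bounded_density (hab : a < b) (hT : IsPiecewiseExpanding (Icc a b) T P)
    (hD : HasBoundedDistortion T P) (hG : IsGibbsMarkov (Icc a b) T P)
    (hμ : IsGibbsMeasure (Icc a b) T P μ) (hdecay : HasExpDecay (Icc a b) T μ)
    (hac : μ ≪ volume) :
    ∃ M : ℝ, 0 < M ∧ ∀ B, MeasurableSet B → μ B ≤ ENNReal.ofReal M * volume B := by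
  have := hμ.prob
  have hTm := hμ.invariant.measurable
  obtain ⟨K, hK, hdist⟩ := exists_distortion hT hD hG
  have hba : 0 < b - a := sub_pos.2 hab
  set ρ := μ.rnDeriv volume with hρ
  have hρm : Measurable ρ := Measure.measurable_rnDeriv _ _
  obtain ⟨k, hk⟩ : ∃ k : ℕ, μ {x | ρ x ≤ k} ≠ 0 := by
    by_contra! hcon
    have h1 : ∀ᵐ x ∂μ, ρ x < ∞ := hac.ae_le (Measure.rnDeriv_lt_top μ volume)
    have h2 : ∀ᵐ x ∂μ, x ∉ ⋃ k : ℕ, {x | ρ x ≤ k} :=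
      measure_eq_zero_iff_ae_notMem.1 (measure_iUnion_null hcon)
    obtain ⟨x, hx1, hx2⟩ := (h1.and h2).exists
    obtain ⟨k, hk⟩ := ENNReal.exists_nat_gt hx1.ne
    exact hx2 (mem_iUnion.2 ⟨k, hk.le⟩)
  set E := {x | ρ x ≤ k} with hE
  have hEm : MeasurableSet E := measurableSet_le hρm measurable_const
  have hEle : ∀ A, MeasurableSet A → μ (E ∩ A) ≤ k * volume A := fun A hA => by
    rw [← Measure.setLIntegral_rnDeriv hac]
    refine (setLIntegral_mono' (hEm.inter hA) fun x hx => hx.1).trans ?_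
    rw [setLIntegral_const]
    gcongr
    exact inter_subset_right
  have hβ : 0 < μ.real E := ENNReal.toReal_pos hk (measure_ne_top _ _)
  set M := (k + 1) * K * (b - a) / μ.real E with hM
  refine ⟨M, by positivity, fun B hB => ?_⟩
  by_cases hBfin : volume B = ∞
  · rw [hBfin, ENNReal.mul_top (by simpa using by positivity)]
    exact le_top
  have hpush : ∀ n, 1 ≤ n → μ.real (E ∩ T^[n] ⁻¹' B) ≤ (k + 1) * K * (b - a) * volume.real B := by
    intro n hn
    have h1 : μ (E ∩ T^[n] ⁻¹' B) ≤
        (k * (ENNReal.ofReal K * volume B)) * ENNReal.ofReal (b - a) := by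
      refine measure_le_of_cylinder hT hG hμ hn fun w => ?_
      set I := cylinder T P w n
      have hIm : MeasurableSet I := measurableSet_cylinder hT hG n w
      have hIX : I ⊆ Icc a b := hT.cylinder_subset w hn
      have hIfin : volume I ≠ ∞ := ((measure_mono hIX).trans_lt (by simp)).ne
      have hAm : MeasurableSet (T^[n] ⁻¹' B ∩ I) := (hTm.iterate n hB).inter hIm
      have h2 := ((hdist n w hn).2 _ (inter_subset_right (s := T^[n] ⁻¹' B)) hAm).1
      have h3 : volume.real (T^[n] '' (T^[n] ⁻¹' B ∩ I)) ≤ volume.real B :=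
        measureReal_mono (image_subset_iff.2 inter_subset_left) hBfin
      have h4 : volume (T^[n] ⁻¹' B ∩ I) ≤ ENNReal.ofReal K * volume B * volume I := by
        rw [← ENNReal.ofReal_toReal hBfin, ← ENNReal.ofReal_toReal hIfin,
          ← ENNReal.ofReal_mul hK.le, ← ENNReal.ofReal_mul (by positivity)]
        refine ENNReal.le_ofReal_iff_toReal_le ?_ (by positivity) |>.2 ?_
        · exact ((measure_mono inter_subset_right).trans_lt hIfin.lt_top).ne
        · refine h2.trans ?_
          rw [mul_right_comm]
          exact mul_le_mul_of_nonneg_right (mul_le_mul_of_nonneg_left h3 hK.le) measureReal_nonneg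
            |>.trans' (le_of_eq (by ring))
      rw [inter_assoc, mul_assoc]
      exact (hEle _ hAm).trans (by gcongr)
    have h5 := ENNReal.toReal_mono (by finiteness) h1
    simp only [ENNReal.toReal_mul, ENNReal.toReal_natCast, ENNReal.toReal_ofReal hK.le,
      ENNReal.toReal_ofReal hba.le, ← measureReal_def] at h5
    refine h5.trans ?_
    have h6 : 0 ≤ K * volume.real B * (b - a) := by positivity
    nlinarith
  have hmix := measure_mul_le_of_forall hab.le hTm hdecay hEm hB hpush
  rw [← ENNReal.ofReal_toReal (measure_ne_top μ B), ← ENNReal.ofReal_toReal hBfin,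
    ← ENNReal.ofReal_mul (by positivity)]
  refine ENNReal.ofReal_le_ofReal ?_
  rw [hM, div_mul_eq_mul_div, le_div_iff₀ hβ, mul_comm]
  exact hmix

end Density

/-! ### Short returns -/

section Returns

variable {ι : Type*} {a b : ℝ} {T : ℝ → ℝ} {P : ι → Set ℝ} {μ : Measure ℝ} [Countable ι]
  [Nonempty ι]

lemma volume_le_of_forall_abs_sub_le {S : Set ℝ} {d : ℝ} (h : ∀ x ∈ S, ∀ y ∈ S, |x - y| ≤ d) :
    volume S ≤ ENNReal.ofReal d := by
  refine (Real.volume_le_diam S).trans (Metric.ediam_le fun x hx y hy => ?_)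
  rw [edist_dist, Real.dist_eq]
  exact ENNReal.ofReal_le_ofReal (h x hx y hy)

/-- On a short cylinder `T^k` expands, so the points that return close to themselves at time `k`
form a set of diameter proportional to the length of the cylinder. -/
lemma volume_return_le {K : ℝ} (hK : 0 < K) {I : Set ℝ} {f : ℝ → ℝ}
    (hdist : ∀ x ∈ I, ∀ y ∈ I, |x - y| ≤ K * volume.real I * |f x - f y|)
    (hfin : volume I ≠ ∞) (hshort : volume.real I ≤ 1 / (2 * K)) {r : ℝ} (hr : 0 < r) :
    volume ({x | |f x - x| < r} ∩ I) ≤ ENNReal.ofReal (4 * K * r) * volume I := by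
  rw [← ENNReal.ofReal_toReal hfin, ← ENNReal.ofReal_mul (by positivity)]
  refine volume_le_of_forall_abs_sub_le fun x hx y hy => ?_
  have h1 := hdist x hx.2 y hy.2
  have hx1 : |f x - x| < r := hx.1
  have hy1 : |f y - y| < r := hy.1
  have h2 : |f x - f y| ≤ |x - y| + 2 * r := by
    calc |f x - f y| = |(f x - x) + (x - y) + (y - f y)| := by ring_nf
      _ ≤ |f x - x| + |x - y| + |y - f y| := abs_add_three _ _ _
      _ ≤ _ := by rw [abs_sub_comm y]; linarith
  have hI0 : 0 ≤ volume.real I := measureReal_nonneg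
  have h3 : K * volume.real I ≤ 1 / 2 := by
    calc K * volume.real I ≤ K * (1 / (2 * K)) := by gcongr
      _ = 1 / 2 := by field_simp
  have h4 : K * volume.real I * |f x - f y| ≤ K * volume.real I * (|x - y| + 2 * r) := by gcongr
  have h5 : K * volume.real I * |x - y| ≤ 1 / 2 * |x - y| :=
    mul_le_mul_of_nonneg_right h3 (abs_nonneg _)
  rw [← measureReal_def]
  nlinarith

/-- The points of an interval `I` that are moved out of `I` by less than `r` lie within `r` of its
endpoints. -/
lemma volume_exit_le {I : Set ℝ} (hI : I.OrdConnected) (hbb : BddBelow I) (hba : BddAbove I)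
    {f : ℝ → ℝ} {r : ℝ} (hr : 0 < r) :
    volume {x | x ∈ I ∧ f x ∉ I ∧ |f x - x| < r} ≤ ENNReal.ofReal (2 * r) := by
  have hsub : {x | x ∈ I ∧ f x ∉ I ∧ |f x - x| < r} ⊆
      Icc (sInf I) (sInf I + r) ∪ Icc (sSup I - r) (sSup I) := by
    rintro x ⟨hx, hfx, hlt⟩
    have hlt' := abs_lt.1 hlt
    rcases lt_or_ge (f x) x with h | h
    · refine Or.inl ⟨csInf_le hbb hx, ?_⟩
      have : f x ≤ sInf I := le_csInf ⟨x, hx⟩ fun y hy => by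
        by_contra hlt
        exact hfx (hI.out hy hx ⟨(not_le.1 hlt).le, h.le⟩)
      linarith
    · refine Or.inr ⟨?_, le_csSup hba hx⟩
      have : sSup I ≤ f x := csSup_le ⟨x, hx⟩ fun y hy => by
        by_contra hlt
        exact hfx (hI.out hx hy ⟨h, (not_le.1 hlt).le⟩)
      linarith
  refine (measure_mono hsub).trans ((measure_union_le _ _).trans (le_of_eq ?_))
  rw [Real.volume_Icc, Real.volume_Icc, ← ENNReal.ofReal_add (by linarith) (by linarith)]
  ring_nf

/-- The set of points that return within `r` of themselves at time `k ≥ 1` has measure of order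
at most `r`, uniformly in `k`. -/
lemma exists_measure_return_le (hab : a < b) (hT : IsPiecewiseExpanding (Icc a b) T P)
    (hD : HasBoundedDistortion T P) (hG : IsGibbsMarkov (Icc a b) T P)
    (hμ : IsGibbsMeasure (Icc a b) T P μ) (hdecay : HasExpDecay (Icc a b) T μ)
    (hac : μ ≪ volume) :
    ∃ C : ℝ, 0 ≤ C ∧ ∀ k, 1 ≤ k → ∀ r, 0 < r →
      μ {x | |T^[k] x - x| < r} ≤ ENNReal.ofReal (C * r) := by
  have hTm := hμ.invariant.measurable
  have hba : 0 < b - a := sub_pos.2 hab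
  obtain ⟨K, hK, hdist⟩ := exists_distortion hT hD hG
  obtain ⟨M, hM, hdens⟩ := exists_bounded_density hab hT hD hG hμ hdecay hac
  set η := 1 / (2 * K) with hη
  have hη0 : 0 < η := by positivity
  obtain ⟨k₀, hk₀⟩ := exists_forall_cylinder_volume_lt hab hT hD hG hμ hdecay
    (fun x => hac (Real.volume_singleton)) hη0
  have hfin : ∀ w k, 1 ≤ k → volume (cylinder T P w k) ≠ ∞ := fun w k hk =>
    ((measure_mono (hT.cylinder_subset w hk)).trans_lt (by simp)).ne
  have hRm : ∀ k r, MeasurableSet {x | |T^[k] x - x| < r} := fun k r =>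
    measurableSet_lt ((hTm.iterate k).sub measurable_id).abs measurable_const
  have hgood : ∀ (w : ℕ → ι) k, 1 ≤ k → volume.real (cylinder T P w k) ≤ η → ∀ r, 0 < r →
      μ ({x | |T^[k] x - x| < r} ∩ cylinder T P w k) ≤
        ENNReal.ofReal (M * (4 * K * r)) * volume (cylinder T P w k) := fun w k hk hv r hr => by
    rw [ENNReal.ofReal_mul hM.le, mul_assoc]
    refine (hdens _ ((hRm k r).inter (measurableSet_cylinder hT hG k w))).trans ?_
    gcongr
    exact volume_return_le hK (fun x hx y hy => ((hdist k w hk).1 x hx y hy).1) (hfin w k hk) hv hr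
  -- long return times: all cylinders of positive measure are short
  have hlong : ∀ k, k₀ ≤ k → 1 ≤ k → ∀ r, 0 < r →
      μ {x | |T^[k] x - x| < r} ≤ ENNReal.ofReal (M * (4 * K) * (b - a) * r) := by
    intro k hk hk1 r hr
    refine (measure_le_of_cylinder hT hG hμ hk1 (c := ENNReal.ofReal (M * (4 * K * r)))
      fun w => ?_).trans (le_of_eq ?_)
    · by_cases h0 : μ (cylinder T P w k) = 0
      · exact (measure_mono_null inter_subset_right h0).le.trans zero_le
      · exact hgood w k hk1 (hk₀ k hk w (pos_iff_ne_zero.2 h0)).le r hr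
    · rw [← ENNReal.ofReal_mul (by positivity)]
      ring_nf
  -- on a long cylinder `T^k` is Lipschitz, so that returns at time `k` lead to returns at time
  -- `2 k`, except near the endpoints of the cylinder
  have hdouble : ∀ k, 1 ≤ k →
      (∃ C : ℝ, 0 ≤ C ∧ ∀ r, 0 < r → μ {x | |T^[2 * k] x - x| < r} ≤ ENNReal.ofReal (C * r)) →
      ∃ C : ℝ, 0 ≤ C ∧ ∀ r, 0 < r → μ {x | |T^[k] x - x| < r} ≤ ENNReal.ofReal (C * r) := by
    rintro k hk ⟨C, hC, hCr⟩
    set L := 1 + K / η with hL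
    have hL0 : 0 < L := by positivity
    set c := M * (4 * K) + M * (2 / η) with hc
    refine ⟨C * L + c * (b - a), by positivity, fun r hr => ?_⟩
    set S := {x | |T^[k] x - x| < r} \ {x | |T^[2 * k] x - x| < L * r} with hS
    have hSbound : μ S ≤ ENNReal.ofReal (c * r) * ENNReal.ofReal (b - a) := by
      refine measure_le_of_cylinder hT hG hμ hk fun w => ?_
      set I := cylinder T P w k with hI
      have hIo : I.OrdConnected := ordConnected_cylinder hT hG k w
      rcases le_total (volume.real I) η with hv | hv
      · refine (measure_mono (inter_subset_inter_left _ sdiff_subset)).trans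
          ((hgood w k hk hv r hr).trans ?_)
        refine mul_le_mul_left (ENNReal.ofReal_le_ofReal ?_) _
        rw [hc, add_mul]
        have : 0 ≤ M * (2 / η) * r := by positivity
        linarith
      · have hsub : S ∩ I ⊆ {x | x ∈ I ∧ T^[k] x ∉ I ∧ |T^[k] x - x| < r} := by
          rintro x ⟨⟨hx1, hx2⟩, hxI⟩
          have hx1' : |T^[k] x - x| < r := hx1
          refine ⟨hxI, fun hmem => hx2 ?_, hx1⟩
          have h1 := ((hdist k w hk).1 _ hmem _ hxI).2
          have h2 : |T^[2 * k] x - T^[k] x| ≤ K / η * |T^[k] x - x| := by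
            rw [two_mul, Function.iterate_add_apply, div_mul_eq_mul_div, le_div_iff₀ hη0, mul_comm]
            exact (mul_le_mul_of_nonneg_right hv (abs_nonneg _)).trans h1
          have h3 : K / η * |T^[k] x - x| ≤ K / η * r := by gcongr
          have h4 := abs_sub_le (T^[2 * k] x) (T^[k] x) x
          change |T^[2 * k] x - x| < L * r
          rw [hL, add_mul, one_mul]
          linarith
        have hX := hT.cylinder_subset w hk
        calc μ (S ∩ I) ≤ ENNReal.ofReal M * volume (S ∩ I) :=
              hdens _ (((hRm _ _).diff (hRm _ _)).inter (measurableSet_cylinder hT hG k w))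
          _ ≤ ENNReal.ofReal M * ENNReal.ofReal (2 * r) := by
              gcongr
              exact (measure_mono hsub).trans
                (volume_exit_le hIo (bddBelow_Icc.mono hX) (bddAbove_Icc.mono hX) hr)
          _ ≤ ENNReal.ofReal (c * r) * volume I := by
              rw [← ENNReal.ofReal_toReal (hfin w k hk), ← ENNReal.ofReal_mul hM.le,
                ← ENNReal.ofReal_mul (by positivity)]
              refine ENNReal.ofReal_le_ofReal ?_
              rw [← measureReal_def]
              calc M * (2 * r) = M * (2 / η) * r * η := by field_simp
                _ ≤ c * r * volume.real I := by
                  gcongr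
                  rw [hc]
                  have : 0 ≤ M * (4 * K) := by positivity
                  linarith
    have hcov : {x | |T^[k] x - x| < r} ⊆ {x | |T^[2 * k] x - x| < L * r} ∪ S := fun x hx => by
      by_cases h : x ∈ {x | |T^[2 * k] x - x| < L * r}
      · exact Or.inl h
      · exact Or.inr ⟨hx, h⟩
    refine (measure_mono hcov).trans ((measure_union_le _ _).trans
      ((add_le_add (hCr _ (by positivity)) hSbound).trans (le_of_eq ?_)))
    rw [← ENNReal.ofReal_mul (by positivity), ← ENNReal.ofReal_add (by positivity) (by positivity)]
    ring_nf
  -- doubling the return time finitely often makes it long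
  have hall : ∀ j k, 1 ≤ k → k₀ ≤ 2 ^ j * k →
      ∃ C : ℝ, 0 ≤ C ∧ ∀ r, 0 < r → μ {x | |T^[k] x - x| < r} ≤ ENNReal.ofReal (C * r) := by
    intro j
    induction j with
    | zero => exact fun k hk hk' => ⟨_, by positivity, hlong k (by simpa using hk') hk⟩
    | succ j ih =>
      intro k hk hk'
      exact hdouble k hk (ih (2 * k) (by omega) (by rw [pow_succ] at hk'; linarith))
  have hevery : ∀ k, ∃ C : ℝ, 0 ≤ C ∧ (1 ≤ k →
      ∀ r, 0 < r → μ {x | |T^[k] x - x| < r} ≤ ENNReal.ofReal (C * r)) := fun k => by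
    by_cases hk : 1 ≤ k
    · obtain ⟨C, hC, h⟩ := hall k₀ k hk
        ((Nat.lt_two_pow_self).le.trans (Nat.le_mul_of_pos_right _ hk))
      exact ⟨C, hC, fun _ => h⟩
    · exact ⟨0, le_rfl, fun h => absurd h hk⟩
  choose C hC hCk using hevery
  refine ⟨M * (4 * K) * (b - a) + ∑ k ∈ Finset.range k₀, C k,
    add_nonneg (by positivity) (Finset.sum_nonneg fun k _ => hC k), fun k hk r hr => ?_⟩
  have hsum0 : 0 ≤ ∑ k ∈ Finset.range k₀, C k := Finset.sum_nonneg fun k _ => hC k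
  rcases lt_or_ge k k₀ with h | h
  · refine (hCk k hk r hr).trans (ENNReal.ofReal_le_ofReal ?_)
    gcongr
    have h1 := Finset.single_le_sum (f := C) (fun k _ => hC k) (Finset.mem_range.2 h)
    have : 0 ≤ M * (4 * K) * (b - a) := by positivity
    linarith
  · refine (hlong k h hk r hr).trans (ENNReal.ofReal_le_ofReal ?_)
    gcongr
    linarith

end Returns

/-! ### The absolutely continuous case -/

section AbsolutelyContinuous

variable {ι : Type*} {a b : ℝ} {T : ℝ → ℝ} {P : ι → Set ℝ} {μ : Measure ℝ}

lemma one_le_lowerCorrDim [IsProbabilityMeasure μ] {M : ℝ} (hM : 0 < M)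
    (h : ∀ B, MeasurableSet B → μ B ≤ ENNReal.ofReal M * volume B) : 1 ≤ lowerCorrDim μ := by
  refine EReal.ge_of_forall_gt_iff_ge.1 fun z hz => ?_
  have hz' : 0 < 1 - z := sub_pos.2 (by exact_mod_cast hz)
  refine le_liminf_of_le (by isBoundedDefault) ?_
  have hlim : Tendsto (fun r : ℝ => 2 * M * r ^ (1 - z)) (𝓝[>] 0) (𝓝 0) := by
    have := (Real.continuousAt_rpow_const 0 (1 - z) (Or.inr hz'.le)).tendsto.const_mul (2 * M)
    rw [Real.zero_rpow hz'.ne', mul_zero] at this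
    exact this.mono_left nhdsWithin_le_nhds
  filter_upwards [hlim.eventually_le_const zero_lt_one, Ioo_mem_nhdsGT (zero_lt_one (α := ℝ))]
    with r hr hr1
  rw [le_corrRatio_iff hr1.1 hr1.2]
  calc ∫⁻ x, μ (Metric.ball x r) ∂μ ≤ ∫⁻ _, ENNReal.ofReal (M * (2 * r)) ∂μ := by
        refine lintegral_mono fun x => (h _ measurableSet_ball).trans (le_of_eq ?_)
        rw [Real.volume_ball, ← ENNReal.ofReal_mul hM.le]
    _ = ENNReal.ofReal (M * (2 * r)) := by simp
    _ ≤ ENNReal.ofReal (r ^ z) := by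
        refine ENNReal.ofReal_le_ofReal ?_
        have h1 : r = r ^ (1 - z) * r ^ z := by
          rw [← Real.rpow_add hr1.1, sub_add_cancel, Real.rpow_one]
        calc M * (2 * r) = 2 * M * r ^ (1 - z) * r ^ z := by rw [mul_assoc (2 * M), ← h1]; ring
          _ ≤ 1 * r ^ z := by gcongr; exact Real.rpow_nonneg hr1.1.le _
          _ = r ^ z := one_mul _

/-- If returns at scale `r` have measure of order `r`, then almost surely `m_n ≥ n ^ (-s)`
eventually, for each `s > 2`: there are fewer than `n ^ 2` pairs of times. -/
lemma ae_eventually_le_closestDist (hinv : MeasurePreserving T μ μ) {C s : ℝ} (hC : 0 ≤ C)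
    (hret : ∀ k, 1 ≤ k → ∀ r, 0 < r → μ {x | |T^[k] x - x| < r} ≤ ENNReal.ofReal (C * r))
    (hs : 2 < s) : ∀ᵐ x ∂μ, ∀ᶠ l : ℕ in atTop,
      ENNReal.ofReal (((2 : ℝ) ^ l) ^ (-s)) ≤ closestDist T (2 * 2 ^ l) x := by
  have hTm := hinv.measurable
  have hbound : ∀ l : ℕ,
      μ {x | closestDist T (2 * 2 ^ l) x < ENNReal.ofReal (((2 : ℝ) ^ l) ^ (-s))} ≤
      ENNReal.ofReal (4 * C * ((2 : ℝ) ^ (2 - s)) ^ l) := fun l => by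
    set n := 2 * 2 ^ l with hn
    set r : ℝ := ((2 : ℝ) ^ l) ^ (-s) with hr
    have hr0 : 0 < r := by positivity
    have hsub : {x | closestDist T n x < ENNReal.ofReal r} ⊆ ⋃ i ∈ Finset.range n,
        ⋃ k ∈ Finset.range n, T^[i] ⁻¹' {x | |T^[k + 1] x - x| < r} := fun x hx => by
      have hx' : closestDist T n x < ENNReal.ofReal r := hx
      simp only [closestDist, iInf_lt_iff] at hx'
      obtain ⟨i, j, ⟨hij, hj⟩, hlt⟩ := hx'
      refine mem_biUnion (x := i) (Finset.mem_coe.2 (Finset.mem_range.2 (hij.trans hj)))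
        (mem_biUnion (x := j - i - 1) (Finset.mem_coe.2 (Finset.mem_range.2 (by omega))) ?_)
      rw [edist_dist, ENNReal.ofReal_lt_ofReal_iff hr0, dist_comm, Real.dist_eq] at hlt
      change |T^[j - i - 1 + 1] (T^[i] x) - T^[i] x| < r
      rwa [← Function.iterate_add_apply, show j - i - 1 + 1 + i = j by omega]
    calc μ {x | closestDist T n x < ENNReal.ofReal r}
        ≤ ∑ i ∈ Finset.range n, ∑ k ∈ Finset.range n,
            μ (T^[i] ⁻¹' {x | |T^[k + 1] x - x| < r}) :=
          (measure_mono hsub).trans ((measure_biUnion_finset_le _ _).trans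
            (Finset.sum_le_sum fun i _ => measure_biUnion_finset_le _ _))
      _ ≤ ∑ i ∈ Finset.range n, ∑ k ∈ Finset.range n, ENNReal.ofReal (C * r) := by
          refine Finset.sum_le_sum fun i _ => Finset.sum_le_sum fun k _ => ?_
          have hm : MeasurableSet {x | |T^[k + 1] x - x| < r} :=
            measurableSet_lt ((hTm.iterate (k + 1)).sub measurable_id).abs measurable_const
          rw [(hinv.iterate i).measure_preimage hm.nullMeasurableSet]
          exact hret (k + 1) (by omega) r hr0
      _ = ENNReal.ofReal ((n : ℝ) * (n * (C * r))) := by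
          simp only [Finset.sum_const, Finset.card_range, nsmul_eq_mul]
          rw [ENNReal.ofReal_mul n.cast_nonneg, ENNReal.ofReal_mul n.cast_nonneg,
            ENNReal.ofReal_natCast]
      _ = _ := by
          congr 1
          have h1 : ((2 : ℝ) ^ (2 - s)) ^ l = 2 ^ l * 2 ^ l * r := by
            rw [hr, ← Real.rpow_natCast, ← Real.rpow_natCast, ← Real.rpow_mul two_pos.le,
              ← Real.rpow_mul two_pos.le, ← Real.rpow_add two_pos, ← Real.rpow_add two_pos]
            congr 1
            ring
          rw [h1, hn]
          push_cast
          ring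
  filter_upwards [ae_eventually_notMem_of_geometric (by positivity) (by positivity)
    (Real.rpow_lt_one_of_one_lt_of_neg one_lt_two (by linarith)) (Eventually.of_forall hbound)]
    with x hx
  filter_upwards [hx] with l hl
  exact not_lt.1 hl

lemma ae_limsup_closestRatio_le (hinv : MeasurePreserving T μ μ) {C : ℝ} (hC : 0 ≤ C)
    (hret : ∀ k, 1 ≤ k → ∀ r, 0 < r → μ {x | |T^[k] x - x| < r} ≤ ENNReal.ofReal (C * r)) :
    ∀ᵐ x ∂μ, limsup (closestRatio T x) atTop ≤ 2 := by
  have key : ∀ᵐ x ∂μ, ∀ s : ℚ, 2 < (s : ℝ) →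
      limsup (closestRatio T x) atTop ≤ ((s : ℝ) : EReal) := ae_all_iff.2 fun s => by
    by_cases hs : 2 < (s : ℝ)
    · filter_upwards [ae_eventually_le_closestDist hinv hC hret hs] with x hx _
      exact limsup_le_of_le (by isBoundedDefault)
        (eventually_closestRatio_le (by linarith) hx)
    · exact Eventually.of_forall fun x h => absurd h hs
  filter_upwards [key] with x hx
  refine EReal.le_of_forall_lt_iff_le.1 fun z hz => ?_
  have hz' : (2 : ℝ) < z := EReal.coe_lt_coe_iff.1 hz
  obtain ⟨s, hs1, hs2⟩ := exists_rat_btwn hz'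
  exact (hx s hs1).trans (EReal.coe_le_coe_iff.2 hs2.le)

end AbsolutelyContinuous

end GibbsMarkov

theorem theorem1p2 {ι : Type*} [Countable ι] (a b : ℝ) (hab : a < b)
    (T : ℝ → ℝ) (P : ι → Set ℝ) (μ : Measure ℝ)
    (hT : GibbsMarkov.IsPiecewiseExpanding (Icc a b) T P)
    (hdist : GibbsMarkov.HasBoundedDistortion T P)
    (hGM : GibbsMarkov.IsGibbsMarkov (Icc a b) T P)
    (hμ : GibbsMarkov.IsGibbsMeasure (Icc a b) T P μ)
    (hdecay : GibbsMarkov.HasExpDecay (Icc a b) T μ) :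
    (0 < GibbsMarkov.upperCorrDim μ →
      ∀ᵐ x ∂μ, x ∈ GibbsMarkov.repeller (Icc a b) T P →
        2 / GibbsMarkov.upperCorrDim μ ≤ liminf (GibbsMarkov.closestRatio T x) atTop) ∧
    (μ ≪ volume →
      GibbsMarkov.lowerCorrDim μ = 1 ∧ GibbsMarkov.upperCorrDim μ = 1 ∧
      ∀ᵐ x ∂μ, Tendsto (GibbsMarkov.closestRatio T x) atTop
        (𝓝 (2 / GibbsMarkov.upperCorrDim μ))) := by
  have := hμ.prob
  have : Nonempty ι := by
    obtain ⟨x, hx⟩ := (GibbsMarkov.ae_mem_repeller hμ).exists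
    exact ⟨(mem_iUnion.1 (hx.2 0)).choose⟩
  refine ⟨fun hdim => ?_, fun hac => ?_⟩
  · filter_upwards [GibbsMarkov.ae_le_liminf_closestRatio hab hT hdist hGM hμ hdecay hdim]
      with x hx _ using hx
  · obtain ⟨M, hM, hdens⟩ := GibbsMarkov.exists_bounded_density hab hT hdist hGM hμ hdecay hac
    obtain ⟨C, hC, hret⟩ := GibbsMarkov.exists_measure_return_le hab hT hdist hGM hμ hdecay hac
    have h1 : 1 ≤ GibbsMarkov.lowerCorrDim μ := GibbsMarkov.one_le_lowerCorrDim hM hdens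
    have h2 : GibbsMarkov.upperCorrDim μ ≤ 1 := GibbsMarkov.upperCorrDim_le_one hab hμ.support
    have h3 : GibbsMarkov.lowerCorrDim μ ≤ GibbsMarkov.upperCorrDim μ := liminf_le_limsup
    have hup : GibbsMarkov.upperCorrDim μ = 1 := le_antisymm h2 (h1.trans h3)
    refine ⟨le_antisymm (h3.trans h2) h1, hup, ?_⟩
    have hpos : 0 < GibbsMarkov.upperCorrDim μ := by rw [hup]; exact zero_lt_one
    have hquot : (2 : EReal) / GibbsMarkov.upperCorrDim μ = 2 := by
      rw [hup, div_one]
    filter_upwards [GibbsMarkov.ae_le_liminf_closestRatio hab hT hdist hGM hμ hdecay hpos,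
      GibbsMarkov.ae_limsup_closestRatio_le hμ.invariant hC hret] with x hx1 hx2
    exact tendsto_of_le_liminf_of_limsup_le hx1 (hx2.trans hquot.ge)
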